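/- Let $n\ge 3$, let $\mathbf d=(d_1,\dots,d_n)$ be positive integers and let $\boldsymbol\gamma=(\gamma_1,\dots,\gamma_n)\in\mathbb C^n$ with $\Re\gamma_j>0$ for all $j$. Let $\zeta_{n,\mathbf d,\boldsymbol\gamma}(\mathbf s)$ denote the meromorphic continuation to $\mathbb C^n$ of $$\sum_{m_1,\dots,m_n\ge 1}\ \prod_{j=1}^n\bigl(\gamma_1m_1^{d_1}+\dots+\gamma_jm_j^{d_j}\bigr)^{-s_j},$$ a series that converges absolutely for $\Re(s_j+\dots+s_n)>\frac1{d_j}+\dots+\frac1{d_n}$ $(1\le j\le n)$; put $\mathbf d'=(d_1,\dots,d_{n-1})$ and $\boldsymbol\gamma'=(\gamma_1,\dots,\gamma_{n-1})$. Assume that for all $1\le j\le n$ and $\varepsilon_{j+1},\dots,\varepsilon_n\in\{0,1\}$, $$\frac1{d_j}+\sum_{k=j+1}^n\frac{\varepsilon_k}{d_k}\in\mathbb Z\iff j=2\text{ and }\varepsilon_3=\dots=\varepsilon_n=1,$$ so that $b:=\sum_{k=2}^n 1/d_k$ is a positive integer. Let $\mathbf N=(N_1,\dots,N_n)$ be non-negative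 integers, $|\mathbf N|=N_1+\dots+N_n$, and let $\boldsymbol\theta\in\mathbb C^n$ satisfy $\theta_n\ne0$ and $\theta_2+\dots+\theta_n\neq0$. Let $B_k$ be the Bernoulli numbers, $X/(e^X-1)=\sum_k B_kX^k/k!$. Then $-\mathbf N+t\boldsymbol\theta$ is a regular point of $\zeta_{n,\mathbf d,\boldsymbol\gamma}$ for all small $t\in\mathbb C\setminus\{0\}$, the limit below exists, and $$\lim_{t\to0,\ t\in\mathbb C\setminus\{0\}}\zeta_{n,\mathbf d,\boldsymbol\gamma}(-\mathbf N+t\boldsymbol\theta)=C\,B_{d_1(|\mathbf N|+b)+1}\Bigl(\gamma_1^{|\mathbf N|+b}\prod_{j=2}^n\gamma_j^{-1/d_j}\Bigr)\frac{\theta_n}{\theta_2+\dots+\theta_n}\prod_{j=2}^n\Gamma\Bigl(\frac1{d_j}\Bigr)+H,$$ where $$C=\prod_{j=3}^n\ \prod_{u=-N_{j-1}-\dots-N_n}^{-N_j-\dots-N_n-1}\Bigl(u-\sum_{k=j}^n\frac1{d_k}\Bigr)\cdot\frac{(-1)^{N_2+\dots+N_{n-1}+b+d_1(|\mathbf N|+b)}\,N_n!}{(N_2+\dots+N_n+b)!\,\bigl(\prod_{j=2}^nd_j\bigr)\,\bigl(d_1(|\mathbf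 N|+b)+1\bigr)}$$ is a nonzero rational number, and $$\begin{aligned}H=&-\tfrac12\,\zeta_{n-1,\mathbf d',\boldsymbol\gamma'}(-N_1,\dots,-N_{n-2},-N_{n-1}-N_n)\\&-\sum_{\substack{1\le k\le\lfloor(1+d_nN_n)/2\rfloor\\ d_n\mid 2k-1}}\frac{B_{2k}}{2k}\binom{N_n}{(2k-1)/d_n}\gamma_n^{(2k-1)/d_n}\,\zeta_{n-1,\mathbf d',\boldsymbol\gamma'}\Bigl(-N_1,\dots,-N_{n-2},-N_{n-1}-N_n+\tfrac{2k-1}{d_n}\Bigr)\end{aligned}$$ (all points occurring here are regular points of $\zeta_{n-1,\mathbf d',\boldsymbol\gamma'}$) belongs to $\mathbb Q(\gamma_1,\dots,\gamma_n)$. -/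

import Mathlib

open Filter Topology

noncomputable section

/-- A function of several complex variables is meromorphic on the whole space: near every point it
is a quotient `g / h` of two holomorphic functions, where `h` does not vanish identically near the
point.  (The values of `F` on the zero set of `h` are left free.) -/
def IsMeromorphicSV {n : ℕ} (F : (Fin n → ℂ) → ℂ) : Prop :=
  ∀ z, ∃ g h : (Fin n → ℂ) → ℂ, AnalyticAt ℂ g z ∧ AnalyticAt ℂ h z ∧
    (∃ᶠ w in 𝓝 z, h w ≠ 0) ∧ ∀ᶠ w in 𝓝 z, h w ≠ 0 → F w = g w / h w

/-- The general term `1 / ∏ⱼ (γ₁ m₁^{d₁} + ⋯ + γⱼ mⱼ^{dⱼ})^{sⱼ}` of the series (principal powers;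
the bases have positive real part). -/
def zetaTerm {n : ℕ} (d : Fin n → ℕ) (γ s : Fin n → ℂ) (m : Fin n → ℕ+) : ℂ :=
  1 / ∏ j, (∑ k ∈ Finset.Iic j, γ k * ((m k : ℕ) : ℂ) ^ d k) ^ s j

/-- The domain of absolute convergence
`Re (sⱼ + ⋯ + sₙ) > 1/dⱼ + ⋯ + 1/dₙ` for `1 ≤ j ≤ n`. -/
def convDomain {n : ℕ} (d : Fin n → ℕ) : Set (Fin n → ℂ) :=
  {s | ∀ j, ∑ k ∈ Finset.Ici j, (1 / (d k : ℝ)) < (∑ k ∈ Finset.Ici j, s k).re}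

/-- `F` is a meromorphic continuation to `ℂⁿ` of the series `∑ₘ zetaTerm d γ s m`, which is part of
the requirement to converge (unconditionally, hence absolutely) on the domain `convDomain d`. -/
structure IsZetaContinuation {n : ℕ} (d : Fin n → ℕ) (γ : Fin n → ℂ)
    (F : (Fin n → ℂ) → ℂ) : Prop where
  meromorphic : IsMeromorphicSV F
  hasSum : ∀ s ∈ convDomain d, HasSum (zetaTerm d γ s) (F s)

/-- `s` is a regular point of the meromorphic continuation of the series. -/
def ZetaRegularAt {n : ℕ} (d : Fin n → ℕ) (γ s : Fin n → ℂ) : Prop :=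
  ∃ F, IsZetaContinuation d γ F ∧ AnalyticAt ℂ F s

open Classical in
/-- The value at the regular point `s` of the meromorphic continuation `ζ_{n,d,γ}` of the series
(and `0` if `s` is not a regular point).  It does not depend on the chosen continuation: see
`IsZetaContinuation.eq_of_analyticAt`. -/
def zetaCont {n : ℕ} (d : Fin n → ℕ) (γ s : Fin n → ℂ) : ℂ :=
  if h : ZetaRegularAt d γ s then h.choose s else 0

/-- Uniqueness of meromorphic continuation. -/
theorem IsZetaContinuation.eq_of_analyticAt {n : ℕ} {d : Fin n → ℕ} {γ s : Fin n → ℂ}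
    {F₁ F₂ : (Fin n → ℂ) → ℂ} (h₁ : IsZetaContinuation d γ F₁) (h₂ : IsZetaContinuation d γ F₂)
    (a₁ : AnalyticAt ℂ F₁ s) (a₂ : AnalyticAt ℂ F₂ s) : F₁ s = F₂ s := by
  let T : Set (Fin n → ℂ) := {z | ∃ᶠ w in 𝓝 z, F₁ =ᶠ[𝓝 w] F₂}
  have hTclosed : IsClosed T := by
    have : T = closure {w | F₁ =ᶠ[𝓝 w] F₂} := by
      ext z
      exact mem_closure_iff_frequently.symm
    rw [this]
    exact isClosed_closure
  have hTopen : IsOpen T := by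
    rw [isOpen_iff_mem_nhds]
    intro z hz
    obtain ⟨g₁, k₁, ag₁, ak₁, f₁, e₁⟩ := h₁.meromorphic z
    obtain ⟨g₂, k₂, ag₂, ak₂, f₂, e₂⟩ := h₂.meromorphic z
    have hev := ag₁.eventually_analyticAt.and (ak₁.eventually_analyticAt.and
      (ag₂.eventually_analyticAt.and (ak₂.eventually_analyticAt.and (e₁.and e₂))))
    obtain ⟨r, hr, hball⟩ := Metric.eventually_nhds_iff_ball.1 hev
    have hpre : IsPreconnected (Metric.ball z r) := (convex_ball z r).isPreconnected
    have hk₁ : AnalyticOnNhd ℂ k₁ (Metric.ball z r) := fun w hw => (hball w hw).2.1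
    have hk₂ : AnalyticOnNhd ℂ k₂ (Metric.ball z r) := fun w hw => (hball w hw).2.2.2.1
    have hg₁ : AnalyticOnNhd ℂ g₁ (Metric.ball z r) := fun w hw => (hball w hw).1
    have hg₂ : AnalyticOnNhd ℂ g₂ (Metric.ball z r) := fun w hw => (hball w hw).2.2.1
    have hmem : Metric.ball z r ∈ 𝓝 z := Metric.ball_mem_nhds z hr
    -- a product of two nonzero germs is nonzero, at every point of the ball
    have hnz : ∀ k : (Fin n → ℂ) → ℂ, AnalyticOnNhd ℂ k (Metric.ball z r) →
        (∃ᶠ w in 𝓝 z, k w ≠ 0) → ∀ v ∈ Metric.ball z r, ∃ᶠ w in 𝓝 v, k w ≠ 0 := by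
      intro k hk hf v hv hcon
      have h0 : k =ᶠ[𝓝 v] 0 := by
        filter_upwards [hcon] with w hw
        simpa using hw
      have := hk.eqOn_zero_of_preconnected_of_eventuallyEq_zero hpre hv h0
      apply hf
      filter_upwards [hmem] with w hw
      simpa using this hw
    have hprod : ∀ v ∈ Metric.ball z r, ∃ᶠ w in 𝓝 v, k₁ w * k₂ w ≠ 0 := by
      intro v hv hcon
      have hbv : ∀ᶠ w in 𝓝 v, w ∈ Metric.ball z r := Metric.isOpen_ball.mem_nhds hv
      obtain ⟨w, hw, hcw, hbw⟩ := ((hnz k₁ hk₁ f₁ v hv).and_eventually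
        (hcon.eventually_nhds.and hbv)).exists
      apply hnz k₂ hk₂ f₂ w hbw
      have hne : ∀ᶠ u in 𝓝 w, k₁ u ≠ 0 := (hk₁ w hbw).continuousAt.eventually_ne hw
      filter_upwards [hcw, hne] with u hu hu1
      intro hu2
      exact hu (mul_ne_zero hu1 hu2)
    obtain ⟨w, hw, hbw⟩ := (hz.and_eventually hmem).exists
    have hP : AnalyticOnNhd ℂ (fun u => (g₁ u * k₂ u - g₂ u * k₁ u) * (k₁ u * k₂ u))
        (Metric.ball z r) :=
      ((hg₁.mul hk₂).sub (hg₂.mul hk₁)).mul (hk₁.mul hk₂)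
    have hP0 : (fun u => (g₁ u * k₂ u - g₂ u * k₁ u) * (k₁ u * k₂ u)) =ᶠ[𝓝 w] 0 := by
      filter_upwards [hw, Metric.isOpen_ball.mem_nhds hbw] with u hu hbu
      by_cases c₁ : k₁ u = 0
      · simp [c₁]
      by_cases c₂ : k₂ u = 0
      · simp [c₂]
      have q₁ := (hball u hbu).2.2.2.2.1 c₁
      have q₂ := (hball u hbu).2.2.2.2.2 c₂
      rw [hu, q₂, div_eq_div_iff c₂ c₁] at q₁
      simp [q₁]
    have hPall := hP.eqOn_zero_of_preconnected_of_eventuallyEq_zero hpre hbw hP0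
    filter_upwards [hmem] with v hv
    have hbv : ∀ᶠ w in 𝓝 v, w ∈ Metric.ball z r := Metric.isOpen_ball.mem_nhds hv
    refine ((hprod v hv).and_eventually hbv).mono ?_
    rintro u ⟨hu, hbu⟩
    have hne : ∀ᶠ x in 𝓝 u, k₁ x * k₂ x ≠ 0 :=
      ((hk₁ u hbu).mul (hk₂ u hbu)).continuousAt.eventually_ne hu
    filter_upwards [hne, Metric.isOpen_ball.mem_nhds hbu] with x hx hbx
    have c₁ : k₁ x ≠ 0 := left_ne_zero_of_mul hx
    have c₂ : k₂ x ≠ 0 := right_ne_zero_of_mul hx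
    rw [(hball x hbx).2.2.2.2.1 c₁, (hball x hbx).2.2.2.2.2 c₂, div_eq_div_iff c₁ c₂]
    have := hPall hbx
    simp only [Pi.zero_apply, mul_eq_zero, c₁, c₂, or_self, or_false] at this
    exact sub_eq_zero.1 this
  have hDopen : IsOpen (convDomain d) := by
    have : convDomain d = ⋂ j, {s : Fin n → ℂ | ∑ k ∈ Finset.Ici j, (1 / (d k : ℝ)) <
        (∑ k ∈ Finset.Ici j, s k).re} := by
      ext s
      simp [convDomain]
    rw [this]
    exact isOpen_iInter_of_finite fun j => isOpen_lt continuous_const (by fun_prop)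
  have hDne : (fun k => ((1 / (d k : ℝ) + 1 : ℝ) : ℂ)) ∈ convDomain d := by
    intro j
    rw [← Complex.ofReal_sum, Complex.ofReal_re]
    exact Finset.sum_lt_sum_of_nonempty ⟨j, Finset.mem_Ici.2 le_rfl⟩ fun k _ => by linarith
  have hTne : T.Nonempty := by
    refine ⟨fun k => ((1 / (d k : ℝ) + 1 : ℝ) : ℂ), Eventually.frequently ?_⟩
    filter_upwards [hDopen.mem_nhds hDne] with w hw
    filter_upwards [hDopen.mem_nhds hw] with x hx
    exact (h₁.hasSum x hx).unique (h₂.hasSum x hx)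
  have hT : T = Set.univ := IsClopen.eq_univ ⟨hTclosed, hTopen⟩ hTne
  have hs : ∃ᶠ w in 𝓝 s, F₁ w = F₂ w := by
    have : s ∈ T := hT ▸ Set.mem_univ s
    exact Frequently.mono this fun w hw => hw.eq_of_nhds
  by_contra hne
  have hcont : ContinuousAt (fun w => F₁ w - F₂ w) s := a₁.continuousAt.sub a₂.continuousAt
  have := hcont.eventually_ne (sub_ne_zero.2 hne)
  exact hs (this.mono fun w hw h => hw (sub_eq_zero.2 h))

/-- At a point where some continuation is holomorphic, `zetaCont` is its value. -/
theorem IsZetaContinuation.zetaCont_eq {n : ℕ} {d : Fin n → ℕ} {γ s : Fin n → ℂ}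
    {F : (Fin n → ℂ) → ℂ} (h : IsZetaContinuation d γ F) (a : AnalyticAt ℂ F s) :
    zetaCont d γ s = F s := by
  have hr : ZetaRegularAt d γ s := ⟨F, h, a⟩
  rw [zetaCont, dif_pos hr]
  exact hr.choose_spec.1.eq_of_analyticAt h hr.choose_spec.2 a

/-- The tail `xⱼ + ⋯ + xₙ` of a vector, with `j` counted from `1`. -/
def tailSum {n : ℕ} {R : Type*} [AddCommMonoid R] (x : Fin n → R) (j : ℕ) : R :=
  ∑ k : Fin n with j ≤ k.val + 1, x k

/-- The reciprocals `1/dⱼ`. -/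
def recip {n : ℕ} (d : Fin n → ℕ) : Fin n → ℚ := fun k => 1 / (d k : ℚ)

/-- The constant `C(N, d)`, a rational number; here `n = m + 1`. -/
def constC {m : ℕ} (d N : Fin (m + 1) → ℕ) (b : ℕ) : ℚ :=
  (∏ j ∈ Finset.Icc 3 (m + 1),
    ∏ u ∈ Finset.Ico (-((tailSum N (j - 1) : ℕ) : ℤ)) (-((tailSum N j : ℕ) : ℤ)),
      ((u : ℚ) - tailSum (recip d) j)) *
  (((-1) ^ ((∑ k : Fin (m + 1) with 2 ≤ k.val + 1 ∧ k.val + 1 ≤ m, N k) + b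
        + d 0 * ((∑ k, N k) + b)) * ((N (Fin.last m)).factorial : ℚ)) /
    (((tailSum N 2 + b).factorial : ℚ) * (∏ k : Fin (m + 1) with 2 ≤ k.val + 1, (d k : ℚ)) *
      ((d 0 : ℚ) * ((∑ k, N k : ℕ) + b) + 1)))

/-- The point `(-N₁, …, -N_{n-2}, -N_{n-1} - Nₙ + r)` of `ℂ^{n-1}`; here `n = m + 1`. -/
def mergedPoint {m : ℕ} (N : Fin (m + 1) → ℕ) (r : ℕ) : Fin m → ℂ := fun i =>
  if (i : ℕ) + 1 = m then -(N i.castSucc : ℂ) - (N (Fin.last m) : ℂ) + (r : ℂ)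
  else -(N i.castSucc : ℂ)

/-- The indices `1 ≤ k ≤ [(1 + dₙ Nₙ)/2]` with `dₙ ∣ 2k - 1`. -/
def indexH {m : ℕ} (d N : Fin (m + 1) → ℕ) : Finset ℕ :=
  {k ∈ Finset.Icc 1 ((1 + d (Fin.last m) * N (Fin.last m)) / 2) | d (Fin.last m) ∣ 2 * k - 1}

/-- The term `H_{n,d,γ}(N)`; here `n = m + 1`, and `Fin.init` drops the last entry of a vector. -/
def termH {m : ℕ} (d : Fin (m + 1) → ℕ) (γ : Fin (m + 1) → ℂ) (N : Fin (m + 1) → ℕ) : ℂ :=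
  -(1 / 2) * zetaCont (n := m) (Fin.init d) (Fin.init γ) (mergedPoint N 0) -
  ∑ k ∈ indexH d N,
    ((bernoulli (2 * k) : ℚ) : ℂ) / (2 * (k : ℂ)) *
      ((N (Fin.last m)).choose ((2 * k - 1) / d (Fin.last m)) : ℂ) *
      γ (Fin.last m) ^ ((2 * k - 1) / d (Fin.last m)) *
      zetaCont (n := m) (Fin.init d) (Fin.init γ)
        (mergedPoint N ((2 * k - 1) / d (Fin.last m)))

end

/-!
The series is continued by summing over the last index first. For `Re x > 0`, the Mellin transform
of the theta function `∑_{a ≥ 1} exp (-γ a ^ d t)`, whose asymptotic expansion at `t = 0` comes from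
Euler–Maclaurin summation, gives `∑_{a ≥ 1} (x + γ a ^ d) ^ (-s)` as
`G s * x ^ (1 / d - s) + ∑_{k < K} b_k s * x ^ (-s - k) + J_K s x / Γ s`
with `G s = Γ(1/d) γ ^ (-1/d) / d * Γ(s - 1/d) / Γ s` and polynomials `b_k` that carry the values
`ζ(-d k)`. Summed over the other indices, the first two parts turn into the continuation in one
variable less, at points whose last two entries are merged into their sum, minus `1 / d` or plus
`k`; the remainder is holomorphic in a region that grows with `K`. So the continuation `zetaFun` is
defined by recursion (`zetaFun_eq_zetaStep`, `isZetaContinuation_zetaFun`), and it is holomorphic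
off the hyperplanes of `OffPoles` (`analyticAt_zetaFun`).

Among these hyperplanes, the arithmetic hypothesis leaves only those of the second variable which
use all of `1/d₃, …, 1/dₙ` to pass through a point `-N` (`offPolesBut_neg_nat`); the condition
`θ₂ + ⋯ + θₙ ≠ 0` says that the line through `-N` in direction `θ` leaves them. In the recursion at
`-N + t θ`, the part with the coefficients `b_k` is holomorphic at `t = 0`, and its value there is
`termH` by the formula for `ζ(-d k)` in terms of Bernoulli numbers (`termH_eq_zetaFun`); it lies in
the field generated by the coefficients, by induction (`zetaFun_neg_nat_mem`). The first part is the
product of `G(-Nₙ + t θₙ)`, which has a simple zero because of `1 / Γ`, and of the continuation in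
one variable less at a point where it has a simple pole in `t`. The residue is found by following
the first part through the recursion down to two variables, where the pole comes from a Gamma
function (`tendsto_mul_zetaFun_negPoint`); the Gamma quotients on the way multiply to the product
in `constC` (`Gamma_mul_prodFactors`).
-/

section

open MeasureTheory Set

noncomputable section

/-! ### Integrals of exponentials of linear forms -/

/-- The `k`-th term `ℓ^k / k!` of the exponential series of a continuous linear form, as a
continuous multilinear map. -/
def expTerm {E : Type*} [NormedAddCommGroup E] [NormedSpace ℂ E] (ℓ : E →L[ℂ] ℂ) (k : ℕ) :
    ContinuousMultilinearMap ℂ (fun _ : Fin k => E) ℂ :=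
  ((k.factorial : ℂ)⁻¹) •
    (ContinuousMultilinearMap.mkPiAlgebraFin ℂ k ℂ).compContinuousLinearMap (fun _ => ℓ)

section ExpFamily

variable {E : Type*} [NormedAddCommGroup E] [NormedSpace ℂ E]

lemma expTerm_apply (ℓ : E →L[ℂ] ℂ) (k : ℕ) (y : E) :
    expTerm ℓ k (fun _ => y) = ℓ y ^ k / (k.factorial : ℂ) := by
  simp [expTerm, div_eq_inv_mul]

lemma norm_expTerm_le (ℓ : E →L[ℂ] ℂ) (k : ℕ) :
    ‖expTerm ℓ k‖ ≤ ‖ℓ‖ ^ k / (k.factorial : ℝ) := by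
  rw [expTerm, norm_smul, div_eq_inv_mul]
  have h := (ContinuousMultilinearMap.mkPiAlgebraFin ℂ k ℂ).norm_compContinuousLinearMap_le
    (fun _ : Fin k => ℓ)
  rw [ContinuousMultilinearMap.norm_mkPiAlgebraFin] at h
  simp only [Finset.prod_const, Finset.card_univ, Fintype.card_fin, one_mul] at h
  rw [norm_inv, Complex.norm_natCast]
  gcongr

lemma continuous_expTerm (k : ℕ) : Continuous fun ℓ : E →L[ℂ] ℂ => expTerm ℓ k := by
  have h1 : Continuous fun ℓ : E →L[ℂ] ℂ =>
      ContinuousMultilinearMap.compContinuousLinearMapContinuousMultilinear ℂ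
        (fun _ : Fin k => E) (fun _ : Fin k => ℂ) ℂ (fun _ => ℓ) :=
    (ContinuousMultilinearMap.cont _).comp (continuous_pi fun _ => continuous_id)
  have h2 : Continuous fun ℓ : E →L[ℂ] ℂ =>
      ContinuousMultilinearMap.compContinuousLinearMapContinuousMultilinear ℂ
        (fun _ : Fin k => E) (fun _ : Fin k => ℂ) ℂ (fun _ => ℓ)
          (ContinuousMultilinearMap.mkPiAlgebraFin ℂ k ℂ) := h1.clm_apply continuous_const
  exact h2.const_smul ((k.factorial : ℂ)⁻¹)

/-- An integral of exponentials of linear forms is analytic at every point around which the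
integral still converges after the linear forms are replaced by `r` times their norm.  This is the
only source of analyticity in several variables below. -/
theorem analyticAt_integral_exp {A : Type*} [MeasurableSpace A] {μ : Measure A} {w : A → ℂ}
    {ℓ : A → E →L[ℂ] ℂ} {s₀ : E} {r : ℝ} (hr : 0 < r) (hℓ : AEStronglyMeasurable ℓ μ)
    (hw : AEStronglyMeasurable w μ)
    (hint : Integrable (fun a => ‖w a * Complex.exp (ℓ a s₀)‖ * Real.exp (r * ‖ℓ a‖)) μ) :
    AnalyticAt ℂ (fun s => ∫ a, w a * Complex.exp (ℓ a s) ∂μ) s₀ := by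
  set v : A → ℂ := fun a => w a * Complex.exp (ℓ a s₀) with hv
  have hvm : AEStronglyMeasurable v μ :=
    hw.mul (Complex.continuous_exp.comp_aestronglyMeasurable
      ((ContinuousLinearMap.apply ℂ ℂ s₀).continuous.comp_aestronglyMeasurable hℓ))
  set b : ℕ → A → ℝ := fun k a => ‖v a‖ * ((r * ‖ℓ a‖) ^ k / (k.factorial : ℝ)) with hb
  have hb0 : ∀ k a, 0 ≤ b k a := fun k a => by positivity
  have hbsum : ∀ n a, ∑ k ∈ Finset.range n, b k a ≤ ‖v a‖ * Real.exp (r * ‖ℓ a‖) := by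
    intro n a
    rw [hb, ← Finset.mul_sum]
    gcongr
    exact Real.sum_le_exp_of_nonneg (by positivity) n
  have hbm : ∀ k, AEStronglyMeasurable (b k) μ := by
    intro k
    have : Continuous fun x : ℝ => (r * x) ^ k / (k.factorial : ℝ) := by fun_prop
    exact hvm.norm.mul (this.comp_aestronglyMeasurable hℓ.norm)
  have hbint : ∀ k, Integrable (b k) μ := by
    intro k
    refine hint.mono' (hbm k) (Eventually.of_forall fun a => ?_)
    rw [Real.norm_of_nonneg (hb0 k a)]
    refine le_trans ?_ (hbsum (k + 1) a)
    exact Finset.single_le_sum (f := fun i => b i a) (fun i _ => hb0 i a)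
      (Finset.mem_range.2 k.lt_succ_self)
  have hbS : Summable fun k => ∫ a, b k a ∂μ := by
    refine summable_of_sum_range_le (c := ∫ a, ‖v a‖ * Real.exp (r * ‖ℓ a‖) ∂μ)
      (fun k => integral_nonneg (hb0 k)) fun n => ?_
    rw [← integral_finsetSum _ fun k _ => hbint k]
    exact integral_mono (integrable_finsetSum _ fun k _ => hbint k) hint fun a => hbsum n a
  set q : ℕ → A → ℝ := fun k a => ‖v a‖ * (‖ℓ a‖ ^ k / (k.factorial : ℝ)) with hq
  have hqb : ∀ k a, q k a = (r ^ k)⁻¹ * b k a := by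
    intro k a
    simp only [hq, hb, mul_pow]
    field_simp
  have hqint : ∀ k, Integrable (fun a => v a • expTerm (ℓ a) k) μ := by
    intro k
    refine ((hbint k).const_mul (r ^ k)⁻¹).mono'
      (hvm.smul ((continuous_expTerm k).comp_aestronglyMeasurable hℓ))
      (Eventually.of_forall fun a => ?_)
    rw [norm_smul, ← hqb]
    exact mul_le_mul_of_nonneg_left (norm_expTerm_le _ _) (norm_nonneg _)
  let p : FormalMultilinearSeries ℂ E ℂ := fun k => ∫ a, v a • expTerm (ℓ a) k ∂μ
  have hp : ∀ k, ‖p k‖ * r ^ k ≤ ∫ a, b k a ∂μ := by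
    intro k
    have h1 : ‖p k‖ ≤ ∫ a, (r ^ k)⁻¹ * b k a ∂μ := by
      refine norm_integral_le_of_norm_le ((hbint k).const_mul _)
        (Eventually.of_forall fun a => ?_)
      rw [norm_smul, ← hqb]
      exact mul_le_mul_of_nonneg_left (norm_expTerm_le _ _) (norm_nonneg _)
    rw [integral_const_mul] at h1
    calc ‖p k‖ * r ^ k ≤ (r ^ k)⁻¹ * (∫ a, b k a ∂μ) * r ^ k := by gcongr
      _ = ∫ a, b k a ∂μ := by field_simp
  refine ⟨p, ENNReal.ofReal r, ?_, ENNReal.ofReal_pos.2 hr, ?_⟩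
  · have := p.le_radius_of_summable_norm (r := r.toNNReal) ?_
    · simpa [ENNReal.ofReal] using this
    · rw [Real.coe_toNNReal r hr.le]
      exact Summable.of_nonneg_of_le (fun k => by positivity) hp hbS
  · intro y hy
    have hyr : ‖y‖ ≤ r := by
      rw [Metric.eball_ofReal, mem_ball_zero_iff] at hy
      exact hy.le
    have hpk : ∀ k, p k (fun _ => y) = ∫ a, v a * (ℓ a y ^ k / (k.factorial : ℂ)) ∂μ := by
      intro k
      have := (ContinuousMultilinearMap.apply ℂ (fun _ : Fin k => E) ℂ
        (fun _ => y)).integral_comp_comm (hqint k)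
      simp only [ContinuousMultilinearMap.apply_apply, smul_apply,
        expTerm_apply, smul_eq_mul] at this
      exact this.symm
    have hbd : ∀ k a, ‖v a * (ℓ a y ^ k / (k.factorial : ℂ))‖ ≤ b k a := by
      intro k a
      rw [norm_mul, norm_div, norm_pow, Complex.norm_natCast]
      have : ‖ℓ a y‖ ≤ r * ‖ℓ a‖ := by
        calc ‖ℓ a y‖ ≤ ‖ℓ a‖ * ‖y‖ := (ℓ a).le_opNorm y
          _ ≤ ‖ℓ a‖ * r := by gcongr
          _ = r * ‖ℓ a‖ := mul_comm _ _
      simp only [hb]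
      gcongr
    have hmeas : ∀ k, AEStronglyMeasurable (fun a => v a * (ℓ a y ^ k / (k.factorial : ℂ))) μ := by
      intro k
      have : Continuous fun x : ℂ => x ^ k / (k.factorial : ℂ) := by fun_prop
      exact hvm.mul (this.comp_aestronglyMeasurable
        ((ContinuousLinearMap.apply ℂ ℂ y).continuous.comp_aestronglyMeasurable hℓ))
    have hI : ∀ k, Integrable (fun a => v a * (ℓ a y ^ k / (k.factorial : ℂ))) μ := fun k =>
      (hbint k).mono' (hmeas k) (Eventually.of_forall (hbd k))
    have := hasSum_integral_of_summable_integral_norm hI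
      (hbS.of_nonneg_of_le (fun k => integral_nonneg fun a => norm_nonneg _)
        fun k => integral_mono (hI k).norm (hbint k) (hbd k))
    simp_rw [← hpk] at this
    convert! this using 1
    refine integral_congr_ae (Eventually.of_forall fun a => ?_)
    simp only [hv]
    rw [tsum_mul_left, map_add, Complex.exp_add, mul_assoc]
    congr 2
    rw [Complex.exp_eq_exp_ℂ, NormedSpace.exp_eq_tsum_div]

end ExpFamily

/-! ### Gamma integrals with a complex parameter -/

lemma integrableOn_rpow_mul_exp_neg_mul {a c : ℝ} (ha : 0 < a) (hc : 0 < c) :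
    IntegrableOn (fun t : ℝ => t ^ (a - 1) * Real.exp (-(c * t))) (Ioi 0) := by
  have := integrableOn_rpow_mul_exp_neg_mul_rpow (p := 1) (s := a - 1) (b := c) (by linarith)
    one_pos hc
  simpa [neg_mul] using this

lemma norm_cpow_mul_exp_neg {s x : ℂ} {t : ℝ} (ht : 0 < t) :
    ‖(t : ℂ) ^ (s - 1) * Complex.exp (-(x * t))‖ = t ^ (s.re - 1) * Real.exp (-(x.re * t)) := by
  rw [norm_mul, Complex.norm_cpow_eq_rpow_re_of_pos ht, Complex.norm_exp]
  simp

lemma continuousOn_cpow_ofReal (s : ℂ) : ContinuousOn (fun t : ℝ => (t : ℂ) ^ s) (Ioi 0) := by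
  intro t ht
  refine ContinuousAt.continuousWithinAt ?_
  exact (continuousAt_cpow_const (Complex.ofReal_mem_slitPlane.2 ht)).comp
    Complex.continuous_ofReal.continuousAt

lemma continuousOn_cpow_mul_exp_neg (s x : ℂ) :
    ContinuousOn (fun t : ℝ => (t : ℂ) ^ (s - 1) * Complex.exp (-(x * t))) (Ioi 0) :=
  (continuousOn_cpow_ofReal _).mul (by fun_prop)

lemma integrableOn_cpow_mul_exp_neg {s x : ℂ} (hs : 0 < s.re) (hx : 0 < x.re) :
    IntegrableOn (fun t : ℝ => (t : ℂ) ^ (s - 1) * Complex.exp (-(x * t))) (Ioi 0) := by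
  refine (integrableOn_rpow_mul_exp_neg_mul hs hx).mono'
    ((continuousOn_cpow_mul_exp_neg s x).aestronglyMeasurable measurableSet_Ioi) ?_
  refine (ae_restrict_iff' measurableSet_Ioi).2 (Eventually.of_forall fun t ht => ?_)
  rw [norm_cpow_mul_exp_neg ht]

lemma analyticAt_integral_cpow_mul_exp_neg {s x : ℂ} (hs : 0 < s.re) (hx : 0 < x.re) :
    AnalyticAt ℂ (fun x : ℂ => ∫ t in Ioi (0 : ℝ), (t : ℂ) ^ (s - 1) * Complex.exp (-(x * t)))
      x := by
  have h := analyticAt_integral_exp (E := ℂ) (μ := volume.restrict (Ioi (0 : ℝ)))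
    (w := fun t => (t : ℂ) ^ (s - 1))
    (ℓ := fun t : ℝ => (-(t : ℂ)) • ContinuousLinearMap.id ℂ ℂ) (s₀ := x) (r := x.re / 2)
    (by positivity) ?_ ?_ ?_
  · convert h using 4
    simp [mul_comm]
  · exact Continuous.aestronglyMeasurable (by fun_prop)
  · exact (continuousOn_cpow_ofReal _).aestronglyMeasurable measurableSet_Ioi
  · refine (integrableOn_rpow_mul_exp_neg_mul hs (half_pos hx)).congr_fun ?_ measurableSet_Ioi
    intro t ht
    have ht' : (0 : ℝ) < t := ht
    have h1 : ((-(t : ℂ)) • ContinuousLinearMap.id ℂ ℂ) x = -(x * t) := by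
      simp [mul_comm]
    have h2 : ‖(-(t : ℂ)) • ContinuousLinearMap.id ℂ ℂ‖ = t := by
      rw [norm_smul, ContinuousLinearMap.norm_id, norm_neg, Complex.norm_real,
        Real.norm_of_nonneg ht'.le, mul_one]
    simp only
    rw [h1, h2, norm_cpow_mul_exp_neg ht', mul_assoc, ← Real.exp_add]
    congr 2
    ring

/-- Euler's integral along a ray: by analytic continuation in `x` from the positive reals. -/
theorem integral_cpow_mul_exp_neg_of_re_pos {s x : ℂ} (hs : 0 < s.re) (hx : 0 < x.re) :
    ∫ t in Ioi (0 : ℝ), (t : ℂ) ^ (s - 1) * Complex.exp (-(x * t)) =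
      Complex.Gamma s * x ^ (-s) := by
  have hU : IsPreconnected {z : ℂ | 0 < z.re} := (convex_halfSpace_re_gt 0).isPreconnected
  have hf : AnalyticOnNhd ℂ (fun x : ℂ =>
      ∫ t in Ioi (0 : ℝ), (t : ℂ) ^ (s - 1) * Complex.exp (-(x * t))) {z : ℂ | 0 < z.re} :=
    fun z hz => analyticAt_integral_cpow_mul_exp_neg hs hz
  have hg : AnalyticOnNhd ℂ (fun x : ℂ => Complex.Gamma s * x ^ (-s)) {z : ℂ | 0 < z.re} := by
    intro z hz
    exact analyticAt_const.mul (analyticAt_id.cpow analyticAt_const (Or.inl hz))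
  refine hf.eqOn_of_preconnected_of_frequently_eq hg hU (z₀ := 1) (by simp) ?_ hx
  have hlim : Tendsto (fun n : ℕ => ((1 + 1 / ((n : ℝ) + 1) : ℝ) : ℂ)) atTop (𝓝[≠] 1) := by
    refine tendsto_nhdsWithin_iff.2 ⟨?_, Eventually.of_forall fun n => ?_⟩
    · have := (tendsto_one_div_add_atTop_nhds_zero_nat (𝕜 := ℝ)).const_add 1
      rw [add_zero] at this
      exact (Complex.continuous_ofReal.tendsto 1).comp this
    · intro h
      have h2 : (1 + 1 / ((n : ℝ) + 1) : ℝ) = 1 := by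
        exact_mod_cast mem_singleton_iff.1 h
      have : (0 : ℝ) < 1 / ((n : ℝ) + 1) := by positivity
      linarith
  refine hlim.frequently (Frequently.of_forall fun n => ?_)
  have hr : (0 : ℝ) < 1 + 1 / ((n : ℝ) + 1) := by positivity
  rw [Complex.integral_cpow_mul_exp_neg_mul_Ioi hs hr, mul_comm, Complex.cpow_neg, one_div,
    Complex.inv_cpow]
  rw [Complex.arg_ofReal_of_nonneg hr.le]
  exact Real.pi_pos.ne

theorem integral_exp_neg_mul_pow {d : ℕ} (hd : 0 < d) {γ : ℂ} (hγ : 0 < γ.re) :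
    ∫ y in Ioi (0 : ℝ), Complex.exp (-(γ * (y : ℂ) ^ d)) =
      Complex.Gamma (1 / d) / d * γ ^ (-(1 / (d : ℂ))) := by
  have hd' : (0 : ℝ) < d := by exact_mod_cast hd
  have hs : (0 : ℝ) < ((1 / d : ℂ)).re := by
    rw [show (1 / d : ℂ) = ((1 / d : ℝ) : ℂ) by push_cast; rfl, Complex.ofReal_re]
    positivity
  have h := integral_comp_rpow_Ioi_of_pos (p := (d : ℝ)) hd'
    (g := fun u : ℝ => (u : ℂ) ^ ((1 / d : ℂ) - 1) * Complex.exp (-(γ * u)))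
  rw [integral_cpow_mul_exp_neg_of_re_pos hs hγ] at h
  have h2 : ∫ y in Ioi (0 : ℝ), (d : ℂ) * Complex.exp (-(γ * (y : ℂ) ^ d)) =
      Complex.Gamma (1 / d) * γ ^ (-(1 / (d : ℂ))) := by
    rw [← h]
    refine setIntegral_congr_fun measurableSet_Ioi fun y hy => ?_
    have hy' : (0 : ℝ) < y := hy
    have e1 : ((y ^ (d : ℝ) : ℝ) : ℂ) ^ ((1 / d : ℂ) - 1) = ((y ^ (1 - (d : ℝ)) : ℝ) : ℂ) := by
      rw [show (1 / d : ℂ) - 1 = ((1 / d - 1 : ℝ) : ℂ) by push_cast; rfl,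
        ← Complex.ofReal_cpow (by positivity), ← Real.rpow_mul hy'.le]
      congr 2
      field_simp
    have e2 : (d : ℝ) * y ^ ((d : ℝ) - 1) * y ^ (1 - (d : ℝ)) = d := by
      rw [mul_assoc, ← Real.rpow_add hy']
      simp
    rw [e1, Complex.real_smul, ← mul_assoc, ← Complex.ofReal_mul, e2]
    simp
  rw [integral_const_mul] at h2
  have hd'' : (d : ℂ) ≠ 0 := by exact_mod_cast hd.ne'
  rw [div_mul_eq_mul_div, ← h2]
  field_simp

/-! ### Euler–Maclaurin summation of `P(y) exp(-γ y^d)` -/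

/-- The function `P(y) exp(-γ y^d)`. -/
def polyExp (γ : ℂ) (d : ℕ) (P : Polynomial ℂ) (y : ℝ) : ℂ :=
  P.eval (y : ℂ) * Complex.exp (-(γ * (y : ℂ) ^ d))

/-- The operator on polynomials that differentiation induces on the functions
`P(y) exp(-γ y^d)`. -/
def polyExpDeriv (γ : ℂ) (d : ℕ) (P : Polynomial ℂ) : Polynomial ℂ :=
  Polynomial.derivative P - Polynomial.C (γ * d) * Polynomial.X ^ (d - 1) * P

section EulerMaclaurin

variable {γ : ℂ} {d : ℕ}

lemma continuous_polyExp (P : Polynomial ℂ) : Continuous (polyExp γ d P) := by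
  unfold polyExp
  have := P.continuous.comp Complex.continuous_ofReal
  exact this.mul (by fun_prop)

lemma hasDerivAt_polyExp (P : Polynomial ℂ) (y : ℝ) :
    HasDerivAt (polyExp γ d P) (polyExp γ d (polyExpDeriv γ d P) y) y := by
  have h1 : HasDerivAt (fun z : ℂ => P.eval z * Complex.exp (-(γ * z ^ d)))
      ((Polynomial.derivative P).eval (y : ℂ) * Complex.exp (-(γ * (y : ℂ) ^ d)) +
        P.eval (y : ℂ) * (Complex.exp (-(γ * (y : ℂ) ^ d)) *
          (-(γ * (d * (y : ℂ) ^ (d - 1)))))) (y : ℂ) :=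
    (P.hasDerivAt _).mul ((((hasDerivAt_pow d (y : ℂ)).const_mul γ).neg).cexp)
  refine h1.comp_ofReal.congr_deriv ?_
  simp only [polyExp, polyExpDeriv, Polynomial.eval_sub, Polynomial.eval_mul, Polynomial.eval_C,
    Polynomial.eval_pow, Polynomial.eval_X]
  ring

lemma polyExp_add (P Q : Polynomial ℂ) (y : ℝ) :
    polyExp γ d (P + Q) y = polyExp γ d P y + polyExp γ d Q y := by
  simp [polyExp, add_mul]

lemma norm_polyExp_monomial (j : ℕ) (a : ℂ) {y : ℝ} (hy : 0 ≤ y) :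
    ‖polyExp γ d (Polynomial.monomial j a) y‖ = ‖a‖ * (y ^ j * Real.exp (-(γ.re * y ^ d))) := by
  rw [polyExp, Polynomial.eval_monomial, norm_mul, norm_mul, norm_pow, Complex.norm_real,
    Real.norm_of_nonneg hy, Complex.norm_exp, mul_assoc]
  congr 4
  rw [← Complex.ofReal_pow, Complex.neg_re, Complex.re_mul_ofReal]

lemma integrableOn_polyExp (hd : 0 < d) (hγ : 0 < γ.re) (P : Polynomial ℂ) :
    IntegrableOn (polyExp γ d P) (Ioi 0) := by
  induction P using Polynomial.induction_on' with
  | add P Q hP hQ =>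
    exact (hP.add hQ).congr (Eventually.of_forall fun y => (polyExp_add P Q y).symm)
  | monomial j a =>
    have h := integrableOn_rpow_mul_exp_neg_mul_rpow (s := j) (p := d) (b := γ.re)
      (by have : (0 : ℝ) ≤ j := j.cast_nonneg
          linarith) (by exact_mod_cast hd) hγ
    refine (h.const_mul ‖a‖).mono' (continuous_polyExp _).aestronglyMeasurable ?_
    refine (ae_restrict_iff' measurableSet_Ioi).2 (Eventually.of_forall fun y hy => ?_)
    rw [norm_polyExp_monomial j a (le_of_lt hy)]
    simp

lemma summable_polyExp (hd : 0 < d) (hγ : 0 < γ.re) (P : Polynomial ℂ) {h : ℝ} (hh : 0 < h) :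
    Summable fun n : ℕ => polyExp γ d P (h * n) := by
  induction P using Polynomial.induction_on' with
  | add P Q hP hQ =>
    simp_rw [polyExp_add]
    exact hP.add hQ
  | monomial j a =>
    have hs := Real.summable_pow_mul_exp_neg_nat_mul j (r := γ.re * h ^ d) (by positivity)
    refine Summable.of_norm_bounded (hs.mul_left (‖a‖ * h ^ j)) fun n => ?_
    rw [norm_polyExp_monomial j a (by positivity), mul_pow, mul_pow]
    have : (n : ℝ) ≤ (n : ℝ) ^ d := by exact_mod_cast Nat.le_self_pow hd.ne' n
    calc ‖a‖ * (h ^ j * (n : ℝ) ^ j * Real.exp (-(γ.re * (h ^ d * (n : ℝ) ^ d))))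
        ≤ ‖a‖ * (h ^ j * (n : ℝ) ^ j * Real.exp (-(γ.re * h ^ d) * n)) := by
          gcongr
          rw [neg_mul, neg_le_neg_iff, ← mul_assoc]
          gcongr
      _ = _ := by ring

/-- The integral of `B_k(y - n)` times `P(y) exp(-γ y^d)`, sampled with step `h`, over the `n`-th
unit interval. -/
def emTerm (γ : ℂ) (d k : ℕ) (P : Polynomial ℂ) (h : ℝ) (n : ℕ) : ℂ :=
  ∫ y in (0 : ℝ)..1, (bernoulliFun k y : ℂ) * polyExp γ d P (h * (n + y))

lemma integrableOn_polyExp_mul (hd : 0 < d) (hγ : 0 < γ.re) (P : Polynomial ℂ) {h : ℝ}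
    (hh : 0 < h) : IntegrableOn (fun u => polyExp γ d P (h * u)) (Ioi 0) := by
  have := (integrableOn_Ioi_comp_mul_left_iff (polyExp γ d P) 0 hh).2
  rw [mul_zero] at this
  exact this (integrableOn_polyExp hd hγ P)

lemma intervalIntegral_shift (f : ℝ → ℂ) (n : ℕ) :
    ∫ y in (0 : ℝ)..1, f (n + y) = ∫ u in (n : ℝ)..((n + 1 : ℕ) : ℝ), f u := by
  rw [intervalIntegral.integral_comp_add_left f (n : ℝ)]
  simp

/-- The `k`-th Euler–Maclaurin remainder with step `h` is `O(1 / h)`. -/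
lemma exists_sum_norm_emTerm_le (hd : 0 < d) (hγ : 0 < γ.re) (k : ℕ) (P : Polynomial ℂ) :
    ∃ C : ℝ, ∀ h : ℝ, 0 < h → ∀ N : ℕ, ∑ n ∈ Finset.range N, ‖emTerm γ d k P h n‖ ≤ C / h := by
  obtain ⟨B, hB⟩ := (isCompact_Icc (a := (0 : ℝ)) (b := 1)).exists_bound_of_continuousOn
    (continuous_bernoulliFun k).continuousOn
  have hB0 : 0 ≤ B := (norm_nonneg _).trans (hB 0 (by simp))
  refine ⟨B * ∫ u in Ioi (0 : ℝ), ‖polyExp γ d P u‖, fun h hh N => ?_⟩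
  set g : ℝ → ℝ := fun u => ‖polyExp γ d P (h * u)‖ with hg
  have hgc : Continuous g := ((continuous_polyExp P).comp (continuous_const_mul h)).norm
  have hgi : IntegrableOn g (Ioi 0) := (integrableOn_polyExp_mul hd hγ P hh).norm
  have h1 : ∀ n : ℕ, ‖emTerm γ d k P h n‖ ≤ B * ∫ u in (n : ℝ)..((n + 1 : ℕ) : ℝ), g u := by
    intro n
    have e : ∫ u in (n : ℝ)..((n + 1 : ℕ) : ℝ), g u = ∫ y in (0 : ℝ)..1, g (n + y) := by
      rw [intervalIntegral.integral_comp_add_left g (n : ℝ)]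
      simp
    rw [e, ← intervalIntegral.integral_const_mul]
    refine intervalIntegral.norm_integral_le_of_norm_le zero_le_one
      (Eventually.of_forall fun y hy => ?_) (Continuous.intervalIntegrable (by fun_prop) _ _)
    rw [norm_mul, Complex.norm_real]
    exact mul_le_mul_of_nonneg_right (hB y ⟨hy.1.le, hy.2⟩) (norm_nonneg _)
  have h2 : ∫ u in Ioi (0 : ℝ), g u = (∫ u in Ioi (0 : ℝ), ‖polyExp γ d P u‖) / h := by
    have := integral_comp_mul_left_Ioi (fun u => ‖polyExp γ d P u‖) 0 hh
    rw [mul_zero] at this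
    rw [hg, this, smul_eq_mul, div_eq_inv_mul]
  calc ∑ n ∈ Finset.range N, ‖emTerm γ d k P h n‖
      ≤ ∑ n ∈ Finset.range N, B * ∫ u in (n : ℝ)..((n + 1 : ℕ) : ℝ), g u :=
        Finset.sum_le_sum fun n _ => h1 n
    _ = B * ∫ u in (0 : ℝ)..(N : ℝ), g u := by
        rw [← Finset.mul_sum, intervalIntegral.sum_integral_adjacent_intervals
          (a := fun n : ℕ => (n : ℝ)) fun k _ => hgc.intervalIntegrable _ _]
        simp
    _ ≤ B * ∫ u in Ioi (0 : ℝ), g u := by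
        refine mul_le_mul_of_nonneg_left ?_ hB0
        rw [intervalIntegral.integral_of_le N.cast_nonneg]
        exact setIntegral_mono_set hgi (Eventually.of_forall fun u => norm_nonneg _)
          (Eventually.of_forall fun u hu => hu.1)
    _ = _ := by rw [h2]; ring

lemma summable_emTerm (hd : 0 < d) (hγ : 0 < γ.re) (k : ℕ) (P : Polynomial ℂ) {h : ℝ}
    (hh : 0 < h) : Summable (emTerm γ d k P h) := by
  obtain ⟨C, hC⟩ := exists_sum_norm_emTerm_le hd hγ k P
  exact (summable_of_sum_range_le (fun _ => norm_nonneg _) (hC h hh)).of_norm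

lemma exists_norm_tsum_emTerm_le (hd : 0 < d) (hγ : 0 < γ.re) (k : ℕ) (P : Polynomial ℂ) :
    ∃ C : ℝ, ∀ h : ℝ, 0 < h → ‖∑' n, emTerm γ d k P h n‖ ≤ C / h := by
  obtain ⟨C, hC⟩ := exists_sum_norm_emTerm_le hd hγ k P
  refine ⟨C, fun h hh => ?_⟩
  have hs := summable_of_sum_range_le (fun _ => norm_nonneg _) (hC h hh)
  exact (norm_tsum_le_tsum_norm hs).trans
    (Real.tsum_le_of_sum_range_le (fun _ => norm_nonneg _) (hC h hh))

lemma emTerm_eq (k : ℕ) (P : Polynomial ℂ) (h : ℝ) (n : ℕ) :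
    emTerm γ d k P h n =
      ((bernoulliFun (k + 1) 1 : ℂ) * polyExp γ d P (h * (n + 1 : ℕ)) -
        (bernoulliFun (k + 1) 0 : ℂ) * polyExp γ d P (h * n)) / (k + 1) -
      h / (k + 1) * emTerm γ d (k + 1) (polyExpDeriv γ d P) h n := by
  have hu : ∀ y : ℝ, HasDerivAt (fun y : ℝ => polyExp γ d P (h * (n + y)))
      (h * polyExp γ d (polyExpDeriv γ d P) (h * (n + y))) y := by
    intro y
    have h1 : HasDerivAt (fun y : ℝ => h * (n + y)) h y := by
      simpa using ((hasDerivAt_id y).const_add (n : ℝ)).const_mul h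
    have := (hasDerivAt_polyExp (γ := γ) (d := d) P (h * (n + y))).scomp y h1
    simpa [Function.comp_def] using this
  have hv : ∀ y : ℝ, HasDerivAt (fun y : ℝ => ((bernoulliFun (k + 1) y / (k + 1) : ℝ) : ℂ))
      (bernoulliFun k y : ℂ) y := fun y => (antideriv_bernoulliFun k y).ofReal_comp
  have hc := continuous_polyExp (γ := γ) (d := d) (polyExpDeriv γ d P)
  have := intervalIntegral.integral_mul_deriv_eq_deriv_mul (a := 0) (b := 1)
    (fun y _ => hu y) (fun y _ => hv y)
    (Continuous.intervalIntegrable (by fun_prop) _ _)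
    (Continuous.intervalIntegrable (by fun_prop) _ _)
  simp only [emTerm]
  rw [← intervalIntegral.integral_const_mul]
  have e1 : ∫ y in (0 : ℝ)..1, (bernoulliFun k y : ℂ) * polyExp γ d P (h * (n + y)) =
      ∫ y in (0 : ℝ)..1, polyExp γ d P (h * (n + y)) * (bernoulliFun k y : ℂ) := by
    simp_rw [mul_comm]
  rw [e1, this]
  congr 1
  · push_cast
    simp only [add_zero]
    ring
  · congr 1
    funext y
    push_cast
    ring

lemma tsum_emTerm_eq (hd : 0 < d) (hγ : 0 < γ.re) (k : ℕ) (P : Polynomial ℂ) {h : ℝ}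
    (hh : 0 < h) :
    ∑' n, emTerm γ d k P h n =
      (if k = 0 then ∑' n : ℕ, polyExp γ d P (h * (n + 1 : ℕ)) else 0) -
        (bernoulli (k + 1) : ℂ) / (k + 1) * P.eval 0 -
      h / (k + 1) * ∑' n, emTerm γ d (k + 1) (polyExpDeriv γ d P) h n := by
  have hS := summable_polyExp hd hγ P hh
  have hS1 : Summable fun n : ℕ => polyExp γ d P (h * (n + 1 : ℕ)) :=
    (summable_nat_add_iff 1).2 hS
  have hT := summable_emTerm hd hγ (k + 1) (polyExpDeriv γ d P) hh
  have h0 := hS.tsum_eq_zero_add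
  have hP0 : polyExp γ d P (h * (0 : ℕ)) = P.eval 0 := by
    simp [polyExp, hd.ne']
  rw [hP0] at h0
  rw [tsum_congr (emTerm_eq k P h),
    ((((hS1.mul_left _).sub (hS.mul_left _)).div_const _)).tsum_sub (hT.mul_left _),
    tsum_div_const, (hS1.mul_left _).tsum_sub (hS.mul_left _), tsum_mul_left, tsum_mul_left,
    tsum_mul_left, h0, bernoulliFun_eval_one, bernoulliFun_eval_zero]
  have hk : (k : ℂ) + 1 ≠ 0 := by exact_mod_cast k.succ_ne_zero
  by_cases hk0 : k = 0
  · subst hk0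
    simp
    ring
  · simp only [Nat.add_eq_right, hk0, if_false]
    push_cast
    field_simp
    ring

/-- Euler–Maclaurin expansion of `∑_{n ≥ 1} exp(-γ (h n)^d)` in powers of the step `h`. -/
lemma tsum_polyExp_one_eq (hd : 0 < d) (hγ : 0 < γ.re) {h : ℝ} (hh : 0 < h) (M : ℕ) :
    ∑' n : ℕ, polyExp γ d 1 (h * (n + 1 : ℕ)) =
      ∑' n, emTerm γ d 0 1 h n +
      ∑ k ∈ Finset.range (M + 1), (-1) ^ k * (bernoulli (k + 1) : ℂ) / ((k + 1).factorial : ℂ) *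
        ((polyExpDeriv γ d)^[k] 1).eval 0 * (h : ℂ) ^ k +
      (-1) ^ M * (h : ℂ) ^ (M + 1) / ((M + 1).factorial : ℂ) *
        ∑' n, emTerm γ d (M + 1) ((polyExpDeriv γ d)^[M + 1] 1) h n := by
  induction M with
  | zero =>
    have := tsum_emTerm_eq hd hγ 0 1 hh
    simp only [if_true] at this
    rw [this]
    simp
    ring
  | succ M ih =>
    rw [ih, Finset.sum_range_succ _ (M + 1), tsum_emTerm_eq hd hγ (M + 1) _ hh,
      if_neg M.succ_ne_zero, Function.iterate_succ_apply' _ (M + 1), Nat.factorial_succ (M + 1)]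
    have h1 : ((M + 1).factorial : ℂ) ≠ 0 := by exact_mod_cast (M + 1).factorial_ne_zero
    have h2 : ((M + 1 : ℕ) : ℂ) + 1 ≠ 0 := by exact_mod_cast (M + 1).succ_ne_zero
    rw [Nat.cast_mul, Nat.cast_add_one (M + 1)]
    field_simp
    ring

lemma tsum_emTerm_zero (hd : 0 < d) (hγ : 0 < γ.re) {h : ℝ} (hh : 0 < h) :
    ∑' n, emTerm γ d 0 1 h n =
      (h : ℂ)⁻¹ * (Complex.Gamma (1 / d) / d * γ ^ (-(1 / (d : ℂ)))) := by
  have hi := integrableOn_polyExp_mul (d := d) hd hγ 1 hh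
  have hc : Continuous fun u => polyExp γ d 1 (h * u) :=
    (continuous_polyExp 1).comp (continuous_const_mul h)
  have h1 : ∫ u in Ioi (0 : ℝ), polyExp γ d 1 (h * u) =
      (h : ℂ)⁻¹ * (Complex.Gamma (1 / d) / d * γ ^ (-(1 / (d : ℂ)))) := by
    have := integral_comp_mul_left_Ioi (polyExp γ d 1) 0 hh
    rw [this, mul_zero, ← integral_exp_neg_mul_pow hd hγ, Complex.real_smul]
    simp [polyExp]
  have h2 := (summable_emTerm hd hγ 0 1 hh).hasSum.tendsto_sum_nat
  have h3 : ∀ N : ℕ, ∑ n ∈ Finset.range N, emTerm γ d 0 1 h n =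
      ∫ u in (0 : ℝ)..(N : ℝ), polyExp γ d 1 (h * u) := by
    intro N
    have := intervalIntegral.sum_integral_adjacent_intervals (μ := volume)
      (f := fun u => polyExp γ d 1 (h * u)) (n := N)
      (a := fun n : ℕ => (n : ℝ)) fun k _ => hc.intervalIntegrable _ _
    rw [Nat.cast_zero] at this
    rw [← this]
    refine Finset.sum_congr rfl fun n _ => ?_
    rw [← intervalIntegral_shift]
    simp [emTerm]
  simp_rw [h3] at h2
  rw [← h1]
  exact tendsto_nhds_unique h2 (intervalIntegral_tendsto_integral_Ioi 0 hi
    tendsto_natCast_atTop_atTop)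

end EulerMaclaurin

/-- The power series of `exp(-γ X^d)`. -/
def expPowSeries (γ : ℂ) (d : ℕ) : PowerSeries ℂ :=
  PowerSeries.mk fun n => if d ∣ n then (-γ) ^ (n / d) / ((n / d).factorial : ℂ) else 0

lemma derivative_expPowSeries (γ : ℂ) {d : ℕ} (hd : 0 < d) :
    PowerSeries.derivative (R := ℂ) (expPowSeries γ d) =
      -(PowerSeries.C (γ * d) * PowerSeries.X ^ (d - 1) * expPowSeries γ d) := by
  ext n
  rw [PowerSeries.coeff_derivative, map_neg, mul_assoc, PowerSeries.coeff_C_mul,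
    PowerSeries.coeff_X_pow_mul']
  simp only [expPowSeries, PowerSeries.coeff_mk]
  by_cases h : d ∣ n + 1
  · obtain ⟨q, hq⟩ := h
    obtain ⟨q, rfl⟩ : ∃ q', q = q' + 1 := ⟨q - 1, by
      rcases q with _ | q
      · simp at hq
      · rfl⟩
    have h1 : n - (d - 1) = d * q := by
      rw [mul_add, mul_one] at hq; omega
    have h2 : d - 1 ≤ n := by
      rw [mul_add, mul_one] at hq; omega
    rw [if_pos h2, h1, hq, if_pos (dvd_mul_right _ _), if_pos (dvd_mul_right _ _),
      Nat.mul_div_cancel_left _ hd, Nat.mul_div_cancel_left _ hd, Nat.factorial_succ]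
    have h3 : (n : ℂ) + 1 = d * (q + 1) := by exact_mod_cast hq
    have h4 : ((q.factorial : ℕ) : ℂ) ≠ 0 := by exact_mod_cast q.factorial_ne_zero
    have h5 : (q : ℂ) + 1 ≠ 0 := by exact_mod_cast q.succ_ne_zero
    rw [h3]
    push_cast
    field_simp
    ring
  · rw [if_neg h]
    by_cases h2 : d - 1 ≤ n
    · rw [if_pos h2, if_neg]
      · simp
      · intro h3
        apply h
        have : n + 1 = (n - (d - 1)) + d := by omega
        rw [this]
        exact dvd_add h3 dvd_rfl
    · rw [if_neg h2]; simp

lemma polyExpDeriv_mul_expPowSeries (γ : ℂ) {d : ℕ} (hd : 0 < d) (P : Polynomial ℂ) :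
    ((polyExpDeriv γ d P : Polynomial ℂ) : PowerSeries ℂ) * expPowSeries γ d =
      PowerSeries.derivative (R := ℂ) ((P : PowerSeries ℂ) * expPowSeries γ d) := by
  rw [Derivation.leibniz, derivative_expPowSeries γ hd, polyExpDeriv]
  have : PowerSeries.derivative (R := ℂ) (P : PowerSeries ℂ) =
      ((Polynomial.derivative P : Polynomial ℂ) : PowerSeries ℂ) := PowerSeries.derivative_coe P
  rw [this]
  simp only [Polynomial.coe_sub, Polynomial.coe_mul, Polynomial.coe_C, Polynomial.coe_pow,
    Polynomial.coe_X, smul_eq_mul]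
  ring

lemma coeff_iterate_derivative (f : PowerSeries ℂ) (k n : ℕ) :
    PowerSeries.coeff n ((PowerSeries.derivative (R := ℂ))^[k] f) * (n.factorial : ℂ) =
      PowerSeries.coeff (n + k) f * ((n + k).factorial : ℂ) := by
  induction k generalizing n with
  | zero => rfl
  | succ k ih =>
    rw [Function.iterate_succ_apply', PowerSeries.coeff_derivative]
    have := ih (n + 1)
    rw [Nat.factorial_succ n] at this
    rw [show n + (k + 1) = n + 1 + k by ring, ← this]
    push_cast
    ring

/-- The derivatives at `0` of `exp(-γ y^d)`. -/
lemma eval_iterate_polyExpDeriv (γ : ℂ) {d : ℕ} (hd : 0 < d) (k : ℕ) :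
    ((polyExpDeriv γ d)^[k] 1).eval 0 =
      (k.factorial : ℂ) * PowerSeries.coeff k (expPowSeries γ d) := by
  have h1 : ∀ k, (((polyExpDeriv γ d)^[k] 1 : Polynomial ℂ) : PowerSeries ℂ) * expPowSeries γ d =
      (PowerSeries.derivative (R := ℂ))^[k] (expPowSeries γ d) := by
    intro k
    induction k with
    | zero => simp
    | succ k ih =>
      rw [Function.iterate_succ_apply', Function.iterate_succ_apply',
        polyExpDeriv_mul_expPowSeries γ hd, ih]
  have h2 := coeff_iterate_derivative (expPowSeries γ d) k 0
  rw [← h1 k] at h2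
  simp only [Nat.factorial_zero, Nat.cast_one, mul_one, zero_add] at h2
  rw [mul_comm, ← h2, PowerSeries.coeff_zero_eq_constantCoeff_apply, map_mul,
    ← Polynomial.coeff_zero_eq_eval_zero]
  simp [expPowSeries]

/-! ### Small-time expansion of the theta function `∑ exp(-γ m^d t)` -/

/-- The theta function `∑_{m ≥ 1} exp(-γ m^d t)`. -/
def thetaSum (γ : ℂ) (d : ℕ) (t : ℝ) : ℂ :=
  ∑' a : ℕ+, Complex.exp (-(γ * ((a : ℕ) : ℂ) ^ d * t))

/-- The coefficient of `t^(-1/d)` in the expansion of `thetaSum γ d t` at `t = 0`. -/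
def thetaLead (γ : ℂ) (d : ℕ) : ℂ := Complex.Gamma (1 / d) / d * γ ^ (-(1 / (d : ℂ)))

/-- The coefficient of `t^k` in the expansion of `thetaSum γ d t` at `t = 0`. -/
def thetaCoeff (γ : ℂ) (d k : ℕ) : ℂ :=
  riemannZeta (-((d * k : ℕ) : ℂ)) * (-γ) ^ k / (k.factorial : ℂ)

/-- The theta function minus its expansion at `t = 0` up to the terms of order less than `K`. -/
def thetaRem (γ : ℂ) (d K : ℕ) (t : ℝ) : ℂ :=
  thetaSum γ d t - thetaLead γ d * (t : ℂ) ^ (-(1 / (d : ℂ))) -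
    ∑ k ∈ Finset.range K, thetaCoeff γ d k * (t : ℂ) ^ k

lemma thetaRem_succ (γ : ℂ) (d K : ℕ) (t : ℝ) :
    thetaRem γ d K t = thetaCoeff γ d K * (t : ℂ) ^ K + thetaRem γ d (K + 1) t := by
  simp only [thetaRem, Finset.sum_range_succ]
  ring

section Theta

variable {γ : ℂ} {d : ℕ}

lemma thetaSum_eq_tsum_nat (t : ℝ) :
    thetaSum γ d t = ∑' n : ℕ, Complex.exp (-(γ * ((n + 1 : ℕ) : ℂ) ^ d * t)) := by
  rw [thetaSum, ← Equiv.pnatEquivNat.symm.tsum_eq]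
  simp

lemma polyExp_one_rpow (hd : 0 < d) {t : ℝ} (ht : 0 < t) (n : ℕ) :
    polyExp γ d 1 (t ^ (1 / (d : ℝ)) * (n : ℕ)) =
      Complex.exp (-(γ * ((n : ℕ) : ℂ) ^ d * t)) := by
  have h : (t ^ (1 / (d : ℝ))) ^ d = t := by
    rw [one_div, Real.rpow_inv_natCast_pow ht.le hd.ne']
  rw [polyExp, Polynomial.eval_one, one_mul, Complex.ofReal_mul, mul_pow, ← Complex.ofReal_pow, h]
  congr 2
  push_cast
  ring

lemma summable_exp_neg_mul_pow (hd : 0 < d) (hγ : 0 < γ.re) {t : ℝ} (ht : 0 < t) :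
    Summable fun n : ℕ => Complex.exp (-(γ * ((n : ℕ) : ℂ) ^ d * t)) := by
  simpa only [polyExp_one_rpow hd ht] using
    summable_polyExp hd hγ 1 (Real.rpow_pos_of_pos ht (1 / (d : ℝ)))

lemma aestronglyMeasurable_thetaSum (hd : 0 < d) (hγ : 0 < γ.re) :
    AEStronglyMeasurable (thetaSum γ d) (volume.restrict (Ioi 0)) := by
  refine aestronglyMeasurable_of_tendsto_ae atTop
    (f := fun N (t : ℝ) =>
      ∑ n ∈ Finset.range N, Complex.exp (-(γ * ((n + 1 : ℕ) : ℂ) ^ d * (t : ℂ))))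
    (fun N => Continuous.aestronglyMeasurable (by fun_prop)) ?_
  refine (ae_restrict_iff' measurableSet_Ioi).2 (Eventually.of_forall fun t ht => ?_)
  rw [thetaSum_eq_tsum_nat]
  exact ((summable_nat_add_iff 1).2
    (summable_exp_neg_mul_pow hd hγ ht)).hasSum.tendsto_sum_nat

lemma aestronglyMeasurable_thetaRem (hd : 0 < d) (hγ : 0 < γ.re) (K : ℕ) :
    AEStronglyMeasurable (thetaRem γ d K) (volume.restrict (Ioi 0)) := by
  refine ((aestronglyMeasurable_thetaSum hd hγ).sub
    (((continuousOn_cpow_ofReal _).aestronglyMeasurable measurableSet_Ioi).const_mul _)).sub ?_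
  exact Continuous.aestronglyMeasurable (by fun_prop)

lemma sum_range_expPowSeries (hd : 0 < d) (K : ℕ) {h t : ℝ} (ht : h ^ d = t) :
    ∑ k ∈ Finset.range (d * K + 1),
        (-1) ^ k * (bernoulli (k + 1) : ℂ) / ((k + 1).factorial : ℂ) *
        ((polyExpDeriv γ d)^[k] 1).eval 0 * (h : ℂ) ^ k =
      ∑ k ∈ Finset.range (K + 1), thetaCoeff γ d k * (t : ℂ) ^ k := by
  have h1 : ∀ k : ℕ, (-1) ^ k * (bernoulli (k + 1) : ℂ) / ((k + 1).factorial : ℂ) *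
      ((polyExpDeriv γ d)^[k] 1).eval 0 * (h : ℂ) ^ k =
      riemannZeta (-(k : ℂ)) * PowerSeries.coeff k (expPowSeries γ d) * (h : ℂ) ^ k := by
    intro k
    rw [eval_iterate_polyExpDeriv γ hd, riemannZeta_neg_nat_eq_bernoulli, Nat.factorial_succ]
    have h4 : ((k.factorial : ℕ) : ℂ) ≠ 0 := by exact_mod_cast k.factorial_ne_zero
    have h5 : (k : ℂ) + 1 ≠ 0 := by exact_mod_cast k.succ_ne_zero
    push_cast
    field_simp
  rw [Finset.sum_congr rfl fun k _ => h1 k]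
  symm
  refine Finset.sum_of_injOn (fun k => d * k) ?_ ?_ ?_ ?_
  · intro a _ b _ hab
    exact Nat.eq_of_mul_eq_mul_left hd hab
  · intro k hk
    simp only [Finset.coe_range, mem_Iio, Nat.lt_succ_iff] at hk ⊢
    exact Nat.mul_le_mul_left d hk
  · intro k hk hk2
    have : ¬ d ∣ k := by
      rintro ⟨q, rfl⟩
      apply hk2
      refine ⟨q, ?_, rfl⟩
      simp only [Finset.coe_range, mem_Iio, Finset.mem_range, Nat.lt_succ_iff] at hk ⊢
      exact Nat.le_of_mul_le_mul_left hk hd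
    simp [expPowSeries, this]
  · intro k _
    rw [expPowSeries, PowerSeries.coeff_mk, if_pos (dvd_mul_right _ _),
      Nat.mul_div_cancel_left _ hd, thetaCoeff, pow_mul, ← ht, Complex.ofReal_pow]
    ring

/-- The remainder after the terms of order less than `K` is `O(t^K)`, for all `t > 0`. -/
theorem exists_norm_thetaRem_le (hd : 0 < d) (hγ : 0 < γ.re) (K : ℕ) :
    ∃ C : ℝ, 0 ≤ C ∧ ∀ t : ℝ, 0 < t → ‖thetaRem γ d K t‖ ≤ C * t ^ K := by
  -- in powers of the step `h = t ^ (1 / d)`, the order `d * K` corresponds to `t ^ K`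
  obtain ⟨C, hC⟩ := exists_norm_tsum_emTerm_le hd hγ (d * K + 1)
    ((polyExpDeriv γ d)^[d * K + 1] 1)
  refine ⟨‖thetaCoeff γ d K‖ + |C|, by positivity, fun t ht => ?_⟩
  set h : ℝ := t ^ (1 / (d : ℝ)) with hh
  have hpos : 0 < h := Real.rpow_pos_of_pos ht _
  have hpow : h ^ d = t := by
    rw [hh, one_div, Real.rpow_inv_natCast_pow ht.le hd.ne']
  have e := tsum_polyExp_one_eq hd hγ hpos (d * K)
  have e1 : ∑' n : ℕ, polyExp γ d 1 (h * (n + 1 : ℕ)) = thetaSum γ d t := by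
    rw [thetaSum_eq_tsum_nat]
    exact tsum_congr fun n => polyExp_one_rpow hd ht (n + 1)
  have e2 : (h : ℂ)⁻¹ = (t : ℂ) ^ (-(1 / (d : ℂ))) := by
    rw [hh, Complex.cpow_neg, Complex.ofReal_cpow ht.le]
    push_cast
    rfl
  rw [e1, tsum_emTerm_zero hd hγ hpos, sum_range_expPowSeries hd K hpow, e2] at e
  have e3 : thetaRem γ d K t = thetaCoeff γ d K * (t : ℂ) ^ K +
      (-1) ^ (d * K) * (h : ℂ) ^ (d * K + 1) / ((d * K + 1).factorial : ℂ) *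
        ∑' n, emTerm γ d (d * K + 1) ((polyExpDeriv γ d)^[d * K + 1] 1) h n := by
    rw [thetaRem, e, thetaLead, Finset.sum_range_succ]
    ring
  rw [e3, add_mul]
  refine (norm_add_le _ _).trans (add_le_add ?_ ?_)
  · rw [norm_mul, norm_pow, Complex.norm_real, Real.norm_of_nonneg ht.le]
  · rw [norm_mul, norm_div, norm_mul, norm_pow, norm_neg, norm_one, one_pow, one_mul, norm_pow,
      Complex.norm_real, Real.norm_of_nonneg hpos.le, Complex.norm_natCast]
    have hf : (1 : ℝ) ≤ ((d * K + 1).factorial : ℝ) := by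
      exact_mod_cast Nat.one_le_iff_ne_zero.2 (Nat.factorial_ne_zero _)
    calc h ^ (d * K + 1) / ((d * K + 1).factorial : ℝ) *
          ‖∑' n, emTerm γ d (d * K + 1) ((polyExpDeriv γ d)^[d * K + 1] 1) h n‖
        ≤ h ^ (d * K + 1) / 1 * (|C| / h) := by
          gcongr
          exact (hC h hpos).trans (by gcongr; exact le_abs_self C)
      _ = |C| * t ^ K := by
          rw [← hpow, ← pow_mul]
          field_simp
          ring

/-! ### The one-dimensional series -/

/-- The Mellin transform at `s` of `exp(-x t)` times the remainder of the theta function. -/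
def mellinRem (γ : ℂ) (d K : ℕ) (s x : ℂ) : ℂ :=
  ∫ t in Ioi (0 : ℝ), (t : ℂ) ^ (s - 1) * Complex.exp (-(x * t)) * thetaRem γ d K t

/-- The factor of the leading term `x^(1/d - s)` of `∑_{m ≥ 1} (x + γ m^d)^(-s)`. -/
def leadFactor (γ : ℂ) (d : ℕ) (s : ℂ) : ℂ :=
  thetaLead γ d * Complex.Gamma (s - 1 / d) / Complex.Gamma s

lemma rpow_mul_pow_eq {σ c t : ℝ} (ht : 0 < t) (K : ℕ) :
    t ^ (σ - 1) * Real.exp (-(c * t)) * t ^ K = t ^ (σ + K - 1) * Real.exp (-(c * t)) := by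
  rw [mul_right_comm, ← Real.rpow_natCast, ← Real.rpow_add ht]
  ring_nf

lemma integral_rpow_mul_exp_neg_mul {a c : ℝ} (ha : 0 < a) (hc : 0 < c) :
    ∫ t in Ioi (0 : ℝ), t ^ (a - 1) * Real.exp (-(c * t)) = Real.Gamma a * c ^ (-a) := by
  rw [Real.integral_rpow_mul_exp_neg_mul_Ioi ha hc, one_div, Real.inv_rpow hc.le,
    ← Real.rpow_neg hc.le, mul_comm]

lemma norm_mellinRem_integrand_le {K : ℕ} {C : ℝ}
    (hC : ∀ t : ℝ, 0 < t → ‖thetaRem γ d K t‖ ≤ C * t ^ K) (s x : ℂ) {t : ℝ} (ht : 0 < t) :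
    ‖(t : ℂ) ^ (s - 1) * Complex.exp (-(x * t)) * thetaRem γ d K t‖ ≤
      C * (t ^ (s.re + K - 1) * Real.exp (-(x.re * t))) := by
  rw [norm_mul, norm_cpow_mul_exp_neg ht]
  calc t ^ (s.re - 1) * Real.exp (-(x.re * t)) * ‖thetaRem γ d K t‖
      ≤ t ^ (s.re - 1) * Real.exp (-(x.re * t)) * (C * t ^ K) := by
        gcongr
        exact hC t ht
    _ = C * (t ^ (s.re - 1) * Real.exp (-(x.re * t)) * t ^ K) := by ring
    _ = _ := by rw [rpow_mul_pow_eq ht]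

lemma aestronglyMeasurable_mellinRem_integrand (hd : 0 < d) (hγ : 0 < γ.re) (K : ℕ) (s x : ℂ) :
    AEStronglyMeasurable
      (fun t : ℝ => (t : ℂ) ^ (s - 1) * Complex.exp (-(x * t)) * thetaRem γ d K t)
      (volume.restrict (Ioi 0)) :=
  ((continuousOn_cpow_mul_exp_neg s x).aestronglyMeasurable measurableSet_Ioi).mul
    (aestronglyMeasurable_thetaRem hd hγ K)

lemma integrableOn_mellinRem_integrand (hd : 0 < d) (hγ : 0 < γ.re) {K : ℕ} {s x : ℂ}
    (hs : -(K : ℝ) < s.re) (hx : 0 < x.re) :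
    IntegrableOn (fun t : ℝ => (t : ℂ) ^ (s - 1) * Complex.exp (-(x * t)) * thetaRem γ d K t)
      (Ioi 0) := by
  obtain ⟨C, -, hC⟩ := exists_norm_thetaRem_le hd hγ K
  refine ((integrableOn_rpow_mul_exp_neg_mul (a := s.re + K) (by linarith) hx).const_mul C).mono'
    (aestronglyMeasurable_mellinRem_integrand hd hγ K s x) ?_
  exact (ae_restrict_iff' measurableSet_Ioi).2 (Eventually.of_forall fun t ht =>
    norm_mellinRem_integrand_le hC s x ht)

lemma exists_norm_mellinRem_le (hd : 0 < d) (hγ : 0 < γ.re) (K : ℕ) :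
    ∃ C : ℝ, 0 ≤ C ∧ ∀ s x : ℂ, -(K : ℝ) < s.re → 0 < x.re →
      ‖mellinRem γ d K s x‖ ≤ C * Real.Gamma (s.re + K) * x.re ^ (-(s.re + K)) := by
  obtain ⟨C, hC0, hC⟩ := exists_norm_thetaRem_le hd hγ K
  refine ⟨C, hC0, fun s x hs hx => ?_⟩
  have ha : 0 < s.re + K := by linarith
  have := norm_integral_le_of_norm_le
    ((integrableOn_rpow_mul_exp_neg_mul ha hx).const_mul C)
    ((ae_restrict_iff' measurableSet_Ioi).2 (Eventually.of_forall fun t (ht : (0 : ℝ) < t) =>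
      norm_mellinRem_integrand_le hC s x ht))
  refine this.trans (le_of_eq ?_)
  rw [integral_const_mul, integral_rpow_mul_exp_neg_mul ha hx]
  ring

lemma cpow_mul_exp_mul_cpow {s x a : ℂ} {t : ℝ} (ht : 0 < t) :
    (t : ℂ) ^ (s - 1) * Complex.exp (-(x * t)) * (t : ℂ) ^ a =
      (t : ℂ) ^ (s + a - 1) * Complex.exp (-(x * t)) := by
  have ht' : (t : ℂ) ≠ 0 := by exact_mod_cast ht.ne'
  rw [mul_right_comm, ← Complex.cpow_add _ _ ht']
  ring_nf

lemma integral_cpow_mul_exp_mul_cpow {s x a : ℂ} (hs : 0 < (s + a).re) (hx : 0 < x.re) :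
    ∫ t in Ioi (0 : ℝ), (t : ℂ) ^ (s - 1) * Complex.exp (-(x * t)) * (t : ℂ) ^ a =
      Complex.Gamma (s + a) * x ^ (-(s + a)) := by
  rw [← integral_cpow_mul_exp_neg_of_re_pos hs hx]
  exact setIntegral_congr_fun measurableSet_Ioi fun t ht => cpow_mul_exp_mul_cpow ht

lemma integrableOn_cpow_mul_exp_mul_cpow {s x a : ℂ} (hs : 0 < (s + a).re) (hx : 0 < x.re) :
    IntegrableOn (fun t : ℝ => (t : ℂ) ^ (s - 1) * Complex.exp (-(x * t)) * (t : ℂ) ^ a)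
      (Ioi 0) :=
  (integrableOn_cpow_mul_exp_neg hs hx).congr_fun
    (fun _ ht => (cpow_mul_exp_mul_cpow ht).symm) measurableSet_Ioi

lemma mellinRem_succ (hd : 0 < d) (hγ : 0 < γ.re) {K : ℕ} {s x : ℂ}
    (hs : -(K : ℝ) < s.re) (hx : 0 < x.re) :
    mellinRem γ d K s x = thetaCoeff γ d K * Complex.Gamma (s + K) * x ^ (-(s + K)) +
      mellinRem γ d (K + 1) s x := by
  have ha : 0 < (s + K).re := by simp; linarith
  have e := integral_cpow_mul_exp_mul_cpow (a := K) ha hx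
  simp only [Complex.cpow_natCast] at e
  have i := integrableOn_cpow_mul_exp_mul_cpow (a := K) ha hx
  simp only [Complex.cpow_natCast] at i
  rw [mul_assoc, ← e, ← integral_const_mul, mellinRem, mellinRem, ← integral_add]
  · refine integral_congr_ae (Eventually.of_forall fun t => ?_)
    simp only
    rw [thetaRem_succ]
    ring
  · exact i.const_mul _
  · exact integrableOn_mellinRem_integrand hd hγ (by push_cast; linarith) hx

lemma summable_integral_norm_cpow_mul_exp (hd : 0 < d) (hγ : 0 < γ.re) {s x : ℂ}
    (hs : 1 / (d : ℝ) < s.re) (hx : 0 < x.re) :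
    Summable fun a : ℕ+ => ∫ t in Ioi (0 : ℝ),
      ‖(t : ℂ) ^ (s - 1) * Complex.exp (-((x + γ * ((a : ℕ) : ℂ) ^ d) * t))‖ := by
  have hd' : (0 : ℝ) < d := by exact_mod_cast hd
  have hσ : 0 < s.re := lt_trans (by positivity) hs
  have h1 : ∀ a : ℕ+, ∫ t in Ioi (0 : ℝ),
      ‖(t : ℂ) ^ (s - 1) * Complex.exp (-((x + γ * ((a : ℕ) : ℂ) ^ d) * t))‖ =
      (1 / (x.re + γ.re * ((a : ℕ) : ℝ) ^ d)) ^ s.re * Real.Gamma s.re := by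
    intro a
    have hr : (x + γ * ((a : ℕ) : ℂ) ^ d).re = x.re + γ.re * ((a : ℕ) : ℝ) ^ d := by
      have : (((a : ℕ) : ℂ) ^ d) = ((((a : ℕ) : ℝ) ^ d : ℝ) : ℂ) := by push_cast; rfl
      rw [this, Complex.add_re, Complex.re_mul_ofReal]
    rw [← Real.integral_rpow_mul_exp_neg_mul_Ioi hσ (by positivity)]
    refine setIntegral_congr_fun measurableSet_Ioi fun t ht => ?_
    rw [norm_cpow_mul_exp_neg ht, hr]
  simp_rw [h1]
  refine Summable.mul_right _ ?_
  have hsum : Summable fun a : ℕ+ => ((a : ℕ) : ℝ) ^ (-(d * s.re)) :=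
    (Real.summable_nat_rpow.2 (by
      have := (div_lt_iff₀ hd').1 hs
      linarith)).comp_injective PNat.coe_injective
  refine Summable.of_nonneg_of_le (fun a => by positivity) (fun a => ?_)
    (hsum.mul_left (γ.re ^ (-s.re)))
  have ha : (0 : ℝ) < (a : ℕ) := by exact_mod_cast a.pos
  calc (1 / (x.re + γ.re * ((a : ℕ) : ℝ) ^ d)) ^ s.re
      ≤ (1 / (γ.re * ((a : ℕ) : ℝ) ^ d)) ^ s.re := by
        gcongr
        linarith
    _ = γ.re ^ (-s.re) * ((a : ℕ) : ℝ) ^ (-(d * s.re)) := by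
        rw [one_div, Real.inv_rpow (by positivity), Real.mul_rpow hγ.le (by positivity),
          ← Real.rpow_natCast, ← Real.rpow_mul ha.le, mul_inv, ← Real.rpow_neg hγ.le,
          ← Real.rpow_neg ha.le]

/-- The one-dimensional series `∑_{m ≥ 1} (x + γ m^d)^(-s)` as its leading term plus a Mellin
transform. -/
theorem hasSum_add_mul_pow_cpow_neg (hd : 0 < d) (hγ : 0 < γ.re) {s x : ℂ}
    (hs : 1 / (d : ℝ) < s.re) (hx : 0 < x.re) :
    HasSum (fun a : ℕ+ => (x + γ * ((a : ℕ) : ℂ) ^ d) ^ (-s))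
      (leadFactor γ d s * x ^ (-(s + -(1 / (d : ℂ)))) +
        mellinRem γ d 0 s x / Complex.Gamma s) := by
  have hd' : (0 : ℝ) < d := by exact_mod_cast hd
  have hσ : 0 < s.re := lt_trans (by positivity) hs
  have hΓ : Complex.Gamma s ≠ 0 := Complex.Gamma_ne_zero_of_re_pos hσ
  have hre : ∀ a : ℕ+, 0 < (x + γ * ((a : ℕ) : ℂ) ^ d).re := by
    intro a
    have : (((a : ℕ) : ℂ) ^ d) = ((((a : ℕ) : ℝ) ^ d : ℝ) : ℂ) := by push_cast; rfl
    rw [this, Complex.add_re, Complex.re_mul_ofReal]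
    positivity
  have h := hasSum_integral_of_summable_integral_norm
    (fun a : ℕ+ => integrableOn_cpow_mul_exp_neg hσ (hre a))
    (summable_integral_norm_cpow_mul_exp hd hγ hs hx)
  simp_rw [integral_cpow_mul_exp_neg_of_re_pos hσ (hre _)] at h
  have hs' : 0 < (s + -(1 / (d : ℂ))).re := by
    rw [show -(1 / (d : ℂ)) = ((-(1 / d) : ℝ) : ℂ) by push_cast; rfl, Complex.add_re,
      Complex.ofReal_re]
    linarith
  have e : ∫ t in Ioi (0 : ℝ), ∑' a : ℕ+,
      (t : ℂ) ^ (s - 1) * Complex.exp (-((x + γ * ((a : ℕ) : ℂ) ^ d) * t)) =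
      thetaLead γ d * (Complex.Gamma (s + -(1 / (d : ℂ))) * x ^ (-(s + -(1 / (d : ℂ))))) +
        mellinRem γ d 0 s x := by
    rw [← integral_cpow_mul_exp_mul_cpow hs' hx, ← integral_const_mul, mellinRem, ← integral_add]
    · refine setIntegral_congr_fun measurableSet_Ioi fun t ht => ?_
      simp only [thetaRem, Finset.range_zero, Finset.sum_empty, sub_zero]
      rw [tsum_mul_left]
      have : ∑' a : ℕ+, Complex.exp (-((x + γ * ((a : ℕ) : ℂ) ^ d) * t)) =
          Complex.exp (-(x * t)) * thetaSum γ d t := by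
        rw [thetaSum, ← tsum_mul_left]
        refine tsum_congr fun a => ?_
        rw [← Complex.exp_add]
        ring_nf
      rw [this]
      ring
    · exact (integrableOn_cpow_mul_exp_mul_cpow hs' hx).const_mul _
    · exact integrableOn_mellinRem_integrand hd hγ (by simpa using hσ) hx
  rw [e] at h
  have h2 := h.div_const (Complex.Gamma s)
  have e1 : ∀ a : ℕ+, Complex.Gamma s * (x + γ * ((a : ℕ) : ℂ) ^ d) ^ (-s) / Complex.Gamma s =
      (x + γ * ((a : ℕ) : ℂ) ^ d) ^ (-s) := fun a => mul_div_cancel_left₀ _ hΓ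
  have e2 : leadFactor γ d s * x ^ (-(s + -(1 / (d : ℂ)))) +
      mellinRem γ d 0 s x / Complex.Gamma s =
      (thetaLead γ d * (Complex.Gamma (s + -(1 / (d : ℂ))) * x ^ (-(s + -(1 / (d : ℂ))))) +
        mellinRem γ d 0 s x) / Complex.Gamma s := by
    rw [leadFactor, sub_eq_add_neg]
    ring
  simp_rw [e1] at h2
  rw [e2]
  exact h2

end Theta

/-! ### Absolute convergence of the multiple series -/

/-- The vector `(s₁, …, s_{n-1}, sₙ + s_{n+1} + c)`: summation over the last variable of the
multiple series leads to the series in one variable less at such points. -/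
def mergeLast {R : Type*} [AddCommMonoid R] {n : ℕ} (s : Fin (n + 2) → R) (c : R) :
    Fin (n + 1) → R :=
  fun i => Fin.init s i + if i = Fin.last n then s (Fin.last (n + 1)) + c else 0

/-- The partial sum `γ₁ m₁^{d₁} + ⋯ + γⱼ mⱼ^{dⱼ}`. -/
def partSum {R : Type*} [CommSemiring R] {n : ℕ} (d : Fin n → ℕ) (γ : Fin n → R)
    (m : Fin n → ℕ+) (j : Fin n) : R :=
  ∑ k ∈ Finset.Iic j, γ k * ((m k : ℕ) : R) ^ d k

/-- The general term of the multiple series for real parameters. -/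
def realTerm {n : ℕ} (d : Fin n → ℕ) (c σ : Fin n → ℝ) (m : Fin n → ℕ+) : ℝ :=
  ∏ j, partSum d c m j ^ (-σ j)

/-- The real form of the conditions that define `convDomain`. -/
def ConvReal {n : ℕ} (d : Fin n → ℕ) (σ : Fin n → ℝ) : Prop :=
  ∀ j, ∑ k ∈ Finset.Ici j, (1 / (d k : ℝ)) < ∑ k ∈ Finset.Ici j, σ k

lemma mem_convDomain_iff {n : ℕ} {d : Fin n → ℕ} {s : Fin n → ℂ} :
    s ∈ convDomain d ↔ ConvReal d (fun k => (s k).re) := by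
  simp only [convDomain, mem_ofPred_eq, ConvReal, Complex.re_sum]

lemma sum_Iic_castSucc {R : Type*} [AddCommMonoid R] {n : ℕ} (f : Fin (n + 1) → R) (j : Fin n) :
    ∑ k ∈ Finset.Iic j.castSucc, f k = ∑ k ∈ Finset.Iic j, f k.castSucc := by
  rw [show Finset.Iic j.castSucc = Finset.univ.filter (· ≤ j.castSucc) by ext; simp,
    show Finset.Iic j = Finset.univ.filter (· ≤ j) by ext; simp, Finset.sum_filter,
    Finset.sum_filter, Fin.sum_univ_castSucc]
  simp

lemma sum_Iic_last {R : Type*} [AddCommMonoid R] {n : ℕ} (f : Fin (n + 1) → R) :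
    ∑ k ∈ Finset.Iic (Fin.last n), f k = ∑ k, f k := by
  congr 1
  ext k
  simp [Fin.le_last]

lemma sum_Ici_castSucc {R : Type*} [AddCommMonoid R] {n : ℕ} (f : Fin (n + 1) → R) (j : Fin n) :
    ∑ k ∈ Finset.Ici j.castSucc, f k = ∑ k ∈ Finset.Ici j, f k.castSucc + f (Fin.last n) := by
  rw [show Finset.Ici j.castSucc = Finset.univ.filter (j.castSucc ≤ ·) by ext; simp,
    show Finset.Ici j = Finset.univ.filter (j ≤ ·) by ext; simp, Finset.sum_filter,
    Finset.sum_filter, Fin.sum_univ_castSucc]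
  simp [Fin.le_last]

lemma sum_Ici_last {R : Type*} [AddCommMonoid R] {n : ℕ} (f : Fin (n + 1) → R) :
    ∑ k ∈ Finset.Ici (Fin.last n), f k = f (Fin.last n) := by
  rw [show Finset.Ici (Fin.last n) = {Fin.last n} by ext; simp [Fin.last_le_iff]]
  simp

lemma sum_Ici_mergeLast {R : Type*} [AddCommMonoid R] {n : ℕ} (s : Fin (n + 2) → R) (c : R)
    (j : Fin (n + 1)) :
    ∑ k ∈ Finset.Ici j, mergeLast s c k = ∑ k ∈ Finset.Ici j.castSucc, s k + c := by
  rw [sum_Ici_castSucc]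
  simp only [mergeLast, Finset.sum_add_distrib, Finset.sum_ite_eq', Finset.mem_Ici, Fin.le_last,
    if_true, add_assoc]
  rfl

section Terms

variable {n : ℕ}

lemma partSum_snoc_castSucc {R : Type*} [CommSemiring R] (d : Fin (n + 1) → ℕ)
    (γ : Fin (n + 1) → R) (m : Fin n → ℕ+) (a : ℕ+) (j : Fin n) :
    partSum d γ (Fin.snoc m a : Fin (n + 1) → ℕ+) j.castSucc =
      partSum (Fin.init d) (Fin.init γ) m j := by
  rw [partSum, sum_Iic_castSucc]
  simp only [Fin.snoc_castSucc]
  rfl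

lemma partSum_snoc_last {R : Type*} [CommSemiring R] (d : Fin (n + 2) → ℕ)
    (γ : Fin (n + 2) → R) (m : Fin (n + 1) → ℕ+) (a : ℕ+) :
    partSum d γ (Fin.snoc m a : Fin (n + 2) → ℕ+) (Fin.last (n + 1)) =
      partSum (Fin.init d) (Fin.init γ) m (Fin.last n) +
        γ (Fin.last (n + 1)) * ((a : ℕ) : R) ^ d (Fin.last (n + 1)) := by
  rw [partSum, partSum, sum_Iic_last, sum_Iic_last, Fin.sum_univ_castSucc]
  simp only [Fin.snoc_castSucc, Fin.snoc_last]
  rfl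

lemma partSum_zero {R : Type*} [CommSemiring R] (d : Fin (n + 1) → ℕ)
    (γ : Fin (n + 1) → R) (m : Fin (n + 1) → ℕ+) :
    partSum d γ m 0 = γ 0 * ((m 0 : ℕ) : R) ^ d 0 := by
  rw [partSum, show Finset.Iic (0 : Fin (n + 1)) = {0} by ext; simp, Finset.sum_singleton]

lemma partSum_re (d : Fin n → ℕ) (γ : Fin n → ℂ) (m : Fin n → ℕ+) (j : Fin n) :
    (partSum d γ m j).re = partSum d (fun k => (γ k).re) m j := by
  rw [partSum, partSum, Complex.re_sum]
  refine Finset.sum_congr rfl fun k _ => ?_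
  rw [show ((((m k : ℕ+) : ℕ) : ℂ) ^ d k) = (((((m k : ℕ+) : ℕ) : ℝ) ^ d k : ℝ) : ℂ) by
    push_cast; rfl, Complex.re_mul_ofReal]

lemma le_partSum (d : Fin (n + 1) → ℕ) {c : Fin (n + 1) → ℝ} (hc : ∀ j, 0 < c j)
    (m : Fin (n + 1) → ℕ+) (j : Fin (n + 1)) : c 0 ≤ partSum d c m j := by
  have h1 : ∀ k, c k ≤ c k * ((m k : ℕ) : ℝ) ^ d k := fun k =>
    le_mul_of_one_le_right (hc k).le (one_le_pow₀ (by exact_mod_cast (m k).pos))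
  exact (h1 0).trans (Finset.single_le_sum (f := fun k => c k * ((m k : ℕ) : ℝ) ^ d k)
    (fun k _ => (hc k).le.trans (h1 k)) (Finset.mem_Iic.2 (Fin.zero_le j)))

lemma partSum_pos (d : Fin (n + 1) → ℕ) {c : Fin (n + 1) → ℝ} (hc : ∀ j, 0 < c j)
    (m : Fin (n + 1) → ℕ+) (j : Fin (n + 1)) : 0 < partSum d c m j :=
  (hc 0).trans_le (le_partSum d hc m j)

lemma partSum_re_pos (d : Fin (n + 1) → ℕ) {γ : Fin (n + 1) → ℂ} (hγ : ∀ j, 0 < (γ j).re)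
    (m : Fin (n + 1) → ℕ+) (j : Fin (n + 1)) : 0 < (partSum d γ m j).re := by
  rw [partSum_re]
  exact partSum_pos d hγ m j

lemma realTerm_pos (d : Fin (n + 1) → ℕ) {c : Fin (n + 1) → ℝ} (hc : ∀ j, 0 < c j)
    (σ : Fin (n + 1) → ℝ) (m : Fin (n + 1) → ℕ+) : 0 < realTerm d c σ m :=
  Finset.prod_pos fun j _ => Real.rpow_pos_of_pos (partSum_pos d hc m j) _

lemma realTerm_snoc (d : Fin (n + 2) → ℕ) (c σ : Fin (n + 2) → ℝ) (m : Fin (n + 1) → ℕ+)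
    (a : ℕ+) :
    realTerm d c σ (Fin.snoc m a : Fin (n + 2) → ℕ+) =
      realTerm (Fin.init d) (Fin.init c) (Fin.init σ) m *
        (partSum (Fin.init d) (Fin.init c) m (Fin.last n) +
          c (Fin.last (n + 1)) * ((a : ℕ) : ℝ) ^ d (Fin.last (n + 1))) ^
            (-σ (Fin.last (n + 1))) := by
  rw [realTerm, Fin.prod_univ_castSucc, partSum_snoc_last, realTerm]
  simp_rw [partSum_snoc_castSucc]
  rfl

lemma realTerm_mergeLast (d : Fin (n + 1) → ℕ) {c : Fin (n + 1) → ℝ} (hc : ∀ j, 0 < c j)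
    (σ : Fin (n + 2) → ℝ) (x : ℝ) (m : Fin (n + 1) → ℕ+) :
    realTerm d c (mergeLast σ x) m =
      realTerm d c (Fin.init σ) m *
        partSum d c m (Fin.last n) ^ (-(σ (Fin.last (n + 1)) + x)) := by
  have h : ∀ j, partSum d c m j ^ (-mergeLast σ x j) = partSum d c m j ^ (-Fin.init σ j) *
      if j = Fin.last n then partSum d c m j ^ (-(σ (Fin.last (n + 1)) + x)) else 1 := by
    intro j
    split_ifs with hj
    · rw [← Real.rpow_add (partSum_pos d hc m j), mergeLast, if_pos hj, neg_add]
    · rw [mergeLast, if_neg hj, add_zero, mul_one]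
  rw [realTerm, Finset.prod_congr rfl fun j _ => h j, Finset.prod_mul_distrib,
    Finset.prod_ite_eq']
  simp [realTerm]

lemma zetaTerm_eq_prod (d : Fin n → ℕ) (γ s : Fin n → ℂ) (m : Fin n → ℕ+) :
    zetaTerm d γ s m = ∏ j, partSum d γ m j ^ (-s j) := by
  simp_rw [zetaTerm, one_div, ← Finset.prod_inv_distrib, Complex.cpow_neg]
  rfl

lemma zetaTerm_snoc (d : Fin (n + 2) → ℕ) (γ s : Fin (n + 2) → ℂ) (m : Fin (n + 1) → ℕ+)
    (a : ℕ+) :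
    zetaTerm d γ s (Fin.snoc m a : Fin (n + 2) → ℕ+) =
      zetaTerm (Fin.init d) (Fin.init γ) (Fin.init s) m *
        (partSum (Fin.init d) (Fin.init γ) m (Fin.last n) +
          γ (Fin.last (n + 1)) * ((a : ℕ) : ℂ) ^ d (Fin.last (n + 1))) ^
            (-s (Fin.last (n + 1))) := by
  rw [zetaTerm_eq_prod, Fin.prod_univ_castSucc, partSum_snoc_last, zetaTerm_eq_prod]
  simp_rw [partSum_snoc_castSucc]
  rfl

lemma zetaTerm_mergeLast (d : Fin (n + 1) → ℕ) {γ : Fin (n + 1) → ℂ} (hγ : ∀ j, 0 < (γ j).re)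
    (s : Fin (n + 2) → ℂ) (x : ℂ) (m : Fin (n + 1) → ℕ+) :
    zetaTerm d γ (mergeLast s x) m =
      zetaTerm d γ (Fin.init s) m *
        partSum d γ m (Fin.last n) ^ (-(s (Fin.last (n + 1)) + x)) := by
  have hne : ∀ j, partSum d γ m j ≠ 0 := by
    intro j h
    have := partSum_re_pos d hγ m j
    rw [h] at this
    exact lt_irrefl _ this
  have h : ∀ j, partSum d γ m j ^ (-mergeLast s x j) = partSum d γ m j ^ (-Fin.init s j) *
      if j = Fin.last n then partSum d γ m j ^ (-(s (Fin.last (n + 1)) + x)) else 1 := by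
    intro j
    split_ifs with hj
    · rw [← Complex.cpow_add _ _ (hne j), mergeLast, if_pos hj, neg_add]
    · rw [mergeLast, if_neg hj, add_zero, mul_one]
  rw [zetaTerm_eq_prod, Finset.prod_congr rfl fun j _ => h j, Finset.prod_mul_distrib,
    Finset.prod_ite_eq', zetaTerm_eq_prod]
  simp

lemma ConvReal.last {d : Fin (n + 1) → ℕ} {σ : Fin (n + 1) → ℝ} (h : ConvReal d σ) :
    1 / (d (Fin.last n) : ℝ) < σ (Fin.last n) := by
  simpa only [sum_Ici_last] using h (Fin.last n)

lemma ConvReal.mergeLast {d : Fin (n + 2) → ℕ} {σ : Fin (n + 2) → ℝ} (h : ConvReal d σ) :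
    ConvReal (Fin.init d) (mergeLast σ (-(1 / (d (Fin.last (n + 1)) : ℝ)))) := by
  intro j
  have := h j.castSucc
  rw [sum_Ici_mergeLast]
  rw [sum_Ici_castSucc] at this
  simp only [Fin.init]
  linarith

lemma ConvReal.mergeLast_zero {d : Fin (n + 2) → ℕ} {σ : Fin (n + 2) → ℝ} (h : ConvReal d σ) :
    ConvReal (Fin.init d) (_root_.mergeLast σ 0) := by
  intro j
  have := h j.castSucc
  rw [sum_Ici_mergeLast]
  rw [sum_Ici_castSucc] at this
  have h0 : (0 : ℝ) ≤ 1 / (d (Fin.last (n + 1)) : ℝ) := by positivity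
  simp only [Fin.init]
  linarith

/-- The real one-dimensional series, uniformly for `Y` bounded away from `0`. -/
lemma exists_tsum_add_mul_pow_rpow_neg_le {d : ℕ} (hd : 0 < d) {c : ℝ} (hc : 0 < c) {σ : ℝ}
    (hσ : 1 / (d : ℝ) < σ) {y₀ : ℝ} (hy₀ : 0 < y₀) :
    ∃ C : ℝ, ∀ Y : ℝ, y₀ ≤ Y →
      Summable (fun a : ℕ+ => (Y + c * ((a : ℕ) : ℝ) ^ d) ^ (-σ)) ∧
      ∑' a : ℕ+, (Y + c * ((a : ℕ) : ℝ) ^ d) ^ (-σ) ≤ C * Y ^ (-(σ + -(1 / (d : ℝ)))) := by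
  have hd' : (0 : ℝ) < d := by exact_mod_cast hd
  have hσ0 : 0 < σ := lt_trans (by positivity) hσ
  obtain ⟨C, hC0, hC⟩ := exists_norm_mellinRem_le (γ := (c : ℂ)) hd (by simpa using hc) 0
  refine ⟨‖leadFactor c d σ‖ + C * Real.Gamma σ / ‖Complex.Gamma σ‖ * y₀ ^ (-(1 / (d : ℝ))),
    fun Y hY => ?_⟩
  have hY0 : 0 < Y := hy₀.trans_le hY
  have h := hasSum_add_mul_pow_cpow_neg (γ := (c : ℂ)) (s := (σ : ℂ)) (x := (Y : ℂ)) hd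
    (by simpa using hc) (by simpa using hσ) (by simpa using hY0)
  have e : ∀ a : ℕ+, ((Y : ℂ) + (c : ℂ) * ((a : ℕ) : ℂ) ^ d) ^ (-(σ : ℂ)) =
      (((Y + c * ((a : ℕ) : ℝ) ^ d) ^ (-σ) : ℝ) : ℂ) := by
    intro a
    rw [Complex.ofReal_cpow (by positivity)]
    push_cast
    rfl
  simp_rw [e] at h
  have hs : Summable (fun a : ℕ+ => (Y + c * ((a : ℕ) : ℝ) ^ d) ^ (-σ)) :=
    Complex.summable_ofReal.1 h.summable
  refine ⟨hs, ?_⟩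
  have h2 := (Complex.hasSum_ofReal.2 hs.hasSum).unique h
  have h3 : ∑' a : ℕ+, (Y + c * ((a : ℕ) : ℝ) ^ d) ^ (-σ) =
      ‖((∑' a : ℕ+, (Y + c * ((a : ℕ) : ℝ) ^ d) ^ (-σ) : ℝ) : ℂ)‖ := by
    rw [Complex.norm_real, Real.norm_of_nonneg (tsum_nonneg fun a => by positivity)]
  rw [h3, h2]
  refine (norm_add_le _ _).trans ?_
  rw [add_mul]
  refine add_le_add (le_of_eq ?_) ?_
  · rw [norm_mul, Complex.norm_cpow_eq_rpow_re_of_pos hY0]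
    congr 2
    rw [show -((σ : ℂ) + -(1 / (d : ℂ))) = ((-(σ + -(1 / (d : ℝ))) : ℝ) : ℂ) by push_cast; rfl,
      Complex.ofReal_re]
  · have := hC σ Y (by simpa using hσ0) (by simpa using hY0)
    simp only [Complex.ofReal_re, Nat.cast_zero, add_zero] at this
    rw [norm_div]
    have h4 : Y ^ (-σ) ≤ y₀ ^ (-(1 / (d : ℝ))) * Y ^ (-(σ + -(1 / (d : ℝ)))) := by
      rw [show Y ^ (-σ) = Y ^ (-(1 / (d : ℝ))) * Y ^ (-(σ + -(1 / (d : ℝ)))) by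
        rw [← Real.rpow_add hY0]; ring_nf]
      have : Y ^ (-(1 / (d : ℝ))) ≤ y₀ ^ (-(1 / (d : ℝ))) :=
        Real.rpow_le_rpow_of_nonpos hy₀ hY (by
          have : 0 < 1 / (d : ℝ) := by positivity
          linarith)
      exact mul_le_mul_of_nonneg_right this (Real.rpow_nonneg hY0.le _)
    have hG : 0 < Real.Gamma σ := Real.Gamma_pos_of_pos hσ0
    calc ‖mellinRem c d 0 σ Y‖ / ‖Complex.Gamma σ‖
        ≤ C * Real.Gamma σ * Y ^ (-σ) / ‖Complex.Gamma σ‖ := by gcongr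
      _ ≤ C * Real.Gamma σ * (y₀ ^ (-(1 / (d : ℝ))) * Y ^ (-(σ + -(1 / (d : ℝ))))) /
            ‖Complex.Gamma σ‖ := by gcongr
      _ = _ := by ring

end Terms

/-- Splitting off the last index. -/
def snocPNat (n : ℕ) : ((Fin n → ℕ+) × ℕ+) ≃ (Fin (n + 1) → ℕ+) :=
  (Equiv.prodComm _ _).trans (Fin.snocEquiv fun _ => ℕ+)

lemma snocPNat_apply {n : ℕ} (m : Fin n → ℕ+) (a : ℕ+) :
    snocPNat n (m, a) = (Fin.snoc m a : Fin (n + 1) → ℕ+) := rfl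

theorem summable_realTerm {n : ℕ} {d : Fin (n + 1) → ℕ} (hd : ∀ j, 0 < d j)
    {c : Fin (n + 1) → ℝ} (hc : ∀ j, 0 < c j) {σ : Fin (n + 1) → ℝ} (hσ : ConvReal d σ) :
    Summable (realTerm d c σ) := by
  induction n with
  | zero =>
    have h := hσ.last
    have hd' : (0 : ℝ) < d 0 := by exact_mod_cast hd 0
    have hs : Summable fun a : ℕ+ => c 0 ^ (-σ 0) * ((a : ℕ) : ℝ) ^ (-(d 0 * σ 0)) :=
      ((Real.summable_nat_rpow.2 (by
        have := (div_lt_iff₀ hd').1 h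
        simp at this
        linarith)).comp_injective PNat.coe_injective).mul_left _
    rw [← (Equiv.funUnique (Fin 1) ℕ+).symm.summable_iff]
    refine hs.congr fun a => ?_
    have ha : (0 : ℝ) < (a : ℕ) := by exact_mod_cast a.pos
    rw [Function.comp, realTerm, Fin.prod_univ_succ, Fin.prod_univ_zero, mul_one, partSum_zero]
    simp only [Equiv.funUnique_symm_apply, uniqueElim_const]
    rw [Real.mul_rpow (hc 0).le (by positivity), ← Real.rpow_natCast, ← Real.rpow_mul ha.le]
    ring_nf
  | succ n ih =>
    have ih' := ih (d := Fin.init d) (fun j => hd _) (c := Fin.init c) (fun j => hc _)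
      hσ.mergeLast
    obtain ⟨C, hC⟩ := exists_tsum_add_mul_pow_rpow_neg_le (hd (Fin.last (n + 1)))
      (hc (Fin.last (n + 1))) hσ.last (y₀ := c 0) (hc 0)
    have hle : ∀ m, c 0 ≤ partSum (Fin.init d) (Fin.init c) m (Fin.last n) := fun m =>
      le_partSum (Fin.init d) (c := Fin.init c) (fun j => hc _) m (Fin.last n)
    have h0 : 0 ≤ realTerm d c σ ∘ snocPNat (n + 1) := fun x => (realTerm_pos d hc σ _).le
    rw [← (snocPNat (n + 1)).summable_iff, summable_prod_of_nonneg h0]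
    simp only [Function.comp, snocPNat_apply, realTerm_snoc]
    refine ⟨fun m => ((hC _ (hle m)).1).mul_left _, ?_⟩
    refine Summable.of_nonneg_of_le (fun m => tsum_nonneg fun a => ?_) (fun m => ?_)
      (ih'.mul_left C)
    · rw [← realTerm_snoc]
      exact (realTerm_pos d hc σ _).le
    · rw [tsum_mul_left, realTerm_mergeLast _ (c := Fin.init c) fun j => hc _]
      have hp : 0 < realTerm (Fin.init d) (Fin.init c) (Fin.init σ) m :=
        realTerm_pos _ (c := Fin.init c) (fun j => hc _) _ _
      calc _ ≤ realTerm (Fin.init d) (Fin.init c) (Fin.init σ) m * (C * _) :=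
            mul_le_mul_of_nonneg_left (hC _ (hle m)).2 hp.le
        _ = _ := by ring

/-! ### The remainder series and its analyticity -/

section Bounds

variable {n : ℕ}

lemma exists_norm_partSum_le (d : Fin (n + 1) → ℕ) {γ : Fin (n + 1) → ℂ}
    (hγ : ∀ j, 0 < (γ j).re) :
    ∃ C : ℝ, 1 ≤ C ∧ ∀ m j, ‖partSum d γ m j‖ ≤ C * (partSum d γ m j).re := by
  have h0 : ∀ k, 0 ≤ ‖γ k‖ / (γ k).re := fun k => div_nonneg (norm_nonneg _) (hγ k).le
  refine ⟨1 + ∑ k, ‖γ k‖ / (γ k).re, by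
    have := Finset.sum_nonneg fun k (_ : k ∈ Finset.univ) => h0 k
    linarith, fun m j => ?_⟩
  have h1 : ∀ k, ‖γ k‖ ≤ (1 + ∑ k, ‖γ k‖ / (γ k).re) * (γ k).re := by
    intro k
    have := Finset.single_le_sum (fun k _ => h0 k) (Finset.mem_univ k)
    rw [← div_le_iff₀ (hγ k)]
    linarith
  rw [partSum_re, partSum, partSum, Finset.mul_sum]
  refine (norm_sum_le _ _).trans (Finset.sum_le_sum fun k _ => ?_)
  rw [norm_mul, norm_pow, Complex.norm_natCast, ← mul_assoc]
  exact mul_le_mul_of_nonneg_right (h1 k) (by positivity)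

lemma norm_cpow_neg_le {X : ℂ} {C : ℝ} (hC : 1 ≤ C) (hX : 0 < X.re) (h : ‖X‖ ≤ C * X.re) (s : ℂ) :
    ‖X ^ (-s)‖ ≤ Real.exp (Real.pi * |s.im|) * C ^ |s.re| * X.re ^ (-s.re) := by
  have hX0 : 0 < ‖X‖ := hX.trans_le (Complex.re_le_norm X)
  have h1 : ‖X‖ ^ (-s.re) ≤ C ^ |s.re| * X.re ^ (-s.re) := by
    rcases le_total s.re 0 with hs | hs
    · rw [abs_of_nonpos hs, ← Real.mul_rpow (by linarith) hX.le]
      exact Real.rpow_le_rpow hX0.le h (by linarith)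
    · have h2 : ‖X‖ ^ (-s.re) ≤ X.re ^ (-s.re) :=
        Real.rpow_le_rpow_of_nonpos hX (Complex.re_le_norm X) (by linarith)
      have h3 : 1 ≤ C ^ |s.re| := Real.one_le_rpow hC (abs_nonneg _)
      exact h2.trans (le_mul_of_one_le_left (Real.rpow_nonneg hX.le _) h3)
  have h4 : Real.exp (-(X.arg * (-s).im)) ≤ Real.exp (Real.pi * |s.im|) := by
    refine Real.exp_le_exp.2 ((le_abs_self _).trans ?_)
    rw [abs_neg, abs_mul, Complex.neg_im, abs_neg]
    exact mul_le_mul_of_nonneg_right (Complex.abs_arg_le_pi X) (abs_nonneg _)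
  calc ‖X ^ (-s)‖ ≤ ‖X‖ ^ (-s).re / Real.exp (X.arg * (-s).im) := Complex.norm_cpow_le X (-s)
    _ = Real.exp (-(X.arg * (-s).im)) * ‖X‖ ^ (-s.re) := by
        rw [Real.exp_neg, Complex.neg_re]; ring
    _ ≤ Real.exp (Real.pi * |s.im|) * (C ^ |s.re| * X.re ^ (-s.re)) := by gcongr
    _ = _ := by ring

lemma exists_norm_zetaTerm_le (d : Fin (n + 1) → ℕ) {γ : Fin (n + 1) → ℂ}
    (hγ : ∀ j, 0 < (γ j).re) (s : Fin (n + 1) → ℂ) :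
    ∃ B : ℝ, 0 ≤ B ∧ ∀ m, ‖zetaTerm d γ s m‖ ≤
      B * realTerm d (fun k => (γ k).re) (fun k => (s k).re) m := by
  obtain ⟨C, hC1, hC⟩ := exists_norm_partSum_le d hγ
  refine ⟨∏ j, (Real.exp (Real.pi * |(s j).im|) * C ^ |(s j).re|),
    Finset.prod_nonneg fun j _ => by positivity, fun m => ?_⟩
  rw [zetaTerm_eq_prod, norm_prod, realTerm, ← Finset.prod_mul_distrib]
  refine Finset.prod_le_prod (fun j _ => norm_nonneg _) fun j _ => ?_
  rw [← partSum_re]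
  exact norm_cpow_neg_le hC1 (partSum_re_pos d hγ m j) (hC m j) _

lemma summable_zetaTerm {d : Fin (n + 1) → ℕ} (hd : ∀ j, 0 < d j) {γ : Fin (n + 1) → ℂ}
    (hγ : ∀ j, 0 < (γ j).re) {s : Fin (n + 1) → ℂ} (hs : s ∈ convDomain d) :
    Summable (zetaTerm d γ s) := by
  obtain ⟨B, -, hB⟩ := exists_norm_zetaTerm_le d hγ s
  exact Summable.of_norm_bounded
    ((summable_realTerm hd hγ (mem_convDomain_iff.1 hs)).mul_left B) hB

lemma exp_mul_norm_log_le {X : ℂ} {C y₀ r : ℝ} (hC : 1 ≤ C) (hy₀ : 0 < y₀) (hX : y₀ ≤ X.re)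
    (h : ‖X‖ ≤ C * X.re) (hr : 0 ≤ r) :
    Real.exp (r * ‖Complex.log X‖) ≤
      Real.exp (r * (Real.log C + 2 * |Real.log y₀| + Real.pi)) * X.re ^ r := by
  have hX0 : 0 < X.re := hy₀.trans_le hX
  have hn : 0 < ‖X‖ := hX0.trans_le (Complex.re_le_norm X)
  rw [Real.rpow_def_of_pos hX0, ← Real.exp_add, Real.exp_le_exp]
  have h1 : ‖Complex.log X‖ ≤ |Real.log ‖X‖| + Real.pi := by
    have := Complex.norm_le_abs_re_add_abs_im (Complex.log X)
    rw [Complex.log_re, Complex.log_im] at this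
    have h2 := Complex.abs_arg_le_pi X
    linarith
  have h2 : Real.log ‖X‖ ≤ Real.log C + Real.log X.re := by
    rw [← Real.log_mul (by linarith) hX0.ne']
    exact Real.log_le_log hn h
  have h3 : Real.log y₀ ≤ Real.log ‖X‖ := Real.log_le_log hy₀ (hX.trans (Complex.re_le_norm X))
  have h4 : |Real.log ‖X‖| ≤ Real.log ‖X‖ + 2 * |Real.log y₀| := by
    have := neg_abs_le (Real.log y₀)
    rw [abs_le]
    constructor <;> linarith [abs_nonneg (Real.log y₀)]
  have : ‖Complex.log X‖ ≤ Real.log C + 2 * |Real.log y₀| + Real.pi + Real.log X.re := by linarith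
  nlinarith [mul_le_mul_of_nonneg_left this hr]

lemma exp_mul_abs_log_le {r t : ℝ} (ht : 0 < t) :
    Real.exp (r * |Real.log t|) ≤ t ^ r + t ^ (-r) := by
  have h1 : 0 < t ^ r := Real.rpow_pos_of_pos ht _
  have h2 : 0 < t ^ (-r) := Real.rpow_pos_of_pos ht _
  rcases abs_choice (Real.log t) with h | h <;> rw [h]
  · rw [mul_comm, ← Real.rpow_def_of_pos ht]; linarith
  · rw [mul_neg, ← neg_mul, mul_comm, ← Real.rpow_def_of_pos ht]; linarith

end Bounds

/-- The real parts of the points at which the `K`-th remainder series converges. -/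
def remDomainReal {n : ℕ} (d : Fin (n + 1) → ℕ) (K : ℕ) : Set (Fin (n + 2) → ℝ) :=
  {σ | -(K : ℝ) < σ (Fin.last (n + 1)) ∧ ConvReal d (mergeLast σ (K : ℝ))}

/-- The domain on which the `K`-th remainder series converges and is holomorphic. -/
def remDomain {n : ℕ} (d : Fin (n + 1) → ℕ) (K : ℕ) : Set (Fin (n + 2) → ℂ) :=
  {s | (fun k => (s k).re) ∈ remDomainReal d K}

instance : MeasurableSpace ℕ+ := ⊤

instance : DiscreteMeasurableSpace ℕ+ := ⟨fun _ => trivial⟩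

/-- The measure on pairs `(m, t)` by which the remainder series is a single integral. -/
def remMeasure (n : ℕ) : Measure ((Fin n → ℕ+) × ℝ) :=
  Measure.count.prod (volume.restrict (Ioi 0))

/-- The remainder series: `∑_m zetaTerm(m) · mellinRem`, where `m` runs over all the indices but
the last one, whose data are `d₁` and `γ₁`. -/
def remSum {n : ℕ} (d : Fin (n + 1) → ℕ) (γ : Fin (n + 1) → ℂ) (d₁ : ℕ) (γ₁ : ℂ) (K : ℕ)
    (s : Fin (n + 2) → ℂ) : ℂ :=
  ∑' m : Fin (n + 1) → ℕ+, zetaTerm d γ (Fin.init s) m *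
    mellinRem γ₁ d₁ K (s (Fin.last (n + 1))) (partSum d γ m (Fin.last n))

section Remainder

variable {n : ℕ} {d : Fin (n + 1) → ℕ} {γ : Fin (n + 1) → ℂ} {d₁ : ℕ} {γ₁ : ℂ} {K : ℕ}

lemma convReal_mergeLast_iff {σ : Fin (n + 2) → ℝ} {x : ℝ} :
    ConvReal d (mergeLast σ x) ↔
      ∀ j : Fin (n + 1), ∑ k ∈ Finset.Ici j, (1 / (d k : ℝ)) <
        ∑ k ∈ Finset.Ici j.castSucc, σ k + x := by
  simp only [ConvReal, sum_Ici_mergeLast]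

lemma isOpen_remDomainReal (d : Fin (n + 1) → ℕ) (K : ℕ) : IsOpen (remDomainReal d K) := by
  have : remDomainReal d K = {σ | -(K : ℝ) < σ (Fin.last (n + 1))} ∩
      ⋂ j : Fin (n + 1), {σ | ∑ k ∈ Finset.Ici j, (1 / (d k : ℝ)) <
        ∑ k ∈ Finset.Ici j.castSucc, σ k + K} := by
    ext σ
    simp [remDomainReal, convReal_mergeLast_iff]
  rw [this]
  exact (isOpen_lt continuous_const (by fun_prop)).inter
    (isOpen_iInter_of_finite fun j => isOpen_lt continuous_const (by fun_prop))

lemma isOpen_remDomain (d : Fin (n + 1) → ℕ) (K : ℕ) : IsOpen (remDomain d K) :=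
  (isOpen_remDomainReal d K).preimage (f := fun (s : Fin (n + 2) → ℂ) k => (s k).re) (by fun_prop)

lemma re_mergeLast (s : Fin (n + 2) → ℂ) (x : ℝ) (k : Fin (n + 1)) :
    (mergeLast s (x : ℂ) k).re = mergeLast (fun k => (s k).re) x k := by
  simp only [mergeLast, Fin.init]
  split_ifs <;> simp

lemma mem_remDomain_iff {s : Fin (n + 2) → ℂ} :
    s ∈ remDomain d K ↔ -(K : ℝ) < (s (Fin.last (n + 1))).re ∧
      mergeLast s (K : ℂ) ∈ convDomain d := by
  have : (fun k => (mergeLast s (K : ℂ) k).re) = mergeLast (fun k => (s k).re) (K : ℝ) :=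
    funext fun k => by simpa using re_mergeLast s (K : ℝ) k
  rw [mem_convDomain_iff, this]
  rfl

lemma integrable_remMeasure {c : Fin (n + 1) → ℝ} (hd : ∀ j, 0 < d j) (hc : ∀ j, 0 < c j)
    {τ : Fin (n + 2) → ℝ} (hτ : τ ∈ remDomainReal d K) :
    Integrable (fun p : (Fin (n + 1) → ℕ+) × ℝ => realTerm d c (Fin.init τ) p.1 *
      (p.2 ^ (τ (Fin.last (n + 1)) + K - 1) *
        Real.exp (-(partSum d c p.1 (Fin.last n) * p.2)))) (remMeasure (n + 1)) := by
  have ha : 0 < τ (Fin.last (n + 1)) + K := by linarith [hτ.1]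
  have hm : Measurable (fun p : (Fin (n + 1) → ℕ+) × ℝ => realTerm d c (Fin.init τ) p.1 *
      (p.2 ^ (τ (Fin.last (n + 1)) + K - 1) *
        Real.exp (-(partSum d c p.1 (Fin.last n) * p.2)))) :=
    measurable_from_prod_countable_right fun m => by fun_prop
  rw [remMeasure, integrable_prod_iff hm.aestronglyMeasurable]
  refine ⟨Eventually.of_forall fun m =>
    (integrableOn_rpow_mul_exp_neg_mul ha (partSum_pos d hc m (Fin.last n))).const_mul
      (realTerm d c (Fin.init τ) m), ?_⟩
  rw [integrable_count_iff]
  refine Summable.congr ((summable_realTerm hd hc hτ.2).mul_left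
    (Real.Gamma (τ (Fin.last (n + 1)) + K))) fun m => ?_
  have hY := partSum_pos d hc m (Fin.last n)
  rw [realTerm_mergeLast d hc, mul_left_comm, ← integral_rpow_mul_exp_neg_mul ha hY,
    ← integral_const_mul, Real.norm_of_nonneg]
  · refine setIntegral_congr_fun measurableSet_Ioi fun t (ht : 0 < t) => ?_
    rw [Real.norm_of_nonneg]
    have := (realTerm_pos d hc (Fin.init τ) m).le
    positivity
  · exact integral_nonneg fun t => norm_nonneg _

/-- The integrand of the remainder series. -/
def remIntegrand (d : Fin (n + 1) → ℕ) (γ : Fin (n + 1) → ℂ) (d₁ : ℕ) (γ₁ : ℂ) (K : ℕ)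
    (s : Fin (n + 2) → ℂ) (p : (Fin (n + 1) → ℕ+) × ℝ) : ℂ :=
  zetaTerm d γ (Fin.init s) p.1 * ((p.2 : ℂ) ^ (s (Fin.last (n + 1)) - 1) *
    Complex.exp (-(partSum d γ p.1 (Fin.last n) * p.2)) * thetaRem γ₁ d₁ K p.2)

lemma ae_remMeasure : ∀ᵐ p ∂(remMeasure n), 0 < p.2 :=
  Measure.quasiMeasurePreserving_snd.ae (ae_restrict_mem measurableSet_Ioi)

lemma aestronglyMeasurable_thetaRem_snd (hd₁ : 0 < d₁) (hγ₁ : 0 < γ₁.re) :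
    AEStronglyMeasurable (fun p : (Fin n → ℕ+) × ℝ => thetaRem γ₁ d₁ K p.2) (remMeasure n) :=
  (aestronglyMeasurable_thetaRem hd₁ hγ₁ K).comp_snd

lemma aestronglyMeasurable_remIntegrand (hd₁ : 0 < d₁) (hγ₁ : 0 < γ₁.re)
    (s : Fin (n + 2) → ℂ) :
    AEStronglyMeasurable (remIntegrand d γ d₁ γ₁ K s) (remMeasure (n + 1)) := by
  have h1 : Measurable fun p : (Fin (n + 1) → ℕ+) × ℝ => zetaTerm d γ (Fin.init s) p.1 :=
    measurable_from_prod_countable_right fun m =>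
      (measurable_const : Measurable fun _ : ℝ => zetaTerm d γ (Fin.init s) m)
  have h2 : Measurable fun p : (Fin (n + 1) → ℕ+) × ℝ =>
      (p.2 : ℂ) ^ (s (Fin.last (n + 1)) - 1) *
        Complex.exp (-(partSum d γ p.1 (Fin.last n) * p.2)) :=
    measurable_from_prod_countable_right fun m => by fun_prop
  exact h1.aestronglyMeasurable.mul
    (h2.aestronglyMeasurable.mul (aestronglyMeasurable_thetaRem_snd hd₁ hγ₁))

lemma exists_norm_remIntegrand_le (hγ : ∀ j, 0 < (γ j).re) (hd₁ : 0 < d₁) (hγ₁ : 0 < γ₁.re)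
    (K : ℕ) (s : Fin (n + 2) → ℂ) :
    ∃ B : ℝ, 0 ≤ B ∧ ∀ m : Fin (n + 1) → ℕ+, ∀ t : ℝ, 0 < t →
      ‖remIntegrand d γ d₁ γ₁ K s (m, t)‖ ≤
        B * (realTerm d (fun k => (γ k).re) (Fin.init fun k => (s k).re) m *
          (t ^ ((s (Fin.last (n + 1))).re + K - 1) *
            Real.exp (-(partSum d (fun k => (γ k).re) m (Fin.last n) * t)))) := by
  obtain ⟨B, hB0, hB⟩ := exists_norm_zetaTerm_le d hγ (Fin.init s)
  obtain ⟨C, hC0, hC⟩ := exists_norm_thetaRem_le hd₁ hγ₁ K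
  refine ⟨B * C, by positivity, fun m t ht => ?_⟩
  have h1 := norm_mellinRem_integrand_le hC (s (Fin.last (n + 1))) (partSum d γ m (Fin.last n)) ht
  rw [partSum_re] at h1
  rw [remIntegrand, norm_mul]
  refine (mul_le_mul (hB m) h1 (norm_nonneg _)
    (mul_nonneg hB0 (realTerm_pos d hγ _ m).le)).trans (le_of_eq ?_)
  rw [show (fun k => (Fin.init s k : ℂ).re) = Fin.init fun k => (s k).re from rfl]
  ring

lemma integrable_remIntegrand (hd : ∀ j, 0 < d j) (hγ : ∀ j, 0 < (γ j).re) (hd₁ : 0 < d₁)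
    (hγ₁ : 0 < γ₁.re) {s : Fin (n + 2) → ℂ} (hs : s ∈ remDomain d K) :
    Integrable (remIntegrand d γ d₁ γ₁ K s) (remMeasure (n + 1)) := by
  obtain ⟨B, -, hB⟩ := exists_norm_remIntegrand_le (d := d) hγ hd₁ hγ₁ K s
  refine ((integrable_remMeasure (τ := fun k => (s k).re) hd hγ hs).const_mul B).mono'
    (aestronglyMeasurable_remIntegrand hd₁ hγ₁ s) ?_
  filter_upwards [ae_remMeasure] with p hp
  exact hB p.1 p.2 hp

lemma summable_remTerm (hd : ∀ j, 0 < d j) (hγ : ∀ j, 0 < (γ j).re) (hd₁ : 0 < d₁)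
    (hγ₁ : 0 < γ₁.re) {s : Fin (n + 2) → ℂ} (hs : s ∈ remDomain d K) :
    Summable fun m : Fin (n + 1) → ℕ+ => zetaTerm d γ (Fin.init s) m *
      mellinRem γ₁ d₁ K (s (Fin.last (n + 1))) (partSum d γ m (Fin.last n)) := by
  have h := (integrable_remIntegrand hd hγ hd₁ hγ₁ hs).integral_prod_left
  rw [integrable_count_iff] at h
  refine h.of_norm.congr fun m => ?_
  simp only [remIntegrand]
  rw [integral_const_mul]
  rfl

lemma remSum_eq_integral (hd : ∀ j, 0 < d j) (hγ : ∀ j, 0 < (γ j).re) (hd₁ : 0 < d₁)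
    (hγ₁ : 0 < γ₁.re) {s : Fin (n + 2) → ℂ} (hs : s ∈ remDomain d K) :
    remSum d γ d₁ γ₁ K s = ∫ p, remIntegrand d γ d₁ γ₁ K s p ∂(remMeasure (n + 1)) := by
  have h := integrable_remIntegrand hd hγ hd₁ hγ₁ hs
  rw [remMeasure] at h ⊢
  rw [integral_prod _ h, integral_countable h.integral_prod_left, remSum]
  refine tsum_congr fun m => ?_
  simp only [remIntegrand, Measure.real, Measure.count_singleton, ENNReal.toReal_one, one_smul]
  rw [integral_const_mul]
  rfl

/-- The linear form in `s` whose exponential is `∏ⱼ Xⱼ^(-sⱼ) · t^{s_n}`, with `Xⱼ` the partial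
sums of `m`. -/
def remForm (d : Fin (n + 1) → ℕ) (γ : Fin (n + 1) → ℂ) (p : (Fin (n + 1) → ℕ+) × ℝ) :
    (Fin (n + 2) → ℂ) →L[ℂ] ℂ :=
  ∑ j : Fin (n + 1), (-Complex.log (partSum d γ p.1 j)) •
      (ContinuousLinearMap.proj j.castSucc : (Fin (n + 2) → ℂ) →L[ℂ] ℂ) +
    (Real.log p.2 : ℂ) •
      (ContinuousLinearMap.proj (Fin.last (n + 1)) : (Fin (n + 2) → ℂ) →L[ℂ] ℂ)

lemma norm_remForm_le (p : (Fin (n + 1) → ℕ+) × ℝ) :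
    ‖remForm d γ p‖ ≤ ∑ j, ‖Complex.log (partSum d γ p.1 j)‖ + |Real.log p.2| := by
  have hp : ∀ i : Fin (n + 2),
      ‖(ContinuousLinearMap.proj i : (Fin (n + 2) → ℂ) →L[ℂ] ℂ)‖ ≤ 1 := fun i =>
    ContinuousLinearMap.opNorm_le_bound _ zero_le_one fun s => by
      simpa using norm_le_pi_norm s i
  refine (norm_add_le _ _).trans (add_le_add ((norm_sum_le _ _).trans
    (Finset.sum_le_sum fun j _ => ?_)) ?_)
  · rw [norm_smul, norm_neg]
    exact mul_le_of_le_one_right (norm_nonneg _) (hp _)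
  · rw [norm_smul, Complex.norm_real, Real.norm_eq_abs]
    exact mul_le_of_le_one_right (abs_nonneg _) (hp _)

lemma aestronglyMeasurable_remForm :
    AEStronglyMeasurable (remForm d γ) (remMeasure (n + 1)) := by
  have h1 : ∀ j : Fin (n + 1), Measurable fun p : (Fin (n + 1) → ℕ+) × ℝ =>
      -Complex.log (partSum d γ p.1 j) := fun j =>
    measurable_from_prod_countable_right fun m =>
      (measurable_const : Measurable fun _ : ℝ => -Complex.log (partSum d γ m j))
  have h2 : Measurable fun p : (Fin (n + 1) → ℕ+) × ℝ => (Real.log p.2 : ℂ) := by fun_prop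
  have h3 : StronglyMeasurable (remForm d γ) := by
    refine StronglyMeasurable.add ?_ (h2.stronglyMeasurable.smul_const _)
    exact Finset.stronglyMeasurable_fun_sum _ fun j _ => (h1 j).stronglyMeasurable.smul_const _
  exact h3.aestronglyMeasurable

lemma exp_remForm (hγ : ∀ j, 0 < (γ j).re) (s : Fin (n + 2) → ℂ) (m : Fin (n + 1) → ℕ+) {t : ℝ}
    (ht : 0 < t) :
    Complex.exp (remForm d γ (m, t) s) =
      zetaTerm d γ (Fin.init s) m * (t : ℂ) ^ (s (Fin.last (n + 1))) := by
  have ht' : (t : ℂ) ≠ 0 := by exact_mod_cast ht.ne'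
  have hX : ∀ j, partSum d γ m j ≠ 0 := by
    intro j h
    have := partSum_re_pos d hγ m j
    rw [h] at this
    exact lt_irrefl _ this
  simp only [remForm, add_apply, sum_apply, smul_apply, ContinuousLinearMap.proj_apply,
    smul_eq_mul]
  rw [Complex.exp_add, Complex.exp_sum, zetaTerm_eq_prod, Complex.cpow_def_of_ne_zero ht',
    Complex.ofReal_log ht.le]
  congr 1
  refine Finset.prod_congr rfl fun j _ => ?_
  rw [Complex.cpow_def_of_ne_zero (hX j)]
  congr 1
  simp [Fin.init]

/-- The remainder series is holomorphic: it is an integral of exponentials of linear forms in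
`s`. -/
theorem analyticAt_remSum (hd : ∀ j, 0 < d j) (hγ : ∀ j, 0 < (γ j).re) (hd₁ : 0 < d₁)
    (hγ₁ : 0 < γ₁.re) {s₀ : Fin (n + 2) → ℂ} (hs₀ : s₀ ∈ remDomain d K) :
    AnalyticAt ℂ (remSum d γ d₁ γ₁ K) s₀ := by
  set w : (Fin (n + 1) → ℕ+) × ℝ → ℂ := fun p =>
    (p.2 : ℂ)⁻¹ * Complex.exp (-(partSum d γ p.1 (Fin.last n) * p.2)) * thetaRem γ₁ d₁ K p.2
    with hw
  have hwℓ : ∀ (s : Fin (n + 2) → ℂ) (p : (Fin (n + 1) → ℕ+) × ℝ), 0 < p.2 →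
      w p * Complex.exp (remForm d γ p s) = remIntegrand d γ d₁ γ₁ K s p := by
    intro s p hp
    have hp' : (p.2 : ℂ) ≠ 0 := by exact_mod_cast hp.ne'
    rw [show p = (p.1, p.2) from rfl, exp_remForm hγ s p.1 hp, hw, remIntegrand,
      Complex.cpow_sub _ _ hp', Complex.cpow_one]
    ring
  have hwm : AEStronglyMeasurable w (remMeasure (n + 1)) := by
    have h2 : Measurable fun p : (Fin (n + 1) → ℕ+) × ℝ => (p.2 : ℂ)⁻¹ *
        Complex.exp (-(partSum d γ p.1 (Fin.last n) * p.2)) :=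
      measurable_from_prod_countable_right fun m => by fun_prop
    exact h2.aestronglyMeasurable.mul (aestronglyMeasurable_thetaRem_snd hd₁ hγ₁)
  -- replacing `ℓ` by `r ‖ℓ‖` costs a shift of the real parts by `± r`
  let τ : ℝ → ℝ → Fin (n + 2) → ℝ := fun e r =>
    Fin.snoc (fun j : Fin (n + 1) => (s₀ j.castSucc).re - r)
      ((s₀ (Fin.last (n + 1))).re + e * r)
  have hτ : ∀ e, ∀ᶠ r in 𝓝[>] (0 : ℝ), τ e r ∈ remDomainReal d K := by
    intro e
    have hc : Continuous (τ e) := by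
      refine continuous_pi fun i => ?_
      refine Fin.lastCases ?_ (fun j => ?_) i
      · simp only [τ, Fin.snoc_last]; fun_prop
      · simp only [τ, Fin.snoc_castSucc]; fun_prop
    have h0 : τ e 0 = fun k => (s₀ k).re := by
      funext i
      refine Fin.lastCases ?_ (fun j => ?_) i
      · simp [τ]
      · simp [τ]
    have := (hc.tendsto 0).eventually
      ((isOpen_remDomainReal d K).mem_nhds (by rw [h0]; exact hs₀))
    exact this.filter_mono nhdsWithin_le_nhds
  obtain ⟨r, ⟨h1, h2⟩, hr⟩ :=
    (((hτ 1).and (hτ (-1))).and self_mem_nhdsWithin).exists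
  have hr' : (0 : ℝ) < r := hr
  have hmain : AnalyticAt ℂ
      (fun s => ∫ p, w p * Complex.exp (remForm d γ p s) ∂(remMeasure (n + 1))) s₀ := by
    refine analyticAt_integral_exp hr' aestronglyMeasurable_remForm hwm ?_
    obtain ⟨B, hB0, hB⟩ := exists_norm_remIntegrand_le (d := d) hγ hd₁ hγ₁ K s₀
    obtain ⟨C, hC1, hC⟩ := exists_norm_partSum_le d hγ
    set D : ℝ := ∏ _j : Fin (n + 1),
      Real.exp (r * (Real.log C + 2 * |Real.log (γ 0).re| + Real.pi)) with hD
    have hi := ((integrable_remMeasure hd hγ h1).add (integrable_remMeasure hd hγ h2)).const_mul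
      (B * D)
    have hm1 : AEStronglyMeasurable (fun p => ‖w p * Complex.exp (remForm d γ p s₀)‖ *
        Real.exp (r * ‖remForm d γ p‖)) (remMeasure (n + 1)) := by
      have hℓ := aestronglyMeasurable_remForm (d := d) (γ := γ)
      refine AEStronglyMeasurable.mul (hwm.mul (Complex.continuous_exp.comp_aestronglyMeasurable
        ((ContinuousLinearMap.apply ℂ ℂ s₀).continuous.comp_aestronglyMeasurable hℓ))).norm ?_
      exact (Real.continuous_exp.comp (continuous_const_mul r)).comp_aestronglyMeasurable hℓ.norm
    refine hi.mono' hm1 ?_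
    filter_upwards [ae_remMeasure] with p hp
    obtain ⟨m, t⟩ := p
    have ht : (0 : ℝ) < t := hp
    rw [hwℓ s₀ (m, t) ht, Real.norm_of_nonneg (by positivity)]
    have hY := fun j => partSum_pos d hγ m j
    have e1 : Real.exp (r * ‖remForm d γ (m, t)‖) ≤
        D * (∏ j, partSum d (fun k => (γ k).re) m j ^ r) * (t ^ r + t ^ (-r)) := by
      calc Real.exp (r * ‖remForm d γ (m, t)‖)
          ≤ Real.exp (r * (∑ j, ‖Complex.log (partSum d γ m j)‖ + |Real.log t|)) := by
            gcongr
            exact norm_remForm_le (m, t)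
        _ = (∏ j, Real.exp (r * ‖Complex.log (partSum d γ m j)‖)) *
              Real.exp (r * |Real.log t|) := by
            rw [mul_add, Real.exp_add, Finset.mul_sum, Real.exp_sum]
        _ ≤ _ := by
            rw [hD, ← Finset.prod_mul_distrib]
            refine mul_le_mul (Finset.prod_le_prod (fun j _ => (Real.exp_pos _).le) fun j _ => ?_)
              (exp_mul_abs_log_le ht) (Real.exp_pos _).le (Finset.prod_nonneg fun j _ => ?_)
            · rw [← partSum_re]
              refine exp_mul_norm_log_le hC1 (hγ 0) ?_ (hC m j) hr'.le
              rw [partSum_re]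
              exact le_partSum d hγ m j
            · exact mul_nonneg (Real.exp_pos _).le (Real.rpow_nonneg (hY j).le _)
    have e2 : ∀ e, realTerm d (fun k => (γ k).re) (Fin.init (τ e r)) m =
        realTerm d (fun k => (γ k).re) (Fin.init fun k => (s₀ k).re) m *
          ∏ j, partSum d (fun k => (γ k).re) m j ^ r := by
      intro e
      rw [realTerm, realTerm, ← Finset.prod_mul_distrib]
      refine Finset.prod_congr rfl fun j _ => ?_
      rw [← Real.rpow_add (hY j)]
      congr 1
      simp only [τ, Fin.init, Fin.snoc_castSucc]
      ring
    have e3 : ∀ e, t ^ (τ e r (Fin.last (n + 1)) + K - 1) =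
        t ^ ((s₀ (Fin.last (n + 1))).re + K - 1) * t ^ (e * r) := by
      intro e
      rw [← Real.rpow_add ht]
      congr 1
      simp only [τ, Fin.snoc_last]
      ring
    refine (mul_le_mul (hB m t ht) e1 (Real.exp_pos _).le
      (mul_nonneg hB0 ?_)).trans (le_of_eq ?_)
    · have := (realTerm_pos d hγ (Fin.init fun k => (s₀ k).re) m).le
      positivity
    · simp only [Pi.add_apply]
      rw [e2, e2, e3, e3, one_mul, neg_one_mul]
      ring
  refine hmain.congr ?_
  filter_upwards [(isOpen_remDomain d K).mem_nhds hs₀] with s hs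
  rw [remSum_eq_integral hd hγ hd₁ hγ₁ hs]
  refine integral_congr_ae ?_
  filter_upwards [ae_remMeasure] with p hp
  exact hwℓ s p hp

end Remainder

/-! ### Local quotients of holomorphic functions -/

/-- `F` is near `z` a quotient of holomorphic functions whose denominator does not vanish
identically; `IsMeromorphicSV` says this at every point. -/
def IsQuotientAt {E : Type*} [NormedAddCommGroup E] [NormedSpace ℂ E] (F : E → ℂ) (z : E) :
    Prop :=
  ∃ g h : E → ℂ, AnalyticAt ℂ g z ∧ AnalyticAt ℂ h z ∧
    (∃ᶠ w in 𝓝 z, h w ≠ 0) ∧ ∀ᶠ w in 𝓝 z, h w ≠ 0 → F w = g w / h w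

section Quotient

variable {E : Type*} [NormedAddCommGroup E] [NormedSpace ℂ E]

/-- Germs of holomorphic functions form a domain. -/
lemma frequently_mul_ne_zero {f g : E → ℂ} {z : E} (hf : AnalyticAt ℂ f z)
    (hg : AnalyticAt ℂ g z) (hf0 : ∃ᶠ w in 𝓝 z, f w ≠ 0) (hg0 : ∃ᶠ w in 𝓝 z, g w ≠ 0) :
    ∃ᶠ w in 𝓝 z, f w * g w ≠ 0 := by
  intro hcon
  obtain ⟨r, hr, hball⟩ := Metric.eventually_nhds_iff_ball.1
    (hg.eventually_analyticAt.and hcon)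
  have hmem := Metric.ball_mem_nhds z hr
  obtain ⟨w, ⟨hw0, hwr⟩, hwa⟩ := ((hf0.and_eventually hmem).and_eventually
    hf.eventually_analyticAt).exists
  have hgz : g =ᶠ[𝓝 w] 0 := by
    filter_upwards [hwa.continuousAt.eventually_ne hw0, Metric.isOpen_ball.mem_nhds hwr]
      with u hu hub
    have := (hball u hub).2
    simp only [ne_eq, not_not, mul_eq_zero] at this
    exact this.resolve_left hu
  have hE := AnalyticOnNhd.eqOn_zero_of_preconnected_of_eventuallyEq_zero
    (fun u hu => (hball u hu).1) (convex_ball z r).isPreconnected hwr hgz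
  apply hg0
  filter_upwards [hmem] with u hu
  simpa using hE hu

lemma AnalyticAt.isQuotientAt {F : E → ℂ} {z : E} (h : AnalyticAt ℂ F z) : IsQuotientAt F z :=
  ⟨F, fun _ => 1, h, analyticAt_const, Frequently.of_forall fun _ => one_ne_zero,
    Eventually.of_forall fun _ _ => (div_one _).symm⟩

lemma IsQuotientAt.congr {F G : E → ℂ} {z : E} (hF : IsQuotientAt F z) (h : F =ᶠ[𝓝 z] G) :
    IsQuotientAt G z := by
  obtain ⟨g, k, hg, hk, hk0, he⟩ := hF
  refine ⟨g, k, hg, hk, hk0, ?_⟩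
  filter_upwards [he, h] with w h1 h2 h3
  rw [← h2, h1 h3]

lemma IsQuotientAt.add {F G : E → ℂ} {z : E} (hF : IsQuotientAt F z) (hG : IsQuotientAt G z) :
    IsQuotientAt (fun w => F w + G w) z := by
  obtain ⟨g₁, h₁, ag₁, ah₁, f₁, e₁⟩ := hF
  obtain ⟨g₂, h₂, ag₂, ah₂, f₂, e₂⟩ := hG
  refine ⟨fun w => g₁ w * h₂ w + g₂ w * h₁ w, fun w => h₁ w * h₂ w,
    (ag₁.mul ah₂).add (ag₂.mul ah₁), ah₁.mul ah₂, frequently_mul_ne_zero ah₁ ah₂ f₁ f₂, ?_⟩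
  filter_upwards [e₁, e₂] with w h1 h2 h
  have c₁ := left_ne_zero_of_mul h
  have c₂ := right_ne_zero_of_mul h
  rw [h1 c₁, h2 c₂]
  field_simp

lemma IsQuotientAt.mul {F G : E → ℂ} {z : E} (hF : IsQuotientAt F z) (hG : IsQuotientAt G z) :
    IsQuotientAt (fun w => F w * G w) z := by
  obtain ⟨g₁, h₁, ag₁, ah₁, f₁, e₁⟩ := hF
  obtain ⟨g₂, h₂, ag₂, ah₂, f₂, e₂⟩ := hG
  refine ⟨fun w => g₁ w * g₂ w, fun w => h₁ w * h₂ w, ag₁.mul ag₂, ah₁.mul ah₂,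
    frequently_mul_ne_zero ah₁ ah₂ f₁ f₂, ?_⟩
  filter_upwards [e₁, e₂] with w h1 h2 h
  rw [h1 (left_ne_zero_of_mul h), h2 (right_ne_zero_of_mul h), div_mul_div_comm]

lemma IsQuotientAt.sum {ι : Type*} (S : Finset ι) {F : ι → E → ℂ} {z : E}
    (hF : ∀ i ∈ S, IsQuotientAt (F i) z) : IsQuotientAt (fun w => ∑ i ∈ S, F i w) z := by
  classical
  induction S using Finset.induction_on with
  | empty => simpa using (analyticAt_const (v := (0 : ℂ))).isQuotientAt
  | insert i S hi ih =>
    simp_rw [Finset.sum_insert hi]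
    exact (hF i (Finset.mem_insert_self i S)).add
      (ih fun j hj => hF j (Finset.mem_insert_of_mem hj))

/-- Being a local quotient is preserved by composition with a holomorphic map that has a
continuous local section, since the denominator stays nonzero then. -/
lemma IsQuotientAt.comp {E' : Type*} [NormedAddCommGroup E'] [NormedSpace ℂ E'] {F : E → ℂ}
    {A : E' → E} {B : E → E'} {z : E'} (hF : IsQuotientAt F (A z)) (hA : AnalyticAt ℂ A z)
    (hB : ContinuousAt B (A z)) (hBz : B (A z) = z) (hAB : ∀ u, A (B u) = u) :
    IsQuotientAt (fun w => F (A w)) z := by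
  obtain ⟨g, h, ag, ah, f, e⟩ := hF
  refine ⟨fun w => g (A w), fun w => h (A w), ag.comp hA, ah.comp hA, ?_,
    hA.continuousAt.eventually e⟩
  have hB' : Tendsto B (𝓝 (A z)) (𝓝 z) := by
    have := hB.tendsto
    rwa [hBz] at this
  refine hB'.frequently (f.mono fun u hu => ?_)
  simpa only [hAB] using hu

lemma MeromorphicAt.isQuotientAt {f : ℂ → ℂ} {x : ℂ} (h : MeromorphicAt f x) :
    IsQuotientAt f x := by
  obtain ⟨n, hn⟩ := h
  refine ⟨fun z => (z - x) ^ n • f z, fun z => (z - x) ^ n, hn, by fun_prop, ?_,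
    Eventually.of_forall fun w hw => ?_⟩
  · have : ∀ᶠ w in 𝓝[≠] x, (w - x) ^ n ≠ 0 := by
      filter_upwards [self_mem_nhdsWithin] with w hw
      exact pow_ne_zero _ (sub_ne_zero.2 hw)
    exact this.frequently.filter_mono nhdsWithin_le_nhds
  · simp only [smul_eq_mul]
    rw [mul_div_cancel_left₀ _ hw]

lemma analyticAt_apply {n : ℕ} (i : Fin n) (z : Fin n → ℂ) :
    AnalyticAt ℂ (fun w : Fin n → ℂ => w i) z :=
  (ContinuousLinearMap.proj i : (Fin n → ℂ) →L[ℂ] ℂ).analyticAt z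

lemma MeromorphicAt.isQuotientAt_apply {n : ℕ} {f : ℂ → ℂ} {i : Fin n} {z : Fin n → ℂ}
    (h : MeromorphicAt f (z i)) : IsQuotientAt (fun w : Fin n → ℂ => f (w i)) z :=
  IsQuotientAt.comp (A := fun w : Fin n → ℂ => w i) (B := fun u => Function.update z i u)
    h.isQuotientAt (analyticAt_apply i z) (by fun_prop) (by simp) (by simp)

lemma analyticAt_mergeLast {n : ℕ} (c : ℂ) (z : Fin (n + 2) → ℂ) :
    AnalyticAt ℂ (fun s : Fin (n + 2) → ℂ => mergeLast s c) z := by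
  refine AnalyticAt.pi fun i => ?_
  simp only [mergeLast, Fin.init]
  split_ifs
  · exact (analyticAt_apply _ z).add ((analyticAt_apply _ z).add analyticAt_const)
  · exact (analyticAt_apply _ z).add analyticAt_const

lemma IsQuotientAt.comp_mergeLast {n : ℕ} {F : (Fin (n + 1) → ℂ) → ℂ} {c : ℂ}
    {z : Fin (n + 2) → ℂ} (hF : IsQuotientAt F (mergeLast z c)) :
    IsQuotientAt (fun s => F (mergeLast s c)) z := by
  refine IsQuotientAt.comp (A := fun s => mergeLast s c)
    (B := fun u => z + (Fin.snoc (α := fun _ => ℂ) (u - mergeLast z c) 0 : Fin (n + 2) → ℂ))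
    hF (analyticAt_mergeLast c z) ?_ ?_ ?_
  · refine (continuous_pi fun i => ?_).continuousAt
    refine Fin.lastCases ?_ (fun j => ?_) i
    · simp only [Pi.add_apply, Fin.snoc_last]; fun_prop
    · simp only [Pi.add_apply, Fin.snoc_castSucc, Pi.sub_apply]; fun_prop
  · funext i
    refine Fin.lastCases ?_ (fun j => ?_) i <;> simp
  · intro u
    funext i
    simp only [mergeLast, Fin.init, Pi.add_apply, Fin.snoc_castSucc, Pi.sub_apply, Fin.snoc_last]
    split_ifs <;> ring

end Quotient

lemma analyticAt_riemannZeta {s : ℂ} (hs : s ≠ 1) : AnalyticAt ℂ riemannZeta s :=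
  DifferentiableOn.analyticAt (s := {1}ᶜ)
    (fun _ hw => (differentiableAt_riemannZeta hw).differentiableWithinAt)
    (isOpen_compl_singleton.mem_nhds hs)

lemma meromorphicAt_riemannZeta (z : ℂ) : MeromorphicAt riemannZeta z := by
  rcases eq_or_ne z 1 with rfl | hz
  · set g : ℂ → ℂ := Function.update (fun s => (s - 1) * riemannZeta s) 1 1 with hg
    have hge : ∀ s : ℂ, s ≠ 1 → g s = (s - 1) * riemannZeta s := fun s hs =>
      Function.update_of_ne hs _ _
    have hga : AnalyticAt ℂ g 1 := by
      refine Complex.analyticAt_of_differentiable_on_punctured_nhds_of_continuousAt ?_ ?_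
      · filter_upwards [self_mem_nhdsWithin] with s hs
        have h1 : DifferentiableAt ℂ (fun s => (s - 1) * riemannZeta s) s :=
          (by fun_prop : DifferentiableAt ℂ (fun s : ℂ => s - 1) s).mul
            (differentiableAt_riemannZeta hs)
        refine h1.congr_of_eventuallyEq ?_
        filter_upwards [isOpen_compl_singleton.mem_nhds hs] with w hw
        exact hge w hw
      · rw [hg, continuousAt_update_same]
        exact riemannZeta_residue_one
    have h1 : MeromorphicAt (fun s : ℂ => g s / (s - 1)) 1 :=
      hga.meromorphicAt.div (by fun_prop : AnalyticAt ℂ (fun s : ℂ => s - 1) 1).meromorphicAt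
    refine h1.congr ?_
    filter_upwards [self_mem_nhdsWithin] with s hs
    rw [hge s hs, mul_div_cancel_left₀ _ (sub_ne_zero.2 hs)]
  · exact (analyticAt_riemannZeta hz).meromorphicAt

lemma analyticAt_inv_Gamma (z : ℂ) : AnalyticAt ℂ (fun s => (Complex.Gamma s)⁻¹) z :=
  Complex.differentiable_one_div_Gamma.analyticAt z

lemma meromorphicAt_leadFactor (γ : ℂ) (d : ℕ) (z : ℂ) : MeromorphicAt (leadFactor γ d) z := by
  have h1 : MeromorphicAt (fun s : ℂ => Complex.Gamma (s - 1 / d)) z :=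
    (Meromorphic.Gamma (z - 1 / d)).comp_analyticAt (g := fun s : ℂ => s - 1 / d) (by fun_prop)
  exact ((MeromorphicAt.const _ z).mul h1).div (Meromorphic.Gamma z)

lemma analyticAt_Gamma {z : ℂ} (h : ∀ l : ℕ, z ≠ -l) : AnalyticAt ℂ Complex.Gamma z := by
  have h1 := (analyticAt_inv_Gamma z).inv (inv_ne_zero (Complex.Gamma_ne_zero h))
  refine h1.congr (Eventually.of_forall fun s => ?_)
  simp

lemma analyticAt_leadFactor {γ : ℂ} {d : ℕ} {z : ℂ} (h : ∀ l : ℕ, z - 1 / d ≠ -l) :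
    AnalyticAt ℂ (leadFactor γ d) z := by
  have h1 : AnalyticAt ℂ (fun s : ℂ => Complex.Gamma (s - 1 / d)) z :=
    (analyticAt_Gamma h).comp (f := fun s : ℂ => s - 1 / d) (by fun_prop)
  exact (analyticAt_const.mul h1).mul (analyticAt_inv_Gamma z)

/-! ### The meromorphic continuation -/

/-- Summation of the multiple series over the last index, with the theta function expanded up to
order `K`, but without its leading term; here `F` is the continuation in one variable less. -/
def zetaRest {n : ℕ} (d : Fin (n + 2) → ℕ) (γ : Fin (n + 2) → ℂ) (F : (Fin (n + 1) → ℂ) → ℂ)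
    (K : ℕ) (s : Fin (n + 2) → ℂ) : ℂ :=
  ∑ k ∈ Finset.range K, thetaCoeff (γ (Fin.last (n + 1))) (d (Fin.last (n + 1))) k *
      (ascPochhammer ℂ k).eval (s (Fin.last (n + 1))) * F (mergeLast s (k : ℂ)) +
    remSum (Fin.init d) (Fin.init γ) (d (Fin.last (n + 1))) (γ (Fin.last (n + 1))) K s /
      Complex.Gamma (s (Fin.last (n + 1)))

/-- Summation of the multiple series over the last index, with the theta function expanded up to
order `K`. -/
def zetaStep {n : ℕ} (d : Fin (n + 2) → ℕ) (γ : Fin (n + 2) → ℂ) (F : (Fin (n + 1) → ℂ) → ℂ)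
    (K : ℕ) (s : Fin (n + 2) → ℂ) : ℂ :=
  leadFactor (γ (Fin.last (n + 1))) (d (Fin.last (n + 1))) (s (Fin.last (n + 1))) *
      F (mergeLast s (-(1 / (d (Fin.last (n + 1)) : ℂ)))) +
    zetaRest d γ F K s

/-- The continuation of the multiple series, by recursion on the number of variables. At each
point the least order of expansion for which the remainder series converges is used; by
`zetaFun_eq_zetaStep` any larger order gives the same value. -/
def zetaFun : (n : ℕ) → (Fin (n + 1) → ℕ) → (Fin (n + 1) → ℂ) → (Fin (n + 1) → ℂ) → ℂ
  | 0, d, γ, s => γ 0 ^ (-s 0) * riemannZeta (d 0 * s 0)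
  | n + 1, d, γ, s =>
    zetaStep d γ (zetaFun n (Fin.init d) (Fin.init γ)) (sInf {K | s ∈ remDomain (Fin.init d) K}) s

section Continuation

variable {n : ℕ}

lemma eventually_mem_remDomain (d : Fin (n + 1) → ℕ) (s : Fin (n + 2) → ℂ) :
    ∀ᶠ K : ℕ in atTop, s ∈ remDomain d K := by
  have h1 : ∀ᶠ K : ℕ in atTop, -(s (Fin.last (n + 1))).re < K :=
    tendsto_natCast_atTop_atTop.eventually_gt_atTop _
  have h2 : ∀ᶠ K : ℕ in atTop, ∀ j : Fin (n + 1), ∑ k ∈ Finset.Ici j, (1 / (d k : ℝ)) -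
      ∑ k ∈ Finset.Ici j.castSucc, (s k).re < K :=
    eventually_all.2 fun j => tendsto_natCast_atTop_atTop.eventually_gt_atTop _
  filter_upwards [h1, h2] with K h1 h2
  refine ⟨by linarith, convReal_mergeLast_iff.2 fun j => ?_⟩
  linarith [h2 j]

lemma remDomain_mono (d : Fin (n + 1) → ℕ) : Monotone (remDomain d) := by
  intro K K' hK s hs
  have hK' : (K : ℝ) ≤ K' := by exact_mod_cast hK
  refine ⟨by linarith [hs.1], convReal_mergeLast_iff.2 fun j => ?_⟩
  have := convReal_mergeLast_iff.1 hs.2 j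
  linarith

lemma Gamma_add_nat_div_Gamma {z : ℂ} {K : ℕ} (hz : -(K : ℝ) < z.re) :
    Complex.Gamma (z + K) / Complex.Gamma z = (ascPochhammer ℂ K).eval z := by
  by_cases h : ∀ k : ℕ, z ≠ -k
  · exact Complex.Gamma_add_nat_div_Gamma_eq z h
  · push Not at h
    obtain ⟨k, rfl⟩ := h
    rw [Complex.Gamma_neg_nat_eq_zero, div_zero, ascPochhammer_eval_neg_coe_nat_of_lt]
    simp only [Complex.neg_re, Complex.natCast_re, neg_lt_neg_iff, Nat.cast_lt] at hz
    exact hz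

variable {d : Fin (n + 2) → ℕ} {γ : Fin (n + 2) → ℂ}

lemma zetaStep_succ (hd : ∀ j, 0 < d j) (hγ : ∀ j, 0 < (γ j).re) {F : (Fin (n + 1) → ℂ) → ℂ}
    (hF : ∀ s ∈ convDomain (Fin.init d), HasSum (zetaTerm (Fin.init d) (Fin.init γ) s) (F s))
    {K : ℕ} {s : Fin (n + 2) → ℂ} (hs : s ∈ remDomain (Fin.init d) K) :
    zetaStep d γ F K s = zetaStep d γ F (K + 1) s := by
  have hK := mem_remDomain_iff.1 hs
  have hs' := remDomain_mono (Fin.init d) K.le_succ hs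
  have hγ' : ∀ j, 0 < (Fin.init γ j : ℂ).re := fun j => hγ _
  have hd' : ∀ j, 0 < Fin.init d j := fun j => hd _
  have e : remSum (Fin.init d) (Fin.init γ) (d (Fin.last (n + 1))) (γ (Fin.last (n + 1))) K s =
      thetaCoeff (γ (Fin.last (n + 1))) (d (Fin.last (n + 1))) K *
        Complex.Gamma (s (Fin.last (n + 1)) + K) * F (mergeLast s (K : ℂ)) +
      remSum (Fin.init d) (Fin.init γ) (d (Fin.last (n + 1))) (γ (Fin.last (n + 1))) (K + 1) s := by
    have h1 := ((hF _ hK.2).mul_left (thetaCoeff (γ (Fin.last (n + 1))) (d (Fin.last (n + 1))) K *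
        Complex.Gamma (s (Fin.last (n + 1)) + K))).add
      (summable_remTerm hd' hγ' (hd (Fin.last (n + 1))) (hγ (Fin.last (n + 1))) hs').hasSum
    rw [remSum, remSum, ← h1.tsum_eq]
    refine tsum_congr fun m => ?_
    rw [mellinRem_succ (hd _) (hγ _) hK.1 (partSum_re_pos _ hγ' m _),
      zetaTerm_mergeLast _ hγ']
    ring
  rw [zetaStep, zetaStep, zetaRest, zetaRest, Finset.sum_range_succ,
    ← Gamma_add_nat_div_Gamma hK.1, e]
  ring

lemma zetaFun_eq_zetaStep_of_hasSum (hd : ∀ j, 0 < d j) (hγ : ∀ j, 0 < (γ j).re)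
    (hF : ∀ s ∈ convDomain (Fin.init d), HasSum (zetaTerm (Fin.init d) (Fin.init γ) s)
      (zetaFun n (Fin.init d) (Fin.init γ) s))
    {K : ℕ} {s : Fin (n + 2) → ℂ} (hs : s ∈ remDomain (Fin.init d) K) :
    zetaFun (n + 1) d γ s = zetaStep d γ (zetaFun n (Fin.init d) (Fin.init γ)) K s := by
  have h0 : s ∈ remDomain (Fin.init d) (sInf {K | s ∈ remDomain (Fin.init d) K}) :=
    Nat.sInf_mem (s := {K | s ∈ remDomain (Fin.init d) K}) ⟨K, hs⟩
  have hle : sInf {K | s ∈ remDomain (Fin.init d) K} ≤ K := Nat.sInf_le hs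
  rw [zetaFun]
  induction K, hle using Nat.le_induction with
  | base => rfl
  | succ k hk ih =>
    have hk' := remDomain_mono (Fin.init d) hk h0
    rw [ih hk', zetaStep_succ hd hγ hF hk']

lemma hasSum_zetaFun_zero {d : Fin 1 → ℕ} (hd : ∀ j, 0 < d j) {γ : Fin 1 → ℂ}
    (hγ : ∀ j, 0 < (γ j).re) {s : Fin 1 → ℂ} (hs : s ∈ convDomain d) :
    HasSum (zetaTerm d γ s) (zetaFun 0 d γ s) := by
  have hd' : (0 : ℝ) < d 0 := by exact_mod_cast hd 0
  have h := (mem_convDomain_iff.1 hs).last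
  have h1 : 1 < ((d 0 : ℂ) * s 0).re := by
    have := (div_lt_iff₀ hd').1 h
    simp only [Fin.last_zero, Fin.isValue] at this
    rw [← Complex.ofReal_natCast, Complex.re_ofReal_mul]
    linarith
  have h2 : HasSum (fun a : ℕ+ => 1 / ((a : ℕ) : ℂ) ^ ((d 0 : ℂ) * s 0))
      (riemannZeta (d 0 * s 0)) := by
    rw [← Equiv.pnatEquivNat.symm.hasSum_iff, zeta_eq_tsum_one_div_nat_add_one_cpow h1]
    have := ((summable_nat_add_iff 1).2 (Complex.summable_one_div_nat_cpow.2 h1)).hasSum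
    simpa [Function.comp_def] using this
  rw [← (Equiv.funUnique (Fin 1) ℕ+).symm.hasSum_iff, zetaFun]
  convert! h2.mul_left (γ 0 ^ (-s 0)) using 1
  funext a
  have hγ0 : γ 0 ≠ 0 := by
    intro h0
    have := hγ 0
    rw [h0] at this
    exact lt_irrefl _ this
  have ha : (0 : ℝ) < (a : ℕ) := by exact_mod_cast a.pos
  have ha' : ((a : ℕ) : ℂ) ≠ 0 := by exact_mod_cast a.pos.ne'
  rw [Function.comp, zetaTerm_eq_prod, Fin.prod_univ_succ, Fin.prod_univ_zero, mul_one,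
    partSum_zero]
  simp only [Equiv.funUnique_symm_apply, uniqueElim_const]
  have e : γ 0 * ((a : ℕ) : ℂ) ^ d 0 = ((((a : ℕ) : ℝ) ^ d 0 : ℝ) : ℂ) * γ 0 := by
    push_cast; ring
  rw [e, Complex.cpow_def_of_ne_zero (mul_ne_zero (by exact_mod_cast (pow_pos ha _).ne') hγ0),
    Complex.log_ofReal_mul (pow_pos ha _) hγ0, Complex.cpow_def_of_ne_zero hγ0,
    Complex.cpow_def_of_ne_zero ha', one_div, ← Complex.exp_neg, ← Complex.exp_add,
    Real.log_pow]
  congr 1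
  push_cast
  ring

theorem hasSum_zetaFun : ∀ {n : ℕ} {d : Fin (n + 1) → ℕ} (_ : ∀ j, 0 < d j)
    {γ : Fin (n + 1) → ℂ} (_ : ∀ j, 0 < (γ j).re) {s : Fin (n + 1) → ℂ} (_ : s ∈ convDomain d),
    HasSum (zetaTerm d γ s) (zetaFun n d γ s) := by
  intro n
  induction n with
  | zero => exact fun hd _ hγ _ hs => hasSum_zetaFun_zero hd hγ hs
  | succ n ih =>
    intro d hd γ hγ s hs
    have hγ' : ∀ j, 0 < (Fin.init γ j : ℂ).re := fun j => hγ _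
    have hd' : ∀ j, 0 < Fin.init d j := fun j => hd _
    have hc := mem_convDomain_iff.1 hs
    have hlast : 1 / (d (Fin.last (n + 1)) : ℝ) < (s (Fin.last (n + 1))).re := hc.last
    have hs0 : s ∈ remDomain (Fin.init d) 0 := by
      have h0 : (0 : ℝ) ≤ 1 / (d (Fin.last (n + 1)) : ℝ) := by positivity
      refine ⟨by simpa using h0.trans_lt hlast, ?_⟩
      simpa using hc.mergeLast_zero
    have hs1 : mergeLast s (-(1 / (d (Fin.last (n + 1)) : ℂ))) ∈ convDomain (Fin.init d) := by
      rw [mem_convDomain_iff]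
      have := hc.mergeLast
      convert! this using 1
      funext k
      rw [← re_mergeLast]
      push_cast
      rfl
    rw [zetaFun_eq_zetaStep_of_hasSum hd hγ (fun s hs => ih hd' hγ' hs) hs0, zetaStep,
      zetaRest]
    have hinner : ∀ m : Fin (n + 1) → ℕ+, HasSum
        (fun a : ℕ+ => (zetaTerm d γ s ∘ snocPNat (n + 1)) (m, a))
        (zetaTerm (Fin.init d) (Fin.init γ) (Fin.init s) m *
          (leadFactor (γ (Fin.last (n + 1))) (d (Fin.last (n + 1))) (s (Fin.last (n + 1))) *
            partSum (Fin.init d) (Fin.init γ) m (Fin.last n) ^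
              (-(s (Fin.last (n + 1)) + -(1 / (d (Fin.last (n + 1)) : ℂ)))) +
          mellinRem (γ (Fin.last (n + 1))) (d (Fin.last (n + 1))) 0 (s (Fin.last (n + 1)))
            (partSum (Fin.init d) (Fin.init γ) m (Fin.last n)) /
              Complex.Gamma (s (Fin.last (n + 1))))) := by
      intro m
      simp only [Function.comp, snocPNat_apply, zetaTerm_snoc]
      exact (hasSum_add_mul_pow_cpow_neg (hd _) (hγ _) hlast
        (partSum_re_pos _ hγ' m _)).mul_left _
    rw [← (snocPNat (n + 1)).hasSum_iff]
    have hsum := ((snocPNat (n + 1)).summable_iff (f := zetaTerm d γ s)).2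
      (summable_zetaTerm hd hγ hs)
    have h1 := hsum.hasSum.prod_fiberwise hinner
    have h2 := ((ih hd' hγ' hs1).mul_left (leadFactor (γ (Fin.last (n + 1)))
      (d (Fin.last (n + 1))) (s (Fin.last (n + 1))))).add
      ((summable_remTerm hd' hγ' (hd (Fin.last (n + 1))) (hγ (Fin.last (n + 1)))
        hs0).hasSum.div_const (Complex.Gamma (s (Fin.last (n + 1)))))
    have h3 := h1.unique (h2.congr_fun fun m => by
      rw [zetaTerm_mergeLast _ hγ']
      ring)
    have h4 := hsum.hasSum
    rw [h3] at h4
    simpa [remSum] using h4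

lemma zetaFun_eq_zetaStep (hd : ∀ j, 0 < d j) (hγ : ∀ j, 0 < (γ j).re)
    {K : ℕ} {s : Fin (n + 2) → ℂ} (hs : s ∈ remDomain (Fin.init d) K) :
    zetaFun (n + 1) d γ s = zetaStep d γ (zetaFun n (Fin.init d) (Fin.init γ)) K s :=
  zetaFun_eq_zetaStep_of_hasSum hd hγ
    (fun _ hs => hasSum_zetaFun (fun _ => hd _) (fun _ => hγ _) hs) hs

lemma eventuallyEq_zetaStep (hd : ∀ j, 0 < d j) (hγ : ∀ j, 0 < (γ j).re)
    {K : ℕ} {s : Fin (n + 2) → ℂ} (hs : s ∈ remDomain (Fin.init d) K) :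
    zetaStep d γ (zetaFun n (Fin.init d) (Fin.init γ)) K =ᶠ[𝓝 s] zetaFun (n + 1) d γ := by
  filter_upwards [(isOpen_remDomain _ K).mem_nhds hs] with w hw
  exact (zetaFun_eq_zetaStep hd hγ hw).symm

lemma analyticAt_ascPochhammer_apply (k : ℕ) (i : Fin n) (z : Fin n → ℂ) :
    AnalyticAt ℂ (fun w : Fin n → ℂ => (ascPochhammer ℂ k).eval (w i)) z :=
  ((ascPochhammer ℂ k).differentiable.analyticAt (z i)).comp
    (f := fun w : Fin n → ℂ => w i) (analyticAt_apply i z)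

lemma analyticAt_remSum_div_Gamma (hd : ∀ j, 0 < d j) (hγ : ∀ j, 0 < (γ j).re)
    {K : ℕ} {s : Fin (n + 2) → ℂ} (hs : s ∈ remDomain (Fin.init d) K) :
    AnalyticAt ℂ (fun s => remSum (Fin.init d) (Fin.init γ) (d (Fin.last (n + 1)))
      (γ (Fin.last (n + 1))) K s / Complex.Gamma (s (Fin.last (n + 1)))) s := by
  have h1 := analyticAt_remSum (d := Fin.init d) (γ := Fin.init γ) (fun _ => hd _) (fun _ => hγ _)
    (hd (Fin.last (n + 1))) (hγ (Fin.last (n + 1))) hs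
  have h2 : AnalyticAt ℂ (fun s : Fin (n + 2) → ℂ => (Complex.Gamma (s (Fin.last (n + 1))))⁻¹) s :=
    (analyticAt_inv_Gamma (s (Fin.last (n + 1)))).comp
      (f := fun s : Fin (n + 2) → ℂ => s (Fin.last (n + 1))) (analyticAt_apply _ s)
  exact h1.mul h2

lemma isQuotientAt_zetaFun : ∀ {n : ℕ} {d : Fin (n + 1) → ℕ} (_ : ∀ j, 0 < d j)
    {γ : Fin (n + 1) → ℂ} (_ : ∀ j, 0 < (γ j).re) (s : Fin (n + 1) → ℂ),
    IsQuotientAt (zetaFun n d γ) s := by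
  intro n
  induction n with
  | zero =>
    intro d hd γ hγ s
    have h1 : AnalyticAt ℂ (fun s : Fin 1 → ℂ => γ 0 ^ (-s 0)) s :=
      analyticAt_const.cpow (analyticAt_apply 0 s).neg (Or.inl (hγ 0))
    have h2 : MeromorphicAt (fun z : ℂ => riemannZeta (d 0 * z)) (s 0) :=
      (meromorphicAt_riemannZeta (d 0 * s 0)).comp_analyticAt (g := fun z : ℂ => d 0 * z)
        (by fun_prop)
    exact h1.isQuotientAt.mul h2.isQuotientAt_apply
  | succ n ih =>
    intro d hd γ hγ s
    have ih' := ih (d := Fin.init d) (fun _ => hd _) (γ := Fin.init γ) (fun _ => hγ _)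
    obtain ⟨K, hK⟩ := (eventually_mem_remDomain (Fin.init d) s).exists
    refine IsQuotientAt.congr ?_ (eventuallyEq_zetaStep hd hγ hK)
    refine (((meromorphicAt_leadFactor _ _ _).isQuotientAt_apply).mul
      (ih' _).comp_mergeLast).add ((IsQuotientAt.sum _ fun k _ => ?_).add
      (analyticAt_remSum_div_Gamma hd hγ hK).isQuotientAt)
    exact ((analyticAt_const.mul
      (analyticAt_ascPochhammer_apply k (Fin.last (n + 1)) s)).isQuotientAt).mul
        (ih' _).comp_mergeLast

theorem isZetaContinuation_zetaFun {n : ℕ} {d : Fin (n + 1) → ℕ} (hd : ∀ j, 0 < d j)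
    {γ : Fin (n + 1) → ℂ} (hγ : ∀ j, 0 < (γ j).re) : IsZetaContinuation d γ (zetaFun n d γ) :=
  ⟨isQuotientAt_zetaFun hd hγ, fun _ hs => hasSum_zetaFun hd hγ hs⟩

/-- The points off the hyperplanes `sⱼ + ⋯ + sₙ = 1/dⱼ + ∑_{k ∈ E} 1/dₖ - l` with
`E ⊆ {j + 1, …, n}` and `l ≥ 0`, which carry all the singularities of the continuation. -/
def OffPoles {n : ℕ} (d : Fin n → ℕ) (s : Fin n → ℂ) : Prop :=
  ∀ j : Fin n, ∀ E ⊆ Finset.Ioi j, ∀ l : ℕ,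
    ∑ k ∈ Finset.Ici j, s k ≠ 1 / (d j : ℂ) + ∑ k ∈ E, 1 / (d k : ℂ) - l

lemma map_castSucc_subset_Ioi {j : Fin (n + 1)} {E : Finset (Fin (n + 1))}
    (hE : E ⊆ Finset.Ioi j) : E.map Fin.castSuccEmb ⊆ Finset.Ioi j.castSucc := by
  intro k hk
  obtain ⟨i, hi, rfl⟩ := Finset.mem_map.1 hk
  simpa using hE hi

lemma OffPoles.mergeLast_neg {s : Fin (n + 2) → ℂ} (h : OffPoles d s) :
    OffPoles (Fin.init d) (mergeLast s (-(1 / (d (Fin.last (n + 1)) : ℂ)))) := by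
  intro j E hE l hcon
  rw [sum_Ici_mergeLast] at hcon
  have hlast : Fin.last (n + 1) ∉ E.map Fin.castSuccEmb := by
    simp [Fin.castSucc_ne_last]
  refine h j.castSucc (insert (Fin.last (n + 1)) (E.map Fin.castSuccEmb)) ?_ l ?_
  · intro k hk
    rcases Finset.mem_insert.1 hk with rfl | hk
    · simp [Fin.castSucc_lt_last]
    · exact map_castSucc_subset_Ioi hE hk
  · rw [Finset.sum_insert hlast, Finset.sum_map]
    simp only [Fin.coe_castSuccEmb]
    simp only [Fin.init] at hcon
    linear_combination hcon

lemma OffPoles.mergeLast_nat {s : Fin (n + 2) → ℂ} (h : OffPoles d s) (k : ℕ) :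
    OffPoles (Fin.init d) (mergeLast s (k : ℂ)) := by
  intro j E hE l hcon
  rw [sum_Ici_mergeLast] at hcon
  refine h j.castSucc (E.map Fin.castSuccEmb) (map_castSucc_subset_Ioi hE) (l + k) ?_
  rw [Finset.sum_map]
  simp only [Fin.coe_castSuccEmb]
  simp only [Fin.init] at hcon
  push_cast
  linear_combination hcon

lemma OffPoles.last {n : ℕ} {d : Fin (n + 1) → ℕ} {s : Fin (n + 1) → ℂ} (h : OffPoles d s)
    (l : ℕ) : s (Fin.last n) - 1 / (d (Fin.last n) : ℂ) ≠ -l := by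
  intro hcon
  refine h (Fin.last n) ∅ (by simp) l ?_
  rw [sum_Ici_last, Finset.sum_empty]
  linear_combination hcon

lemma analyticAt_zetaFun_zero {d : Fin 1 → ℕ} {γ : Fin 1 → ℂ}
    (hγ : ∀ j, 0 < (γ j).re) {s : Fin 1 → ℂ} (hs : (d 0 : ℂ) * s 0 ≠ 1) :
    AnalyticAt ℂ (zetaFun 0 d γ) s := by
  have h1 : AnalyticAt ℂ (fun s : Fin 1 → ℂ => γ 0 ^ (-s 0)) s :=
    analyticAt_const.cpow (analyticAt_apply 0 s).neg (Or.inl (hγ 0))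
  exact h1.mul ((analyticAt_riemannZeta hs).comp (f := fun s : Fin 1 → ℂ => (d 0 : ℂ) * s 0)
    (analyticAt_const.mul (analyticAt_apply 0 s)))

lemma OffPoles.mul_ne_one {d : Fin 1 → ℕ} (hd : ∀ j, 0 < d j) {s : Fin 1 → ℂ}
    (h : OffPoles d s) : (d 0 : ℂ) * s 0 ≠ 1 := by
  have hd' : (d 0 : ℂ) ≠ 0 := by exact_mod_cast (hd 0).ne'
  intro hcon
  apply h.last 0
  simp only [Fin.last_zero]
  field_simp
  linear_combination hcon

lemma analyticAt_zetaRest (hd : ∀ j, 0 < d j) (hγ : ∀ j, 0 < (γ j).re)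
    {F : (Fin (n + 1) → ℂ) → ℂ} {K : ℕ} {s : Fin (n + 2) → ℂ}
    (hF : ∀ k : ℕ, AnalyticAt ℂ F (mergeLast s (k : ℂ)))
    (hs : s ∈ remDomain (Fin.init d) K) : AnalyticAt ℂ (zetaRest d γ F K) s := by
  refine AnalyticAt.add (Finset.analyticAt_fun_sum _ fun k _ => ?_)
    (analyticAt_remSum_div_Gamma hd hγ hs)
  exact (analyticAt_const.mul (analyticAt_ascPochhammer_apply k (Fin.last (n + 1)) s)).mul
    ((hF k).comp (f := fun s : Fin (n + 2) → ℂ => mergeLast s (k : ℂ)) (analyticAt_mergeLast _ s))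

theorem analyticAt_zetaFun : ∀ {n : ℕ} {d : Fin (n + 1) → ℕ} (_ : ∀ j, 0 < d j)
    {γ : Fin (n + 1) → ℂ} (_ : ∀ j, 0 < (γ j).re) {s : Fin (n + 1) → ℂ} (_ : OffPoles d s),
    AnalyticAt ℂ (zetaFun n d γ) s := by
  intro n
  induction n with
  | zero => exact fun hd _ hγ _ hs => analyticAt_zetaFun_zero hγ (hs.mul_ne_one hd)
  | succ n ih =>
    intro d hd γ hγ s hs
    have ih' := fun {s} => ih (d := Fin.init d) (fun _ => hd _) (γ := Fin.init γ)
      (fun _ => hγ _) (s := s)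
    obtain ⟨K, hK⟩ := (eventually_mem_remDomain (Fin.init d) s).exists
    refine AnalyticAt.congr ?_ (eventuallyEq_zetaStep hd hγ hK)
    have h1 : AnalyticAt ℂ (fun s : Fin (n + 2) → ℂ => leadFactor (γ (Fin.last (n + 1)))
        (d (Fin.last (n + 1))) (s (Fin.last (n + 1)))) s :=
      (analyticAt_leadFactor hs.last).comp
        (f := fun s : Fin (n + 2) → ℂ => s (Fin.last (n + 1))) (analyticAt_apply _ s)
    exact (h1.mul ((ih' hs.mergeLast_neg).comp
      (f := fun s : Fin (n + 2) → ℂ => mergeLast s _) (analyticAt_mergeLast _ s))).add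
      (analyticAt_zetaRest hd hγ (fun k => ih' (hs.mergeLast_nat k)) hK)

end Continuation

/-! ### Values and residues of the Gamma function -/

lemma Gamma_intCast_sub {a b : ℤ} (hab : a ≤ b) {β : ℂ}
    (h : ∀ u ∈ Finset.Ico a b, (u : ℂ) - β ≠ 0) :
    Complex.Gamma (b - β) = Complex.Gamma (a - β) * ∏ u ∈ Finset.Ico a b, ((u : ℂ) - β) := by
  induction b, hab using Int.leInduction with
  | base => simp
  | succ b hab ih =>
    have hb : b ∉ Finset.Ico a b := by simp
    rw [← Finset.insert_Ico_right_eq_Ico_add_one hab] at h ⊢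
    rw [Finset.prod_insert hb, mul_left_comm,
      ← ih fun u hu => h u (Finset.mem_insert_of_mem hu),
      ← Complex.Gamma_add_one _ (h b (Finset.mem_insert_self b _))]
    congr 1
    push_cast
    ring

/-- The residue of the Gamma function at `-M`. -/
lemma tendsto_self_mul_Gamma_sub_nat (M : ℕ) :
    Tendsto (fun z : ℂ => z * Complex.Gamma (z - M)) (𝓝[≠] 0) (𝓝 ((-1) ^ M / M.factorial)) := by
  induction M with
  | zero => simpa using Complex.tendsto_self_mul_Gamma_nhds_zero
  | succ M ih =>
    have hM : ((M : ℂ) + 1) ≠ 0 := by exact_mod_cast M.succ_ne_zero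
    have hM' : 0 - ((M : ℂ) + 1) ≠ 0 := by rwa [zero_sub, neg_ne_zero]
    have h1 : Tendsto (fun z : ℂ => z - (M + 1)) (𝓝[≠] 0) (𝓝 (0 - (M + 1))) :=
      (Continuous.tendsto (by fun_prop) 0).mono_left nhdsWithin_le_nhds
    have h2 := ih.div h1 hM'
    have h3 : ((-1) ^ (M + 1) / ((M + 1).factorial : ℂ)) =
        (-1) ^ M / (M.factorial : ℂ) / (0 - (M + 1)) := by
      rw [Nat.factorial_succ]
      have : (M.factorial : ℂ) ≠ 0 := by exact_mod_cast M.factorial_ne_zero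
      push_cast
      rw [zero_sub, div_neg, pow_succ]
      field_simp
    rw [h3]
    refine h2.congr' ?_
    filter_upwards [h1.eventually_ne hM'] with z hz
    have e : z - M = z - (M + 1) + 1 := by ring
    rw [Pi.div_apply, e, Complex.Gamma_add_one _ hz]
    push_cast
    field_simp

lemma tendsto_mul_const_nhdsNE {θ : ℂ} (hθ : θ ≠ 0) :
    Tendsto (fun t : ℂ => t * θ) (𝓝[≠] 0) (𝓝[≠] 0) := by
  refine tendsto_nhdsWithin_iff.2 ⟨?_, ?_⟩
  · have : Tendsto (fun t : ℂ => t * θ) (𝓝 0) (𝓝 (0 * θ)) := Continuous.tendsto (by fun_prop) 0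
    rw [zero_mul] at this
    exact this.mono_left nhdsWithin_le_nhds
  · filter_upwards [self_mem_nhdsWithin] with t ht
    exact mul_ne_zero ht hθ

lemma tendsto_mul_Gamma_line (M : ℕ) {θ : ℂ} (hθ : θ ≠ 0) :
    Tendsto (fun t : ℂ => t * Complex.Gamma (-M + t * θ)) (𝓝[≠] 0)
      (𝓝 ((-1) ^ M / (M.factorial * θ))) := by
  have h := ((tendsto_self_mul_Gamma_sub_nat M).comp (tendsto_mul_const_nhdsNE hθ)).div_const θ
  rw [div_div] at h
  refine h.congr fun t => ?_
  simp only [Function.comp]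
  rw [mul_right_comm, mul_div_assoc, div_self hθ, mul_one, neg_add_eq_sub]

lemma tendsto_inv_Gamma_line_div (N : ℕ) {θ : ℂ} (hθ : θ ≠ 0) :
    Tendsto (fun t : ℂ => (Complex.Gamma (-N + t * θ))⁻¹ / t) (𝓝[≠] 0)
      (𝓝 ((-1) ^ N * N.factorial * θ)) := by
  have hN : (N.factorial : ℂ) ≠ 0 := by exact_mod_cast N.factorial_ne_zero
  have h0 : ((-1 : ℂ) ^ N / (N.factorial * θ)) ≠ 0 :=
    div_ne_zero (pow_ne_zero _ (by norm_num)) (mul_ne_zero hN hθ)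
  have h := (tendsto_mul_Gamma_line N hθ).inv₀ h0
  have e : ((-1 : ℂ) ^ N / (N.factorial * θ))⁻¹ = (-1) ^ N * N.factorial * θ := by
    rw [inv_div, div_eq_mul_inv, ← inv_pow, inv_neg, inv_one]
    ring
  rw [e] at h
  refine h.congr fun t => ?_
  rw [mul_inv, div_eq_mul_inv, mul_comm]

/-! ### Points with a single singular hyperplane -/

/-- `p` lies on none of the hyperplanes of `OffPoles`, except possibly on those for the second
variable with `E = {3, …, n}`. -/
def OffPolesBut {n : ℕ} (d : Fin n → ℕ) (p : Fin n → ℂ) : Prop :=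
  ∀ j : Fin n, ∀ E ⊆ Finset.Ioi j, ∀ l : ℕ,
    ∑ k ∈ Finset.Ici j, p k = 1 / (d j : ℂ) + ∑ k ∈ E, 1 / (d k : ℂ) - l →
      (j : ℕ) = 1 ∧ E = Finset.Ioi j

section OffPolesBut

variable {n : ℕ} {d : Fin (n + 2) → ℕ} {p : Fin (n + 2) → ℂ}

lemma OffPolesBut.mergeLast_nat (h : OffPolesBut d p) (k : ℕ) :
    OffPoles (Fin.init d) (mergeLast p (k : ℂ)) := by
  intro j E hE l hcon
  rw [sum_Ici_mergeLast] at hcon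
  have h1 := (h j.castSucc (E.map Fin.castSuccEmb) (map_castSucc_subset_Ioi hE) (l + k) (by
    rw [Finset.sum_map]
    simp only [Fin.coe_castSuccEmb]
    simp only [Fin.init] at hcon
    push_cast
    linear_combination hcon)).2
  have h2 : Fin.last (n + 1) ∈ E.map Fin.castSuccEmb := by
    rw [h1]
    simp [Fin.castSucc_lt_last]
  simp [Fin.castSucc_ne_last] at h2

lemma OffPolesBut.mergeLast_neg (h : OffPolesBut d p) :
    OffPolesBut (Fin.init d) (mergeLast p (-(1 / (d (Fin.last (n + 1)) : ℂ)))) := by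
  intro j E hE l hcon
  rw [sum_Ici_mergeLast] at hcon
  have hlast : Fin.last (n + 1) ∉ E.map Fin.castSuccEmb := by
    simp [Fin.castSucc_ne_last]
  obtain ⟨h1, h2⟩ := h j.castSucc (insert (Fin.last (n + 1)) (E.map Fin.castSuccEmb)) (by
    intro k hk
    rcases Finset.mem_insert.1 hk with rfl | hk
    · simp [Fin.castSucc_lt_last]
    · exact map_castSucc_subset_Ioi hE hk) l (by
    rw [Finset.sum_insert hlast, Finset.sum_map]
    simp only [Fin.coe_castSuccEmb]
    simp only [Fin.init] at hcon
    linear_combination hcon)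
  refine ⟨by simpa using h1, hE.antisymm fun k hk => ?_⟩
  have h3 : k.castSucc ∈ Finset.Ioi j.castSucc := by simpa using hk
  rw [← h2] at h3
  simpa [Fin.castSucc_ne_last] using h3

lemma OffPolesBut.last (h : OffPolesBut d p) (hn : n ≠ 0) (l : ℕ) :
    p (Fin.last (n + 1)) - 1 / (d (Fin.last (n + 1)) : ℂ) ≠ -l := by
  intro hcon
  have h1 := (h (Fin.last (n + 1)) ∅ (by simp) l (by
    rw [sum_Ici_last, Finset.sum_empty]
    linear_combination hcon)).1
  simp only [Fin.val_last] at h1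
  omega

end OffPolesBut

/-! ### Tails of vectors -/

section TailSum

variable {R : Type*} [AddCommMonoid R] {n : ℕ}

lemma tailSum_eq_init_add (x : Fin (n + 1) → R) {j : ℕ} (hj : j ≤ n + 1) :
    tailSum x j = tailSum (Fin.init x) j + x (Fin.last n) := by
  simp only [tailSum, Finset.sum_filter, Fin.sum_univ_castSucc (n := n), Fin.init, Fin.val_castSucc,
    Fin.val_last, if_pos hj]

lemma tailSum_mergeLast (x : Fin (n + 2) → R) (c : R) {j : ℕ} (hj : j ≤ n + 1) :
    tailSum (mergeLast x c) j = tailSum x j + c := by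
  rw [tailSum_eq_init_add x (by omega), tailSum_eq_init_add (mergeLast x c) hj,
    tailSum_eq_init_add (Fin.init x) hj]
  have h1 : tailSum (Fin.init (mergeLast x c)) j = tailSum (Fin.init (Fin.init x)) j := by
    congr 1
    funext i
    simp [mergeLast, Fin.init, Fin.castSucc_ne_last]
  rw [h1]
  simp only [mergeLast, if_true]
  abel

lemma tailSum_succ (x : Fin (n + 1) → R) : tailSum x (n + 1) = x (Fin.last n) := by
  rw [tailSum_eq_init_add x le_rfl]
  have : tailSum (Fin.init x) (n + 1) = 0 := by
    refine Finset.sum_eq_zero fun k hk => ?_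
    have := (Finset.mem_filter.1 hk).2
    omega
  rw [this, zero_add]

lemma recip_init {n : ℕ} (d : Fin (n + 1) → ℕ) : recip (Fin.init d) = Fin.init (recip d) := rfl

end TailSum

/-- The product over `j ≥ 3` in `constC`, with all its factors shifted by `δ`. -/
def prodFactors {n : ℕ} (d N : Fin n → ℕ) (δ : ℚ) : ℚ :=
  ∏ j ∈ Finset.Icc 3 n,
    ∏ u ∈ Finset.Ico (-((tailSum N (j - 1) : ℕ) : ℤ)) (-((tailSum N j : ℕ) : ℤ)),
      ((u : ℚ) - tailSum (recip d) j - δ)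

lemma prodFactors_succ {n : ℕ} (d N : Fin (n + 3) → ℕ) (δ : ℚ) :
    prodFactors d N δ = prodFactors (Fin.init d) (mergeLast N 0)
        (δ + 1 / (d (Fin.last (n + 2)) : ℚ)) *
      ∏ u ∈ Finset.Ico (-((mergeLast N 0 (Fin.last (n + 1)) : ℕ) : ℤ))
          (-((N (Fin.last (n + 2)) : ℕ) : ℤ)),
        ((u : ℚ) - (δ + 1 / (d (Fin.last (n + 2)) : ℚ))) := by
  rw [prodFactors, Finset.prod_Icc_succ_top (by omega), prodFactors]
  congr 1
  · refine Finset.prod_congr rfl fun j hj => ?_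
    have hj' := (Finset.mem_Icc.1 hj).2
    rw [tailSum_mergeLast N 0 hj', tailSum_mergeLast N 0 (by omega), recip_init,
      tailSum_eq_init_add (recip d) (by omega)]
    refine Finset.prod_congr rfl fun u _ => ?_
    simp only [recip]
    ring
  · rw [Nat.add_sub_cancel, tailSum_succ N, tailSum_succ (recip d),
      ← tailSum_succ (mergeLast N 0), tailSum_mergeLast N 0 le_rfl]
    refine Finset.prod_congr rfl fun u _ => ?_
    simp only [recip]
    ring

/-! ### The residue along a line -/

section LineLimit

variable {n : ℕ}

lemma tendsto_comp_line {E : Type*} [TopologicalSpace E] {f : (Fin n → ℂ) → E} {p : Fin n → ℂ}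
    (hf : ContinuousAt f p) (θ : Fin n → ℂ) :
    Tendsto (fun t : ℂ => f (p + t • θ)) (𝓝[≠] 0) (𝓝 (f p)) := by
  have h : Tendsto (fun t : ℂ => p + t • θ) (𝓝 0) (𝓝 p) := by
    have := Continuous.tendsto (f := fun t : ℂ => p + t • θ) (by fun_prop) 0
    simpa using this
  exact (hf.tendsto.comp h).mono_left nhdsWithin_le_nhds

lemma mergeLast_add_smul (p θ : Fin (n + 2) → ℂ) (t c : ℂ) :
    mergeLast (p + t • θ) c = mergeLast p c + t • mergeLast θ 0 := by
  funext i
  simp only [mergeLast, Fin.init, Pi.add_apply, Pi.smul_apply, smul_eq_mul]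
  split_ifs <;> ring

/-- The point `(-N₁, …, -Nₙ - δ)`. -/
def negPoint (N : Fin (n + 1) → ℕ) (δ : ℚ) : Fin (n + 1) → ℂ :=
  fun i => -(N i : ℂ) - if i = Fin.last n then (δ : ℂ) else 0

lemma negPoint_last (N : Fin (n + 1) → ℕ) (δ : ℚ) :
    negPoint N δ (Fin.last n) = -(N (Fin.last n) : ℂ) - δ := by
  simp [negPoint]

lemma mergeLast_negPoint (N : Fin (n + 2) → ℕ) (δ ε : ℚ) :
    mergeLast (negPoint N δ) (-(ε : ℂ)) = negPoint (mergeLast N 0) (δ + ε) := by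
  funext i
  simp only [mergeLast, Fin.init, negPoint, Fin.castSucc_ne_last, if_false, if_true]
  split_ifs
  · push_cast
    ring
  · push_cast
    ring

/-- On the hyperplane `p_{n+1} - 1/d = -M`, the leading factor has a simple pole. -/
lemma tendsto_mul_leadFactor_line (γ : ℂ) (d : ℕ) {p θ : ℂ} {M : ℕ} (hp : p - 1 / d = -M)
    (hθ : θ ≠ 0) :
    Tendsto (fun t : ℂ => t * leadFactor γ d (p + t * θ)) (𝓝[≠] 0)
      (𝓝 (thetaLead γ d * ((-1) ^ M / (M.factorial * θ)) * (Complex.Gamma p)⁻¹)) := by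
  have h1 : Tendsto (fun t : ℂ => (Complex.Gamma (p + t * θ))⁻¹) (𝓝[≠] 0)
      (𝓝 (Complex.Gamma p)⁻¹) := by
    have h : Tendsto (fun t : ℂ => p + t * θ) (𝓝 0) (𝓝 p) := by
      have := Continuous.tendsto (f := fun t : ℂ => p + t * θ) (by fun_prop) 0
      simpa using this
    exact ((analyticAt_inv_Gamma p).continuousAt.tendsto.comp h).mono_left nhdsWithin_le_nhds
  refine (((tendsto_mul_Gamma_line M hθ).const_mul (thetaLead γ d)).mul h1).congr fun t => ?_
  have e : p + t * θ - 1 / d = -M + t * θ := by rw [← hp]; ring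
  rw [leadFactor, e]
  ring

variable {d : Fin (n + 2) → ℕ} {γ : Fin (n + 2) → ℂ}

/-- The terms of the recursion for the continuation along a line, up to a holomorphic part which
is killed by the factor `t`. -/
lemma tendsto_mul_zetaFun_line (hd : ∀ j, 0 < d j) (hγ : ∀ j, 0 < (γ j).re) {p : Fin (n + 2) → ℂ}
    (hp : OffPolesBut d p) (θ : Fin (n + 2) → ℂ) {L : ℂ}
    (h : Tendsto (fun t : ℂ => t * (leadFactor (γ (Fin.last (n + 1))) (d (Fin.last (n + 1)))
        (p (Fin.last (n + 1)) + t * θ (Fin.last (n + 1))) *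
      zetaFun n (Fin.init d) (Fin.init γ)
        (mergeLast p (-(1 / (d (Fin.last (n + 1)) : ℂ))) + t • mergeLast θ 0))) (𝓝[≠] 0) (𝓝 L)) :
    Tendsto (fun t : ℂ => t * zetaFun (n + 1) d γ (p + t • θ)) (𝓝[≠] 0) (𝓝 L) := by
  obtain ⟨K, hK⟩ := (eventually_mem_remDomain (Fin.init d) p).exists
  have hrest := tendsto_comp_line (analyticAt_zetaRest hd hγ (K := K)
    (F := zetaFun n (Fin.init d) (Fin.init γ))
    (fun k => analyticAt_zetaFun (fun _ => hd _) (fun _ => hγ _) (hp.mergeLast_nat k))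
    hK).continuousAt θ
  have ht : Tendsto (fun t : ℂ => t) (𝓝[≠] 0) (𝓝 0) := tendsto_id.mono_left nhdsWithin_le_nhds
  have h1 := h.add (ht.mul hrest)
  rw [zero_mul, add_zero] at h1
  refine h1.congr' ?_
  have hmem : ∀ᶠ t : ℂ in 𝓝[≠] 0, p + t • θ ∈ remDomain (Fin.init d) K :=
    (tendsto_comp_line (f := id) continuousAt_id θ).eventually
      ((isOpen_remDomain _ K).mem_nhds hK)
  filter_upwards [hmem] with t htK
  rw [zetaFun_eq_zetaStep hd hγ htK, zetaStep, mergeLast_add_smul, ← mul_add]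
  rfl

end LineLimit

/-- The quotient of Gamma values that one step of the recursion contributes. -/
lemma Gamma_mul_prodFactors {n : ℕ} {d N : Fin (n + 3) → ℕ} {δ : ℚ} (hδ : 0 ≤ δ)
    (h : ∀ l : ℕ, negPoint N δ (Fin.last (n + 2)) - 1 / (d (Fin.last (n + 2)) : ℂ) ≠ -l) :
    Complex.Gamma (negPoint N δ (Fin.last (n + 2)) - 1 / (d (Fin.last (n + 2)) : ℂ)) *
        (Complex.Gamma (negPoint (mergeLast N 0) (δ + 1 / (d (Fin.last (n + 2)) : ℚ))
          (Fin.last (n + 1))))⁻¹ *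
        (prodFactors (Fin.init d) (mergeLast N 0) (δ + 1 / (d (Fin.last (n + 2)) : ℚ)) : ℂ) =
      (prodFactors d N δ : ℂ) := by
  have hδ' : 0 ≤ δ + 1 / (d (Fin.last (n + 2)) : ℚ) := by positivity
  have hpl := negPoint_last N δ
  rw [prodFactors_succ]
  set δ' : ℚ := δ + 1 / (d (Fin.last (n + 2)) : ℚ) with hδ'_def
  have hGl : negPoint N δ (Fin.last (n + 2)) - 1 / (d (Fin.last (n + 2)) : ℂ) =
      ((-(N (Fin.last (n + 2)) : ℤ) : ℤ) : ℂ) - (δ' : ℂ) := by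
    rw [hpl, hδ'_def]
    push_cast
    ring
  have hGp : negPoint (mergeLast N 0) δ' (Fin.last (n + 1)) =
      ((-((mergeLast N 0 (Fin.last (n + 1)) : ℕ) : ℤ) : ℤ) : ℂ) - (δ' : ℂ) := by
    rw [negPoint_last]
    push_cast
    ring
  have hle : -((mergeLast N 0 (Fin.last (n + 1)) : ℕ) : ℤ) ≤ -(N (Fin.last (n + 2)) : ℤ) := by
    have : mergeLast N 0 (Fin.last (n + 1)) =
        N (Fin.last (n + 1)).castSucc + N (Fin.last (n + 2)) := by
      simp [mergeLast, Fin.init]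
    omega
  have hG := Gamma_intCast_sub hle (β := (δ' : ℂ)) (by
    intro u hu h
    have hu' := (Finset.mem_Ico.1 hu).2
    have hu0 : (u : ℚ) < 0 := by exact_mod_cast (by omega : u < 0)
    have : (u : ℚ) - δ' = 0 := by exact_mod_cast h
    linarith)
  have hG0 := Complex.Gamma_ne_zero h
  rw [← hGl, ← hGp] at hG
  have hG1 : Complex.Gamma (negPoint (mergeLast N 0) δ' (Fin.last (n + 1))) ≠ 0 :=
    fun h => hG0 (by rw [hG, h, zero_mul])
  rw [hG]
  push_cast
  field_simp

/-- The residue of the continuation along a line through a point that lies on the singular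
hyperplane of the second variable but on no other one. -/
theorem tendsto_mul_zetaFun_negPoint {n : ℕ} {d : Fin (n + 2) → ℕ} (hd : ∀ j, 0 < d j)
    {γ : Fin (n + 2) → ℂ} (hγ : ∀ j, 0 < (γ j).re) {N : Fin (n + 2) → ℕ} {δ : ℚ} (hδ : 0 ≤ δ)
    (hp : OffPolesBut d (negPoint N δ)) {M : ℕ}
    (hM : (M : ℚ) = (tailSum N 2 : ℕ) + δ + tailSum (recip d) 2) {θ : Fin (n + 2) → ℂ}
    (hθ : tailSum θ 2 ≠ 0) :
    Tendsto (fun t : ℂ => t * zetaFun (n + 1) d γ (negPoint N δ + t • θ)) (𝓝[≠] 0)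
      (𝓝 ((Complex.Gamma (negPoint N δ (Fin.last (n + 1))))⁻¹ * (prodFactors d N δ : ℂ) *
        (∏ j : Fin (n + 2) with 2 ≤ j.val + 1, thetaLead (γ j) (d j)) *
        ((-1) ^ M / (M.factorial * tailSum θ 2)) *
        (γ 0 ^ (N 0 + M) * riemannZeta (-((d 0 * (N 0 + M) : ℕ) : ℂ))))) := by
  induction n generalizing δ with
  | zero =>
    have e1 : tailSum θ 2 = θ 1 := tailSum_succ θ
    have e2 : tailSum N 2 = N 1 := tailSum_succ N
    have e3 : tailSum (recip d) 2 = 1 / (d 1 : ℚ) := tailSum_succ (recip d)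
    rw [e2, e3] at hM
    rw [e1] at hθ ⊢
    have hMC : (M : ℂ) = N 1 + δ + 1 / (d 1 : ℂ) := by
      have := congrArg (Rat.cast : ℚ → ℂ) hM
      push_cast at this
      exact this
    have hp1 : negPoint N δ 1 = -(N 1 : ℂ) - δ := negPoint_last N δ
    have hlead := tendsto_mul_leadFactor_line (γ 1) (d 1) (p := negPoint N δ 1) (M := M)
      (by rw [hp1, hMC]; ring) hθ
    have hz : mergeLast (negPoint N δ) (-(1 / (d 1 : ℂ))) 0 = -((N 0 + M : ℕ) : ℂ) := by
      simp only [mergeLast, Fin.init, Fin.last_zero, if_true]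
      rw [show Fin.last (0 + 1) = 1 from rfl, hp1, negPoint]
      push_cast
      rw [hMC]
      simp
      ring
    have hval : zetaFun 0 (Fin.init d) (Fin.init γ) (mergeLast (negPoint N δ) (-(1 / (d 1 : ℂ)))) =
        γ 0 ^ (N 0 + M) * riemannZeta (-((d 0 * (N 0 + M) : ℕ) : ℂ)) := by
      rw [zetaFun, hz, neg_neg, Complex.cpow_natCast]
      simp only [Fin.init, Fin.castSucc_zero]
      congr 2
      push_cast
      ring
    have han : AnalyticAt ℂ (zetaFun 0 (Fin.init d) (Fin.init γ))
        (mergeLast (negPoint N δ) (-(1 / (d 1 : ℂ)))) := by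
      refine analyticAt_zetaFun_zero (fun _ => hγ _) ?_
      rw [hz]
      intro h
      have h1 := congrArg Complex.re h
      have h2 : (0 : ℝ) ≤ (Fin.init d 0 : ℕ) * (N 0 + M : ℕ) := by positivity
      rw [mul_neg, Complex.neg_re, ← Nat.cast_mul, Complex.natCast_re, Complex.one_re,
        Nat.cast_mul] at h1
      linarith
    have h1 := hlead.mul (tendsto_comp_line han.continuousAt (mergeLast θ 0))
    rw [hval] at h1
    refine tendsto_mul_zetaFun_line hd hγ hp θ ?_
    have hprod : (∏ j : Fin (0 + 2) with 2 ≤ j.val + 1, thetaLead (γ j) (d j)) =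
        thetaLead (γ 1) (d 1) := by
      rw [Finset.prod_filter, Fin.prod_univ_two]
      simp
    have hpf : prodFactors d N δ = 1 := by simp [prodFactors]
    rw [hprod, hpf, Rat.cast_one, mul_one]
    convert! h1 using 2
    · rw [mul_assoc]
      rfl
    · rw [show Fin.last (0 + 1) = 1 from rfl]
      ring
  | succ n ih =>
    have hmerge : mergeLast (negPoint N δ) (-(1 / (d (Fin.last (n + 2)) : ℂ))) =
        negPoint (mergeLast N 0) (δ + 1 / (d (Fin.last (n + 2)) : ℚ)) := by
      rw [← mergeLast_negPoint]
      push_cast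
      rfl
    have hδ' : 0 ≤ δ + 1 / (d (Fin.last (n + 2)) : ℚ) := by positivity
    have hp' := hp.mergeLast_neg
    rw [hmerge] at hp'
    have hM' : (M : ℚ) = (tailSum (mergeLast N 0) 2 : ℕ) + (δ + 1 / (d (Fin.last (n + 2)) : ℚ)) +
        tailSum (recip (Fin.init d)) 2 := by
      rw [hM, tailSum_mergeLast N 0 (by omega), tailSum_eq_init_add (recip d) (by omega),
        recip_init]
      simp only [recip, add_zero]
      ring
    have hθ' : tailSum (mergeLast θ 0) 2 ≠ 0 := by
      rwa [tailSum_mergeLast θ 0 (by omega), add_zero]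
    have hlim := ih (d := Fin.init d) (fun _ => hd _) (γ := Fin.init γ) (fun _ => hγ _)
      (N := mergeLast N 0) hδ' hp' hM' hθ'
    have hpl := negPoint_last N δ
    have hlead := tendsto_comp_line (f := fun s : Fin (n + 3) → ℂ => leadFactor
        (γ (Fin.last (n + 2))) (d (Fin.last (n + 2))) (s (Fin.last (n + 2))))
      ((analyticAt_leadFactor (hp.last (by omega))).comp
        (f := fun s : Fin (n + 3) → ℂ => s (Fin.last (n + 2)))
        (analyticAt_apply _ _)).continuousAt θ
    have h1 := hlead.mul hlim
    refine tendsto_mul_zetaFun_line hd hγ hp θ ?_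
    rw [hmerge]
    set δ' : ℚ := δ + 1 / (d (Fin.last (n + 2)) : ℚ) with hδ'_def
    have hG := Gamma_mul_prodFactors hδ (hp.last (by omega))
    have hprod : (∏ j : Fin (n + 1 + 2) with 2 ≤ j.val + 1, thetaLead (γ j) (d j)) =
        (∏ j : Fin (n + 2) with 2 ≤ j.val + 1, thetaLead (Fin.init γ j) (Fin.init d j)) *
          thetaLead (γ (Fin.last (n + 2))) (d (Fin.last (n + 2))) := by
      rw [Finset.prod_filter, Finset.prod_filter, Fin.prod_univ_castSucc]
      simp [Fin.init]
    convert! h1 using 2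
    · simp only [Pi.add_apply, Pi.smul_apply, smul_eq_mul]
      ring
    · have e0 : mergeLast N 0 0 = N 0 := by
        simp [mergeLast, Fin.init]
      rw [hprod, ← hG, leadFactor, e0, tailSum_mergeLast θ 0 (by omega), add_zero]
      simp only [Fin.init, Fin.castSucc_zero]
      rw [← hδ'_def]
      push_cast
      ring

/-! ### Values at non-positive integers -/

section Values

variable {n : ℕ}

lemma negPoint_zero (N : Fin (n + 1) → ℕ) : negPoint N 0 = fun i => -(N i : ℂ) := by
  funext i
  simp [negPoint]

lemma thetaCoeff_mul_ascPochhammer (γ : ℂ) (d k N : ℕ) :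
    thetaCoeff γ d k * (ascPochhammer ℂ k).eval (-(N : ℂ)) =
      riemannZeta (-((d * k : ℕ) : ℂ)) * N.choose k * γ ^ k := by
  have hk : (k.factorial : ℂ) ≠ 0 := by exact_mod_cast k.factorial_ne_zero
  have h1 : ((-1 : ℂ) ^ k) * (-1) ^ k = 1 := by rw [← mul_pow]; norm_num
  rw [ascPochhammer_eval_neg_eq_descPochhammer, descPochhammer_eval_eq_descFactorial,
    Nat.descFactorial_eq_factorial_mul_choose, thetaCoeff, neg_pow γ k]
  push_cast
  field_simp
  linear_combination riemannZeta (-((d : ℂ) * k)) * γ ^ k * (N.choose k : ℂ) * h1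

variable {d : Fin (n + 2) → ℕ} {γ : Fin (n + 2) → ℂ}

/-- At a point whose last entry is `-N`, the remainder is divided by a pole of the Gamma function,
and the remaining sum breaks off. The value `0` of `Complex.Gamma` at its poles together with
`x / 0 = 0` yields the correct value `0` of `1 / Γ`. -/
lemma zetaRest_of_last_eq_neg {s : Fin (n + 2) → ℂ} {N : ℕ}
    (hs : s (Fin.last (n + 1)) = -(N : ℂ)) (F : (Fin (n + 1) → ℂ) → ℂ) {K : ℕ} (hK : N < K) :
    zetaRest d γ F K s = ∑ k ∈ Finset.range (N + 1),
      riemannZeta (-((d (Fin.last (n + 1)) * k : ℕ) : ℂ)) * N.choose k *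
        γ (Fin.last (n + 1)) ^ k * F (mergeLast s (k : ℂ)) := by
  rw [zetaRest, hs, Complex.Gamma_neg_nat_eq_zero, div_zero, add_zero]
  simp_rw [thetaCoeff_mul_ascPochhammer]
  refine (Finset.sum_subset (Finset.range_subset_range.2 hK) fun k _ hk => ?_).symm
  have : N < k := by
    rw [Finset.mem_range] at hk
    omega
  rw [Nat.choose_eq_zero_of_lt this]
  simp

lemma zetaFun_of_last_eq_neg (hd : ∀ j, 0 < d j) (hγ : ∀ j, 0 < (γ j).re)
    {s : Fin (n + 2) → ℂ} {N : ℕ} (hs : s (Fin.last (n + 1)) = -(N : ℂ)) :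
    zetaFun (n + 1) d γ s = ∑ k ∈ Finset.range (N + 1),
      riemannZeta (-((d (Fin.last (n + 1)) * k : ℕ) : ℂ)) * N.choose k *
        γ (Fin.last (n + 1)) ^ k * zetaFun n (Fin.init d) (Fin.init γ) (mergeLast s (k : ℂ)) := by
  obtain ⟨K, hK, hNK⟩ := ((eventually_mem_remDomain (Fin.init d) s).and
    (eventually_gt_atTop N)).exists
  -- the leading term vanishes, again by the convention `x / 0 = 0` for `1 / Γ`
  rw [zetaFun_eq_zetaStep hd hγ hK, zetaStep, zetaRest_of_last_eq_neg hs _ hNK, leadFactor, hs,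
    Complex.Gamma_neg_nat_eq_zero, div_zero, zero_mul, zero_add]

lemma riemannZeta_neg_nat_mem (S : IntermediateField ℚ ℂ) (k : ℕ) :
    riemannZeta (-(k : ℂ)) ∈ S := by
  rw [riemannZeta_neg_nat_eq_bernoulli]
  refine S.div_mem (S.mul_mem (_root_.pow_mem (S.neg_mem S.one_mem) _) ?_)
    (S.add_mem (natCast_mem S k) S.one_mem)
  exact SubfieldClass.ratCast_mem S _

/-- At non-positive integers the continuation takes values in the field generated by the
coefficients. -/
theorem zetaFun_neg_nat_mem (S : IntermediateField ℚ ℂ) : ∀ {n : ℕ} {d : Fin (n + 1) → ℕ}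
    (_ : ∀ j, 0 < d j) {γ : Fin (n + 1) → ℂ} (_ : ∀ j, 0 < (γ j).re) (_ : ∀ j, γ j ∈ S)
    (N : Fin (n + 1) → ℕ), zetaFun n d γ (fun j => -(N j : ℂ)) ∈ S := by
  intro n
  induction n with
  | zero =>
    intro d _ γ _ hS N
    have e : (d 0 : ℂ) * -(N 0 : ℂ) = -((d 0 * N 0 : ℕ) : ℂ) := by
      push_cast
      ring
    rw [zetaFun, neg_neg, Complex.cpow_natCast, e]
    exact S.mul_mem (_root_.pow_mem (hS 0) _) (riemannZeta_neg_nat_mem S _)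
  | succ n ih =>
    intro d hd γ hγ hS N
    rw [zetaFun_of_last_eq_neg hd hγ (N := N (Fin.last (n + 1))) rfl]
    refine S.sum_mem fun k hk => S.mul_mem (S.mul_mem (S.mul_mem (riemannZeta_neg_nat_mem S _)
      (natCast_mem S _)) (_root_.pow_mem (hS _) _)) ?_
    have hk' : k ≤ N (Fin.last (n + 1)) := Nat.lt_succ_iff.1 (Finset.mem_range.1 hk)
    -- only `k ≤ N` occurs, so the merged point is again one of `-ℕⁿ`
    have e : mergeLast (fun j => -(N j : ℂ)) (k : ℂ) =
        fun j => -((Fin.init N j +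
          if j = Fin.last n then N (Fin.last (n + 1)) - k else 0 : ℕ) : ℂ) := by
      funext j
      simp only [mergeLast, Fin.init]
      split_ifs
      · rw [Nat.cast_add, Nat.cast_sub hk']
        ring
      · simp
    rw [e]
    exact ih (fun _ => hd _) (fun _ => hγ _) (fun _ => hS _) _

lemma mergedPoint_eq_mergeLast (N : Fin (n + 2) → ℕ) (r : ℕ) :
    mergedPoint N r = mergeLast (fun j => -(N j : ℂ)) (r : ℂ) := by
  funext i
  have : (i : ℕ) + 1 = n + 1 ↔ i = Fin.last n := by
    rw [Fin.ext_iff, Fin.val_last]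
    omega
  simp only [mergedPoint, mergeLast, Fin.init, this]
  split_ifs <;> ring

/-- Only the odd multiples of `d` contribute: `ζ` vanishes at the negative even integers. -/
lemma sum_riemannZeta_neg_mul {d : Fin (n + 1) → ℕ} (hd : 0 < d (Fin.last n)) (N : Fin (n + 1) → ℕ)
    (f : ℕ → ℂ) :
    ∑ k ∈ Finset.range (N (Fin.last n) + 1),
        riemannZeta (-((d (Fin.last n) * k : ℕ) : ℂ)) * (N (Fin.last n)).choose k * f k =
      -(1 / 2) * f 0 - ∑ k ∈ indexH d N, ((bernoulli (2 * k) : ℚ) : ℂ) / (2 * (k : ℂ)) *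
        ((N (Fin.last n)).choose ((2 * k - 1) / d (Fin.last n)) : ℂ) *
          f ((2 * k - 1) / d (Fin.last n)) := by
  set D := d (Fin.last n) with hD
  set L := N (Fin.last n) with hL
  have hdata : ∀ k ∈ indexH d N, 1 ≤ k ∧ 2 * k - 1 = D * ((2 * k - 1) / D) ∧
      1 ≤ (2 * k - 1) / D ∧ (2 * k - 1) / D ≤ L := by
    intro k hk
    obtain ⟨hk1, hk2⟩ := Finset.mem_filter.1 hk
    obtain ⟨hk3, hk4⟩ := Finset.mem_Icc.1 hk1
    obtain ⟨r, hr⟩ := hk2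
    have e : (2 * k - 1) / D = r := by rw [hr, ← hD, Nat.mul_div_cancel_left _ hd]
    rw [← hD] at hr
    rw [e]
    have h1 : 2 * k ≤ 1 + D * L := by
      rw [← hD, ← hL] at hk4
      omega
    refine ⟨hk3, hr, ?_, ?_⟩
    · rcases Nat.eq_zero_or_pos r with rfl | h
      · omega
      · exact h
    · exact Nat.le_of_mul_le_mul_left (by omega : D * r ≤ D * L) hd
  have hsum : ∑ k ∈ indexH d N, -(((bernoulli (2 * k) : ℚ) : ℂ) / (2 * (k : ℂ)) *
        (L.choose ((2 * k - 1) / D) : ℂ) * f ((2 * k - 1) / D)) =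
      ∑ k ∈ Finset.Ico 1 (L + 1), riemannZeta (-((D * k : ℕ) : ℂ)) * L.choose k * f k := by
    refine Finset.sum_of_injOn (fun k => (2 * k - 1) / D) ?_ ?_ ?_ ?_
    · intro k hk k' hk' h
      have h1 := hdata k hk
      have h2 := hdata k' hk'
      simp only at h
      rw [← h] at h2
      omega
    · intro k hk
      have h1 := hdata k hk
      simp only [Finset.coe_Ico, Set.mem_Ico]
      omega
    · intro r hr hnot
      have hr' := Finset.mem_Ico.1 hr
      have hDr : 0 < D * r := Nat.mul_pos hd (by omega)
      have heven : Even (D * r) := by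
        by_contra hodd
        obtain ⟨k, hk⟩ := Nat.not_even_iff_odd.1 hodd
        have hle : D * r ≤ D * L := Nat.mul_le_mul_left D (by omega)
        have e : 2 * (k + 1) - 1 = D * r := by omega
        refine hnot ⟨k + 1, Finset.mem_coe.2 (Finset.mem_filter.2
          ⟨Finset.mem_Icc.2 ⟨by omega, ?_⟩, ?_⟩), ?_⟩
        · rw [← hD, ← hL]
          omega
        · rw [e]
          exact dvd_mul_right D r
        · simp only [e]
          exact Nat.mul_div_cancel_left _ hd
      rw [riemannZeta_neg_nat_eq_bernoulli, bernoulli_eq_zero_of_odd heven.add_one (by omega)]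
      simp
    · intro k hk
      obtain ⟨h1, h2, -, -⟩ := hdata k hk
      obtain ⟨i, rfl⟩ : ∃ i, k = i + 1 := ⟨k - 1, by omega⟩
      have e : D * ((2 * (i + 1) - 1) / D) = 2 * i + 1 := by omega
      have e2 : (-1 : ℂ) ^ (2 * i + 1) = -1 := Odd.neg_one_pow ⟨i, rfl⟩
      rw [e, riemannZeta_neg_nat_eq_bernoulli, e2, show 2 * i + 1 + 1 = 2 * (i + 1) by ring]
      push_cast
      ring
  rw [Finset.sum_neg_distrib] at hsum
  rw [Finset.range_eq_Ico, Finset.sum_eq_sum_Ico_succ_bot (by omega), hsum.symm, mul_zero,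
    Nat.cast_zero, neg_zero, riemannZeta_zero, Nat.choose_zero_right]
  push_cast
  ring

/-- At a point with at most the singular hyperplane of the second variable, the term `termH` is
the value of the recursion for the continuation. -/
lemma termH_eq_zetaFun (hd : ∀ j, 0 < d j) (hγ : ∀ j, 0 < (γ j).re) {N : Fin (n + 2) → ℕ}
    (hp : OffPolesBut d (fun j => -(N j : ℂ))) :
    termH d γ N = zetaFun (n + 1) d γ (fun j => -(N j : ℂ)) := by
  have hcont : ∀ r : ℕ, zetaCont (Fin.init d) (Fin.init γ) (mergedPoint N r) =
      zetaFun n (Fin.init d) (Fin.init γ) (mergeLast (fun j => -(N j : ℂ)) (r : ℂ)) := by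
    intro r
    rw [mergedPoint_eq_mergeLast]
    exact (isZetaContinuation_zetaFun (fun _ => hd _) (fun _ => hγ _)).zetaCont_eq
      (analyticAt_zetaFun (fun _ => hd _) (fun _ => hγ _) (hp.mergeLast_nat r))
  have h := sum_riemannZeta_neg_mul (hd (Fin.last (n + 1))) N fun k =>
    γ (Fin.last (n + 1)) ^ k * zetaFun n (Fin.init d) (Fin.init γ)
      (mergeLast (fun j => -(N j : ℂ)) (k : ℂ))
  rw [zetaFun_of_last_eq_neg hd hγ (N := N (Fin.last (n + 1))) rfl, termH, hcont]
  simp_rw [hcont]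
  simp only [← mul_assoc] at h
  rw [h, pow_zero, mul_one]

end Values

/-! ### Regularity along a line -/

lemma eventually_ne_neg_nat {x c : ℂ} (h : (∃ l : ℕ, x = -l) → c ≠ 0) :
    ∀ᶠ t : ℂ in 𝓝[≠] 0, ∀ l : ℕ, x + t * c ≠ -l := by
  have key : ∀ᶠ t : ℂ in 𝓝[≠] 0, Complex.Gamma (x + t * c) ≠ 0 := by
    by_cases hx : ∃ l : ℕ, x = -l
    · obtain ⟨M, rfl⟩ := hx
      have hc := h ⟨M, rfl⟩
      have h0 : ((-1 : ℂ) ^ M / (M.factorial * c)) ≠ 0 :=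
        div_ne_zero (pow_ne_zero _ (by norm_num))
          (mul_ne_zero (by exact_mod_cast M.factorial_ne_zero) hc)
      exact ((tendsto_mul_Gamma_line M hc).eventually_ne h0).mono fun t ht =>
        right_ne_zero_of_mul ht
    · have hG : Complex.Gamma x ≠ 0 := fun h0 => hx ((Complex.Gamma_eq_zero_iff x).1 h0)
      have hc : ContinuousAt (fun t : ℂ => (Complex.Gamma (x + t * c))⁻¹) 0 :=
        ContinuousAt.comp (f := fun t : ℂ => x + t * c) (g := fun z => (Complex.Gamma z)⁻¹)
          (analyticAt_inv_Gamma _).continuousAt (by fun_prop)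
      have h1 := hc.eventually_ne (y := 0) (by simpa using hG)
      exact (h1.filter_mono nhdsWithin_le_nhds).mono fun t ht h0 => ht (by rw [h0, inv_zero])
  filter_upwards [key] with t ht l hl
  exact ht ((Complex.Gamma_eq_zero_iff _).2 ⟨l, hl⟩)

lemma sum_Ici_eq_tailSum {R : Type*} [AddCommMonoid R] {n : ℕ} (x : Fin n → R) (j : Fin n) :
    ∑ k ∈ Finset.Ici j, x k = tailSum x ((j : ℕ) + 1) := by
  refine Finset.sum_congr ?_ fun _ _ => rfl
  ext k
  rw [Finset.mem_Ici, Finset.mem_filter_univ, Fin.le_def, Nat.succ_le_succ_iff]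

lemma OffPolesBut.eventually_offPoles {n : ℕ} {d : Fin n → ℕ} {p : Fin n → ℂ}
    (hp : OffPolesBut d p) {θ : Fin n → ℂ} (hθ : tailSum θ 2 ≠ 0) :
    ∀ᶠ t : ℂ in 𝓝[≠] 0, OffPoles d (p + t • θ) := by
  refine eventually_all.2 fun j => (eventually_all (ι := Finset (Fin n))).2 fun E => ?_
  by_cases hE : E ⊆ Finset.Ioi j
  · have h := eventually_ne_neg_nat (x := ∑ k ∈ Finset.Ici j, p k -
        (1 / (d j : ℂ) + ∑ k ∈ E, 1 / (d k : ℂ))) (c := ∑ k ∈ Finset.Ici j, θ k) (by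
      rintro ⟨l, hl⟩
      have h1 := (hp j E hE l (by linear_combination hl)).1
      rwa [sum_Ici_eq_tailSum, h1])
    filter_upwards [h] with t ht _ l hl
    refine ht l ?_
    simp only [Pi.add_apply, Pi.smul_apply, smul_eq_mul, Finset.sum_add_distrib,
      ← Finset.mul_sum] at hl
    linear_combination hl
  · exact Eventually.of_forall fun t h => absurd h hE

/-- If only `1/d₂ + ⋯ + 1/dₙ` among the sums `1/dⱼ + ∑_{k ∈ E} 1/dₖ` is an integer, then the points
of `-ℕⁿ` lie on no other singular hyperplane than that of the second variable. -/
lemma offPolesBut_neg_nat {n : ℕ} {d : Fin n → ℕ} (hd : ∀ j, 0 < d j)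
    (hira : ∀ j : Fin n, ∀ E ⊆ Finset.Ioi j,
      (∃ a : ℕ, recip d j + ∑ k ∈ E, recip d k = a) → ((j : ℕ) + 1 = 2 ∧ E = Finset.Ioi j))
    (N : Fin n → ℕ) : OffPolesBut d (fun j => -(N j : ℂ)) := by
  intro j E hE l h
  -- the sum of reciprocals is positive and an integer, hence a natural number
  have hpos : 0 < recip d j + ∑ k ∈ E, recip d k := by
    have h1 : 0 < recip d j := by
      have := hd j
      simp only [recip]
      positivity
    have h2 : 0 ≤ ∑ k ∈ E, recip d k := Finset.sum_nonneg fun k _ => by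
      simp only [recip]
      positivity
    linarith
  have hq : recip d j + ∑ k ∈ E, recip d k = ((l - ∑ k ∈ Finset.Ici j, (N k : ℤ) : ℤ) : ℚ) := by
    have : ((recip d j + ∑ k ∈ E, recip d k : ℚ) : ℂ) =
        (((l - ∑ k ∈ Finset.Ici j, (N k : ℤ) : ℤ) : ℚ) : ℂ) := by
      rw [Finset.sum_neg_distrib] at h
      simp only [recip]
      push_cast
      linear_combination -h
    exact_mod_cast this
  have h0 : 0 ≤ l - ∑ k ∈ Finset.Ici j, (N k : ℤ) := by
    rw [hq] at hpos
    exact_mod_cast hpos.le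
  obtain ⟨a, ha⟩ := Int.eq_ofNat_of_zero_le h0
  obtain ⟨h1, h2⟩ := hira j E hE ⟨a, by rw [hq, ha, Int.cast_natCast]⟩
  exact ⟨by omega, h2⟩

/-! ### The limit at a point of indeterminacy -/

/-- The simple zero of `1 / Γ` in the last variable meets the simple pole of the continuation in
one variable less. -/
theorem tendsto_zetaFun_neg_nat {n : ℕ} {d : Fin (n + 3) → ℕ} (hd : ∀ j, 0 < d j)
    {γ : Fin (n + 3) → ℂ} (hγ : ∀ j, 0 < (γ j).re) {N : Fin (n + 3) → ℕ}
    (hp : OffPolesBut d (fun j => -(N j : ℂ))) {M : ℕ}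
    (hM : (M : ℚ) = (tailSum N 2 : ℕ) + tailSum (recip d) 2) {θ : Fin (n + 3) → ℂ}
    (hθ : tailSum θ 2 ≠ 0) (hθn : θ (Fin.last (n + 2)) ≠ 0) :
    Tendsto (fun t : ℂ => zetaFun (n + 2) d γ ((fun j => -(N j : ℂ)) + t • θ)) (𝓝[≠] 0)
      (𝓝 ((prodFactors d N 0 : ℂ) *
          (∏ j : Fin (n + 3) with 2 ≤ j.val + 1, thetaLead (γ j) (d j)) *
          ((-1) ^ M / (M.factorial * tailSum θ 2)) *
          (γ 0 ^ (N 0 + M) * riemannZeta (-((d 0 * (N 0 + M) : ℕ) : ℂ))) *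
          ((-1) ^ N (Fin.last (n + 2)) * (N (Fin.last (n + 2))).factorial *
            θ (Fin.last (n + 2))) +
        zetaFun (n + 2) d γ (fun j => -(N j : ℂ)))) := by
  have hpN := negPoint_zero N
  rw [← hpN] at hp ⊢
  set p := negPoint N 0 with hp_def
  have hpl : p (Fin.last (n + 2)) = -(N (Fin.last (n + 2)) : ℂ) := by rw [hpN]
  obtain ⟨K, hK, hNK⟩ := ((eventually_mem_remDomain (Fin.init d) p).and
    (eventually_gt_atTop (N (Fin.last (n + 2))))).exists
  have hrest := tendsto_comp_line (analyticAt_zetaRest hd hγ (K := K)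
    (F := zetaFun (n + 1) (Fin.init d) (Fin.init γ))
    (fun k => analyticAt_zetaFun (fun _ => hd _) (fun _ => hγ _) (hp.mergeLast_nat k))
    hK).continuousAt θ
  rw [zetaRest_of_last_eq_neg hpl _ hNK, ← zetaFun_of_last_eq_neg hd hγ hpl] at hrest
  have hmerge : mergeLast p (-(1 / (d (Fin.last (n + 2)) : ℂ))) =
      negPoint (mergeLast N 0) (0 + 1 / (d (Fin.last (n + 2)) : ℚ)) := by
    rw [← mergeLast_negPoint, ← hp_def]
    push_cast
    rfl
  have hδ' : (0 : ℚ) ≤ 0 + 1 / (d (Fin.last (n + 2)) : ℚ) := by positivity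
  have hp' := hp.mergeLast_neg
  rw [hmerge] at hp'
  have hM' : (M : ℚ) = (tailSum (mergeLast N 0) 2 : ℕ) + (0 + 1 / (d (Fin.last (n + 2)) : ℚ)) +
      tailSum (recip (Fin.init d)) 2 := by
    rw [hM, tailSum_mergeLast N 0 (by omega), tailSum_eq_init_add (recip d) (by omega), recip_init]
    simp only [recip, add_zero]
    ring
  have hθ' : tailSum (mergeLast θ 0) 2 ≠ 0 := by
    rwa [tailSum_mergeLast θ 0 (by omega), add_zero]
  have hlim := tendsto_mul_zetaFun_negPoint (d := Fin.init d) (fun _ => hd _) (γ := Fin.init γ)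
    (fun _ => hγ _) (N := mergeLast N 0) hδ' hp' hM' hθ'
  have hGamma := tendsto_comp_line (f := fun s : Fin (n + 3) → ℂ =>
      Complex.Gamma (s (Fin.last (n + 2)) - 1 / (d (Fin.last (n + 2)) : ℂ)))
    ((analyticAt_Gamma (hp.last (by omega))).comp
      (f := fun s : Fin (n + 3) → ℂ => s (Fin.last (n + 2)) - 1 / (d (Fin.last (n + 2)) : ℂ))
      ((analyticAt_apply _ _).sub analyticAt_const)).continuousAt θ
  have hzero := tendsto_inv_Gamma_line_div (N (Fin.last (n + 2))) hθn
  have h1 := ((((hGamma.const_mul (thetaLead (γ (Fin.last (n + 2)))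
    (d (Fin.last (n + 2))))).mul hzero).mul hlim)).add hrest
  have hG := Gamma_mul_prodFactors le_rfl (hp.last (by omega))
  have hprod : (∏ j : Fin (n + 3) with 2 ≤ j.val + 1, thetaLead (γ j) (d j)) =
      (∏ j : Fin (n + 2) with 2 ≤ j.val + 1, thetaLead (Fin.init γ j) (Fin.init d j)) *
        thetaLead (γ (Fin.last (n + 2))) (d (Fin.last (n + 2))) := by
    rw [Finset.prod_filter, Finset.prod_filter, Fin.prod_univ_castSucc]
    simp [Fin.init]
  have e0 : mergeLast N 0 0 = N 0 := by
    simp [mergeLast, Fin.init]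
  rw [e0, tailSum_mergeLast θ 0 (by omega), add_zero] at h1
  rw [hprod, ← hG]
  have hmem : ∀ᶠ t : ℂ in 𝓝[≠] 0, p + t • θ ∈ remDomain (Fin.init d) K :=
    (tendsto_comp_line (f := id) continuousAt_id θ).eventually
      ((isOpen_remDomain _ K).mem_nhds hK)
  convert! h1.congr' ?_ using 2
  · simp only [Fin.init, Fin.castSucc_zero]
    ring
  · filter_upwards [hmem, self_mem_nhdsWithin] with t htK ht0
    have ht : t ≠ 0 := ht0
    rw [zetaFun_eq_zetaStep hd hγ htK, zetaStep, mergeLast_add_smul, hmerge, leadFactor]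
    simp only [Pi.add_apply, Pi.smul_apply, smul_eq_mul, hpl]
    field_simp

/-! ### The constant of the limit -/

lemma constC_ne_zero {m : ℕ} {d : Fin (m + 1) → ℕ} (hd : ∀ j, 0 < d j) (N : Fin (m + 1) → ℕ)
    (b : ℕ) : constC d N b ≠ 0 := by
  have hd0 : (0 : ℚ) < d 0 := by exact_mod_cast hd 0
  refine mul_ne_zero (Finset.prod_ne_zero_iff.2 fun j _ => Finset.prod_ne_zero_iff.2 fun u hu => ?_)
    (div_ne_zero (mul_ne_zero (pow_ne_zero _ (by norm_num)) (by positivity))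
      (mul_ne_zero (mul_ne_zero (by positivity) (Finset.prod_ne_zero_iff.2 fun k _ => ?_))
        (by positivity)))
  · have hu' := (Finset.mem_Ico.1 hu).2
    have hu0 : (u : ℚ) < 0 := by exact_mod_cast (by omega : u < 0)
    have h1 : 0 ≤ tailSum (recip d) j := Finset.sum_nonneg fun k _ => by
      simp only [recip]
      positivity
    linarith
  · exact_mod_cast (hd k).ne'

/-- The limit in terms of `constC` and Bernoulli numbers. -/
lemma constC_mul_bernoulli {n : ℕ} (d : Fin (n + 3) → ℕ) (γ : Fin (n + 3) → ℂ)
    (N : Fin (n + 3) → ℕ) (b : ℕ) (θ : Fin (n + 3) → ℂ) :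
    (prodFactors d N 0 : ℂ) * (∏ j : Fin (n + 3) with 2 ≤ j.val + 1, thetaLead (γ j) (d j)) *
        ((-1) ^ (tailSum N 2 + b) / ((tailSum N 2 + b).factorial * tailSum θ 2)) *
        (γ 0 ^ (N 0 + (tailSum N 2 + b)) *
          riemannZeta (-((d 0 * (N 0 + (tailSum N 2 + b)) : ℕ) : ℂ))) *
        ((-1) ^ N (Fin.last (n + 2)) * (N (Fin.last (n + 2))).factorial *
          θ (Fin.last (n + 2))) =
      (constC d N b : ℂ) * ((bernoulli (d 0 * ((∑ k, N k) + b) + 1) : ℚ) : ℂ) *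
        (γ 0 ^ ((∑ k, N k) + b) *
          ∏ j : Fin (n + 3) with 2 ≤ j.val + 1, γ j ^ (-(1 / (d j : ℂ)))) *
        (θ (Fin.last (n + 2)) / tailSum θ 2) *
        (∏ j : Fin (n + 3) with 2 ≤ j.val + 1, Complex.Gamma (1 / (d j : ℂ))) := by
  have hsum : ∑ k, N k = N 0 + tailSum N 2 := by
    rw [Fin.sum_univ_succ, tailSum, Finset.sum_filter, Fin.sum_univ_succ (n := n + 2)]
    simp
  have htail : tailSum N 2 = (∑ k : Fin (n + 3) with 2 ≤ k.val + 1 ∧ k.val + 1 ≤ n + 2, N k) +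
      N (Fin.last (n + 2)) := by
    rw [tailSum, Finset.sum_filter, Finset.sum_filter, Fin.sum_univ_castSucc,
      Fin.sum_univ_castSucc (n := n + 2)]
    have h : ∀ k : Fin (n + 2), (k : ℕ) + 1 ≤ n + 2 := fun k => by omega
    simp [h]
  have hsign : ∀ c : ℕ, (-1 : ℂ) ^ (tailSum N 2 + b) * (-1) ^ N (Fin.last (n + 2)) * (-1) ^ c =
      (-1) ^ ((∑ k : Fin (n + 3) with 2 ≤ k.val + 1 ∧ k.val + 1 ≤ n + 2, N k) + b + c) := by
    intro c
    have h1 : (-1 : ℂ) ^ N (Fin.last (n + 2)) * (-1) ^ N (Fin.last (n + 2)) = 1 := by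
      rw [← mul_pow]
      norm_num
    rw [htail]
    simp only [pow_add]
    linear_combination (-1 : ℂ) ^ (∑ k : Fin (n + 3) with 2 ≤ k.val + 1 ∧ k.val + 1 ≤ n + 2, N k) *
      (-1) ^ b * (-1) ^ c * h1
  have he : N 0 + (tailSum N 2 + b) = (∑ k, N k) + b := by rw [hsum, add_assoc]
  have hlead : (∏ j : Fin (n + 3) with 2 ≤ j.val + 1, thetaLead (γ j) (d j)) =
      (∏ j : Fin (n + 3) with 2 ≤ j.val + 1, Complex.Gamma (1 / (d j : ℂ))) *
        (∏ j : Fin (n + 3) with 2 ≤ j.val + 1, γ j ^ (-(1 / (d j : ℂ)))) /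
        (∏ j : Fin (n + 3) with 2 ≤ j.val + 1, (d j : ℂ)) := by
    rw [← Finset.prod_mul_distrib, ← Finset.prod_div_distrib]
    refine Finset.prod_congr rfl fun j _ => ?_
    rw [thetaLead]
    ring
  have hfactors : prodFactors d N 0 = ∏ j ∈ Finset.Icc 3 (n + 2 + 1),
      ∏ u ∈ Finset.Ico (-((tailSum N (j - 1) : ℕ) : ℤ)) (-((tailSum N j : ℕ) : ℤ)),
        ((u : ℚ) - tailSum (recip d) j) := by
    simp only [prodFactors, sub_zero]
  rw [he, hlead, riemannZeta_neg_nat_eq_bernoulli, constC, ← hfactors]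
  simp only [Rat.cast_mul, Rat.cast_div, Rat.cast_pow, Rat.cast_neg, Rat.cast_one,
    Rat.cast_natCast, Rat.cast_add, Rat.cast_prod, Nat.cast_mul, Nat.cast_add]
  rw [← hsign]
  simp only [div_eq_mul_inv, mul_inv]
  ring

end

end

/-- Here `n = m + 1`; the entry number `j` (counted from `1`) of a vector has index `j - 1`. -/
theorem theorem2 (m : ℕ) (hn : 3 ≤ m + 1)
    (d : Fin (m + 1) → ℕ) (hd : ∀ j, 0 < d j)
    (γ : Fin (m + 1) → ℂ) (hγ : ∀ j, 0 < (γ j).re)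
    -- `1/dⱼ + ∑_{k > j} εₖ/dₖ` is an integer iff `j = 2` and all `εₖ = 1`; `E = {k | εₖ = 1}`
    (hira : ∀ j : Fin (m + 1), ∀ E ⊆ Finset.Ioi j,
      (∃ a : ℕ, recip d j + ∑ k ∈ E, recip d k = a) ↔ ((j : ℕ) + 1 = 2 ∧ E = Finset.Ioi j))
    (N : Fin (m + 1) → ℕ)
    (θ : Fin (m + 1) → ℂ) (hθ : tailSum θ 2 ≠ 0) (hθn : θ (Fin.last m) ≠ 0) :
    ∃ b : ℕ, 0 < b ∧ (b : ℚ) = tailSum (recip d) 2 ∧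
      constC d N b ≠ 0 ∧
      -- the points at which the continued zeta functions are evaluated are regular
      (∀ᶠ t : ℂ in 𝓝[≠] 0, ZetaRegularAt d γ (fun j => -(N j : ℂ) + t * θ j)) ∧
      ZetaRegularAt (n := m) (Fin.init d) (Fin.init γ) (mergedPoint N 0) ∧
      (∀ k ∈ indexH d N, ZetaRegularAt (n := m) (Fin.init d) (Fin.init γ)
        (mergedPoint N ((2 * k - 1) / d (Fin.last m)))) ∧
      -- the rationality of the remaining term and the directional limit
      termH d γ N ∈ IntermediateField.adjoin ℚ (Set.range γ) ∧
      Tendsto (fun t : ℂ => zetaCont d γ (fun j => -(N j : ℂ) + t * θ j)) (𝓝[≠] 0)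
        (𝓝 ((constC d N b : ℂ) * ((bernoulli (d 0 * ((∑ k, N k) + b) + 1) : ℚ) : ℂ) *
            (γ 0 ^ ((∑ k, N k) + b) *
              ∏ j : Fin (m + 1) with 2 ≤ j.val + 1, γ j ^ (-(1 / (d j : ℂ)))) *
            (θ (Fin.last m) / tailSum θ 2) *
            (∏ j : Fin (m + 1) with 2 ≤ j.val + 1, Complex.Gamma (1 / (d j : ℂ))) +
          termH d γ N)) := by
  obtain ⟨n, rfl⟩ : ∃ n, m = n + 2 := ⟨m - 2, by omega⟩
  have hp := offPolesBut_neg_nat hd (fun j E hE h => (hira j E hE).1 h) N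
  have hIoi : recip d 1 + ∑ k ∈ Finset.Ioi (1 : Fin (n + 3)), recip d k = tailSum (recip d) 2 := by
    rw [← Finset.sum_insert (by simp), Finset.Ioi_insert, sum_Ici_eq_tailSum]
    rfl
  obtain ⟨b, hb⟩ := (hira 1 (Finset.Ioi 1) subset_rfl).2 ⟨rfl, rfl⟩
  rw [hIoi] at hb
  have hreg := hp.eventually_offPoles hθ
  have hline : ∀ t : ℂ, (fun j => -(N j : ℂ) + t * θ j) = (fun j => -(N j : ℂ)) + t • θ :=
    fun _ => rfl
  have hmerged : ∀ r : ℕ, ZetaRegularAt (n := n + 2) (Fin.init d) (Fin.init γ)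
      (mergedPoint N r) := fun r =>
    ⟨_, isZetaContinuation_zetaFun (fun _ => hd _) (fun _ => hγ _), by
      rw [mergedPoint_eq_mergeLast]
      exact analyticAt_zetaFun (fun _ => hd _) (fun _ => hγ _) (hp.mergeLast_nat r)⟩
  have hH := termH_eq_zetaFun hd hγ hp
  refine ⟨b, ?_, hb.symm, constC_ne_zero hd N b, ?_, hmerged 0, fun k _ => hmerged _, ?_, ?_⟩
  · have h1 : (0 : ℚ) < tailSum (recip d) 2 := Finset.sum_pos (fun k _ => by
      have := hd k
      simp only [recip]
      positivity) ⟨1, by simp⟩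
    rw [hb] at h1
    exact_mod_cast h1
  · filter_upwards [hreg] with t ht
    exact ⟨_, isZetaContinuation_zetaFun hd hγ, analyticAt_zetaFun hd hγ (by rwa [hline])⟩
  · rw [hH]
    exact zetaFun_neg_nat_mem _ hd hγ
      (fun j => IntermediateField.subset_adjoin ℚ _ (Set.mem_range_self j)) N
  · have hlim := tendsto_zetaFun_neg_nat hd hγ hp (M := tailSum N 2 + b)
      (by rw [hb]; push_cast; rfl) hθ hθn
    have hval := constC_mul_bernoulli d γ N b θ
    rw [← hval, hH]
    refine hlim.congr' ?_
    filter_upwards [hreg] with t ht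
    rw [hline]
    exact ((isZetaContinuation_zetaFun hd hγ).zetaCont_eq (analyticAt_zetaFun hd hγ ht)).symm
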